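/- **Setting.** Let $p$ be a prime and $B$ a definite quaternion algebra over $\mathbb Q$, split at $p$, with a fixed identification $B_p=B\otimes\mathbb Q_p\simeq M_2(\mathbb Q_p)$. Put $B_f^\times=(B\otimes\mathbb A_f)^\times$, $Z_f=\mathbb A_f^\times$, and let $\mu$ be a Haar measure on $B_f^\times$ with rational values on compact open subgroups. Let $N_f(z)=|z|_{\mathbb A_f}^{-1}\in\mathbb Q_{>0}$ for $z\in Z_f$, so that $z/N_f(z)\in\widehat{\mathbb Z}^\times$, and $\mathrm{Nrd}_p(x)=N_f(\mathrm{nrd}\,x)/\mathrm{nrd}(x_p)\in\mathbb Z_p^\times$ for $x\in B_f^\times$. Let $\mathcal O$ be a commutative $p$-adic Banach algebra over $\mathbb Q_p$. A weight is a locally analytic character $k:\mathbb Z_p^\times\to\mathcal O^\times$, written $t\mapsto t^k$, and weights are written additively. Let $W=\mathbb Z_p^\times\times\mathbb Z_p$ and $\widehat W=p\mathbb Z_p\times\mathbb Z_p^\times$. For $X=W,\widehat W$ let $\mathcal D_k(X)$ be the continuous $\mathcal O$-dual of the space of $\mathcal O$-valued locally analytic functions $F$ on $X$ with $F(tx)=t^kF(x)$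 for $t\in\mathbb Z_p^\times$. It carries the right action $(\mu\sigma)(F)=\mu(w\mapsto F(w\sigma))$ of matrices $\sigma$ with $X\sigma\subseteq X$. Let $K=K^p\times\Gamma_0(p\mathbb Z_p)$ be a compact open subgroup of $B_f^\times$. For a character $\omega$ of $\widehat{\mathbb Z}^\times$ with values in $\mathcal O^\times$, set $\omega_{0,p}^{k}(z)=\omega\big(z/N_f(z)\big)\,\big(z/N_f(z)\big)_p^{-k}$ and let $M_p(\mathcal D_k(X),\omega_{0,p}^k)^K$ be the space of maps $\varphi:B_f^\times\to\mathcal D_k(X)$ such that $\varphi(xg)=\varphi(x)$ for $g\in B^\times$, $\varphi(zx)=\omega_{0,p}^k(z)\varphi(x)$ for $z\in Z_f$, and $\varphi(ux)u_p=\varphi(x)$ for $u\in K$. For $\pi\in B_f^\times$ the operator $[K\pi K]$ is $(\varphi|[K\pi K])(y)=\sum_{x\in K\backslash K\pi K}\varphi(xy)x_p$. The operator $U_p$ on forms with values in $\mathcal D_k(W)$, respectively $U_p^\iota$ on forms with values in $\mathcal D_k(\widehat W)$, is $[K\pi K]$ for $\pi$ concentrated at $p$ with $\pi_p=\begin{pmatrix}1&0\\0&p\end{pmatrix}$,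 respectively $\pi_p=\begin{pmatrix}p&0\\0&1\end{pmatrix}$. Let $k_1,k_2,k_3,\underline k^*$ be weights with $2\underline k^*=k_1+k_2+k_3$, and set $\underline k_i^*=\underline k^*-k_i$. Suppose that $\underline k_3^*$ extends to a multiplicative, locally analytic function $x\mapsto x^{\underline k_3^*}$ from $\mathbb Z_p$ to $\mathcal O$; $p^{\underline k_3^*}$ denotes its value at $p$. (Example: $k_1,k_2,k_3\in\mathbb N$ with even sum and $k_3\le k_1+k_2$.) Write $\delta(v,w)=v_1w_2-v_2w_1$. On $W\times W\times\widehat W$ let $$\Delta(w_1,w_2,w_3)=\delta(w_2,w_3)^{\underline k_1^*}\,\delta(w_1,w_3)^{\underline k_2^*}\,\delta(w_1,w_2)^{\underline k_3^*},$$ and let $\Delta^\circ$ be the function equal to $\Delta$ where $\delta(w_1,w_2)\in\mathbb Z_p^\times$ and to $0$ elsewhere. Let $\omega_{0,1},\omega_{0,2},\omega_{0,3}:\widehat{\mathbb Z}^\times\to\mathcal O^\times$ be characters with product $1$. For $\varphi_i\in M_p(\mathcal D_{k_i}(W),\omega_{0,p}^{k_i})^K$ ($i=1,2$) and $\varphi_3\in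 M_p(\mathcal D_{k_3}(\widehat W),\omega_{0,p}^{k_3})^K$, where $\omega_{0,p}^{k_i}$ is formed from $\omega_{0,i}$, put $$t_{3,\underline k}(\varphi_1\otimes\varphi_2\otimes\varphi_3)=\mu(K)\sum_{x\in K\backslash B_f^\times/B^\times}\frac{(\varphi_1(x)\boxtimes\varphi_2(x)\boxtimes\varphi_3(x))(\Delta)}{|B^\times\cap x^{-1}Kx|\;\mathrm{Nrd}_p(x)^{\underline k^*}},$$ and define $t^\circ_{3,\underline k}$ by the same formula with $\Delta^\circ$ in place of $\Delta$. Here $(\mu_1\boxtimes\mu_2\boxtimes\mu_3)(\Delta)$ is the iterated integral of $\Delta$. **Corollary.** Suppose $\varphi_1|U_p=\alpha_1\varphi_1$, $\varphi_2|U_p=\alpha_2\varphi_2$ with $\alpha_1,\alpha_2\in\mathcal O^\times$, and $\varphi_3|U_p^\iota=\alpha_3\varphi_3$ with $\alpha_3\in\mathcal O$. Then $$t^\circ_{3,\underline k}(\varphi_1\otimes\varphi_2\otimes\varphi_3)=\Big(1-\omega_{0,3}(\mathbf p')\,\frac{\alpha_3}{\alpha_1\alpha_2}\,p^{\underline k_3^*}\Big)\,t_{3,\underline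 k}(\varphi_1\otimes\varphi_2\otimes\varphi_3),$$ where $\mathbf p'\in\widehat{\mathbb Z}^\times$ has component $p$ at every prime different from $p$ and component $1$ at $p$. -/

import Mathlib

open scoped RestrictedProduct

noncomputable section

namespace TripleProduct

instance factPrime (q : Nat.Primes) : Fact (Nat.Prime (q : ℕ)) := ⟨q.2⟩

/-! ### Locally analytic functions -/

/-- `F` is locally analytic with uniform radius `r` and bound `C`: around every point `x` it is
given on the ball of radius `r` by a power series whose coefficients `q n` satisfy
`‖q n‖ * r ^ n ≤ C`. For fixed `r` the least such `C` is the Gauss norm of the Banach space of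
functions analytic on all balls of radius `r`. -/
def HasExpansions {p : Nat.Primes} {E O : Type*} [NormedAddCommGroup E] [NormedSpace ℚ_[p] E]
    [NormedAddCommGroup O] [NormedSpace ℚ_[p] O] (F : E → O) (r C : ℝ) : Prop :=
  ∀ x : E, ∃ q : FormalMultilinearSeries ℚ_[p] E O,
    (∀ n, ‖q n‖ * r ^ n ≤ C) ∧
      ∀ y : E, ‖y‖ < r → HasSum (fun n => q n (fun _ => y)) (F (x + y))

/-- Local analyticity. It is used only for functions vanishing outside a compact open set (the
extension by zero of a function on that set), for which the radius may be chosen uniformly. -/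
def IsLocAnalytic {p : Nat.Primes} {E O : Type*} [NormedAddCommGroup E] [NormedSpace ℚ_[p] E]
    [NormedAddCommGroup O] [NormedSpace ℚ_[p] O] (F : E → O) : Prop :=
  ∃ r : ℝ, 0 < r ∧ ∃ C : ℝ, HasExpansions (p := p) F r C

section Expansions

variable {p : Nat.Primes} {E O : Type*} [NormedAddCommGroup E] [NormedSpace ℚ_[p] E]

theorem HasExpansions.nonneg [NormedAddCommGroup O] [NormedSpace ℚ_[p] O] {F : E → O} {r C : ℝ}
    (h : HasExpansions (p := p) F r C) : 0 ≤ C := by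
  obtain ⟨q, hq, -⟩ := h 0
  have := hq 0
  simp only [pow_zero, mul_one] at this
  exact (norm_nonneg _).trans this

theorem HasExpansions.mono [NormedAddCommGroup O] [NormedSpace ℚ_[p] O] {F : E → O}
    {r r' C : ℝ} (h : HasExpansions (p := p) F r C) (h0 : 0 < r') (hr : r' ≤ r) :
    HasExpansions (p := p) F r' C := by
  intro x
  obtain ⟨q, hq, hs⟩ := h x
  refine ⟨q, fun n => le_trans ?_ (hq n), fun y hy => hs y (hy.trans_le hr)⟩
  gcongr

theorem HasExpansions.add [NormedAddCommGroup O] [NormedSpace ℚ_[p] O] {F G : E → O}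
    {r C D : ℝ} (hr : 0 < r) (hF : HasExpansions (p := p) F r C)
    (hG : HasExpansions (p := p) G r D) : HasExpansions (p := p) (F + G) r (C + D) := by
  intro x
  obtain ⟨q, hq, hs⟩ := hF x
  obtain ⟨q', hq', hs'⟩ := hG x
  refine ⟨q + q', fun n => ?_, fun y hy => ?_⟩
  · have h1 : ‖(q + q') n‖ ≤ ‖q n‖ + ‖q' n‖ := norm_add_le _ _
    have h2 : 0 ≤ r ^ n := by positivity
    nlinarith [hq n, hq' n, mul_le_mul_of_nonneg_right h1 h2]
  · exact (hs y hy).add (hs' y hy)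

theorem HasExpansions.smul [NormedCommRing O] [NormedAlgebra ℚ_[p] O] {F : E → O}
    {r C : ℝ} (hr : 0 < r) (hF : HasExpansions (p := p) F r C) (c : O) :
    HasExpansions (p := p) (c • F) r (‖c‖ * C) := by
  intro x
  obtain ⟨q, hq, hs⟩ := hF x
  refine ⟨fun n => (ContinuousLinearMap.mul ℚ_[p] O c).compContinuousMultilinearMap (q n),
    fun n => ?_, fun y hy => ?_⟩
  · have h1 := ContinuousLinearMap.norm_compContinuousMultilinearMap_le
      (ContinuousLinearMap.mul ℚ_[p] O c) (q n)
    have h2 : ‖ContinuousLinearMap.mul ℚ_[p] O c‖ ≤ ‖c‖ :=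
      ContinuousLinearMap.opNorm_mul_apply_le ℚ_[p] O c
    calc _ ≤ (‖c‖ * ‖q n‖) * r ^ n := by gcongr; exact h1.trans (by gcongr)
      _ = ‖c‖ * (‖q n‖ * r ^ n) := by ring
      _ ≤ _ := by gcongr; exact hq n
  · simpa using (hs y hy).mul_left c

theorem IsLocAnalytic.zero [NormedAddCommGroup O] [NormedSpace ℚ_[p] O] :
    IsLocAnalytic (p := p) (0 : E → O) :=
  ⟨1, one_pos, 0, fun _ => ⟨0, fun n => by simp, fun y _ => by simp⟩⟩

theorem IsLocAnalytic.add [NormedAddCommGroup O] [NormedSpace ℚ_[p] O] {F G : E → O}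
    (hF : IsLocAnalytic (p := p) F) (hG : IsLocAnalytic (p := p) G) :
    IsLocAnalytic (p := p) (F + G) := by
  obtain ⟨r, hr, C, h⟩ := hF
  obtain ⟨s, hs, D, h'⟩ := hG
  have h0 : 0 < min r s := lt_min hr hs
  exact ⟨min r s, h0, C + D,
    (h.mono h0 (min_le_left _ _)).add h0 (h'.mono h0 (min_le_right _ _))⟩

theorem IsLocAnalytic.smul [NormedCommRing O] [NormedAlgebra ℚ_[p] O] {F : E → O}
    (hF : IsLocAnalytic (p := p) F) (c : O) : IsLocAnalytic (p := p) (c • F) := by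
  obtain ⟨r, hr, C, h⟩ := hF
  exact ⟨r, hr, _, h.smul hr c⟩

end Expansions

/-! ### Weights -/

/-- The extension by zero to `ℚ_p` of a character of `ℤ_p^×`. -/
def unitExt {p : Nat.Primes} {O : Type*} [NormedCommRing O] (k : ℤ_[p]ˣ →* Oˣ) (x : ℚ_[p]) : O :=
  open Classical in if h : ‖x‖ = 1 then (k (PadicInt.mkUnits h) : O) else 0

/-- The extension by zero to `ℚ_p` of a multiplicative function on `ℤ_p`. -/
def intExt {p : Nat.Primes} {O : Type*} [NormedCommRing O] (κ : ℤ_[p] →* O) (x : ℚ_[p]) : O :=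
  open Classical in if h : ‖x‖ ≤ 1 then κ ⟨x, h⟩ else 0

/-- An `O`-weight: a locally analytic character `ℤ_p^× → O^×`. -/
def IsWeight {p : Nat.Primes} {O : Type*} [NormedCommRing O] [NormedAlgebra ℚ_[p] O]
    (k : ℤ_[p]ˣ →* Oˣ) : Prop :=
  IsLocAnalytic (p := p) (unitExt k)

/-- The multiplicative function `κ` on `ℤ_p` is locally analytic and extends the character `k`
of `ℤ_p^×`. -/
structure IsAnalyticExtension {p : Nat.Primes} {O : Type*} [NormedCommRing O]
    [NormedAlgebra ℚ_[p] O] (k : ℤ_[p]ˣ →* Oˣ) (κ : ℤ_[p] →* O) : Prop where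
  analytic : IsLocAnalytic (p := p) (intExt κ)
  extends_char : ∀ t : ℤ_[p]ˣ, κ (t : ℤ_[p]) = (k t : O)

/-! ### Homogeneous functions and distributions -/

/-- Compact open subsets of `ℚ_p²` (unions of open unit balls inside `ℤ_p²`) that are stable under
multiplication by `ℤ_p^×`. -/
structure Region (p : Nat.Primes) where
  /-- The underlying set. -/
  carrier : Set (Fin 2 → ℚ_[p])
  norm_le : ∀ w ∈ carrier, ‖w‖ ≤ 1
  add_mem : ∀ w v, ‖v‖ < 1 → w ∈ carrier → w + v ∈ carrier
  smul_mem : ∀ (t : ℤ_[p]ˣ) (w), w ∈ carrier → ((t : ℤ_[p]) : ℚ_[p]) • w ∈ carrier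

theorem norm_add_eq_one {p : Nat.Primes} {x y : ℚ_[p]} (hx : ‖x‖ = 1) (hy : ‖y‖ < 1) :
    ‖x + y‖ = 1 := by
  rw [Padic.add_eq_max_of_ne (by rw [hx]; exact hy.ne'), hx, max_eq_left hy.le]

theorem norm_unit_mul {p : Nat.Primes} (t : ℤ_[p]ˣ) (x : ℚ_[p]) :
    ‖((t : ℤ_[p]) : ℚ_[p]) * x‖ = ‖x‖ := by
  rw [norm_mul, PadicInt.padic_norm_e_of_padicInt, PadicInt.norm_units, one_mul]

/-- `W = ℤ_p^× × ℤ_p`. -/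
def regionW (p : Nat.Primes) : Region p where
  carrier := {w | ‖w 0‖ = 1 ∧ ‖w 1‖ ≤ 1}
  norm_le := fun w hw => by
    rw [pi_norm_le_iff_of_nonneg zero_le_one, Fin.forall_fin_two]
    exact ⟨hw.1.le, hw.2⟩
  add_mem := fun w v hv hw => by
    rw [pi_norm_lt_iff one_pos, Fin.forall_fin_two] at hv
    exact ⟨norm_add_eq_one hw.1 hv.1,
      (Padic.nonarchimedean _ _).trans (max_le hw.2 hv.2.le)⟩
  smul_mem := fun t w hw => by
    simpa [norm_unit_mul, -norm_mul] using hw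

/-- `Ŵ = p ℤ_p × ℤ_p^×`. -/
def regionWhat (p : Nat.Primes) : Region p where
  carrier := {w | ‖w 0‖ < 1 ∧ ‖w 1‖ = 1}
  norm_le := fun w hw => by
    rw [pi_norm_le_iff_of_nonneg zero_le_one, Fin.forall_fin_two]
    exact ⟨hw.1.le, hw.2.le⟩
  add_mem := fun w v hv hw => by
    rw [pi_norm_lt_iff one_pos, Fin.forall_fin_two] at hv
    exact ⟨(Padic.nonarchimedean _ _).trans_lt (max_lt hw.1 hv.1), norm_add_eq_one hw.2 hv.2⟩
  smul_mem := fun t w hw => by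
    simpa [norm_unit_mul, -norm_mul] using hw

section Distributions

variable {p : Nat.Primes} {O : Type*} [NormedCommRing O] [NormedAlgebra ℚ_[p] O]

/-- `𝒜_k(X)`: locally analytic functions on `X`, extended by zero to `ℚ_p²`, with
`F(tx) = k(t) F(x)` for `t ∈ ℤ_p^×`. -/
def homogFun (k : ℤ_[p]ˣ →* Oˣ) (X : Region p) : Submodule O ((Fin 2 → ℚ_[p]) → O) where
  carrier := {F | (∀ w, w ∉ X.carrier → F w = 0) ∧ IsLocAnalytic (p := p) F ∧
    ∀ (t : ℤ_[p]ˣ) (w), F (((t : ℤ_[p]) : ℚ_[p]) • w) = (k t : O) * F w}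
  zero_mem' := ⟨fun _ _ => rfl, IsLocAnalytic.zero, fun _ _ => by simp⟩
  add_mem' := fun {F G} hF hG =>
    ⟨fun w hw => by simp [hF.1 w hw, hG.1 w hw], hF.2.1.add hG.2.1,
      fun t w => by simp [hF.2.2 t w, hG.2.2 t w, mul_add]⟩
  smul_mem' := fun c F hF =>
    ⟨fun w hw => by simp [hF.1 w hw], hF.2.1.smul c,
      fun t w => by simp only [Pi.smul_apply, smul_eq_mul, hF.2.2 t w]; ring⟩

/-- `𝒟_k(X)`: the `O`-linear functionals on `𝒜_k(X)` that are continuous for the locally convex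
inductive limit topology, i.e. bounded on functions of each fixed radius of analyticity. -/
def HomDist (k : ℤ_[p]ˣ →* Oˣ) (X : Region p) : Submodule O (Module.Dual O (homogFun k X)) where
  carrier := {μ | ∀ r : ℝ, 0 < r → ∃ M : ℝ, ∀ (F : homogFun k X) (C : ℝ),
    HasExpansions (p := p) F.1 r C → ‖μ F‖ ≤ M * C}
  zero_mem' := fun r _ => ⟨0, fun F C _ => by simp⟩
  add_mem' := fun {μ ν} hμ hν r hr => by
    obtain ⟨M, hM⟩ := hμ r hr
    obtain ⟨N, hN⟩ := hν r hr
    refine ⟨M + N, fun F C h => ?_⟩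
    have := norm_add_le (μ F) (ν F)
    have h1 := hM F C h
    have h2 := hN F C h
    rw [LinearMap.add_apply]
    linarith
  smul_mem' := fun c μ hμ r hr => by
    obtain ⟨M, hM⟩ := hμ r hr
    refine ⟨‖c‖ * M, fun F C h => ?_⟩
    rw [LinearMap.smul_apply, smul_eq_mul, mul_assoc]
    exact (norm_mul_le _ _).trans (by gcongr; exact hM F C h)

/-- Radius of analyticity of `F(wσ)` in terms of that of `F(w)`. -/
def pullRadius (σ : Matrix (Fin 2) (Fin 2) ℚ_[p]) (r : ℝ) : ℝ :=
  min 1 (r / (‖LinearMap.toContinuousLinearMap (Matrix.vecMulLinear σ)‖ + 1))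

theorem pullRadius_pos (σ : Matrix (Fin 2) (Fin 2) ℚ_[p]) {r : ℝ} (hr : 0 < r) :
    0 < pullRadius σ r :=
  lt_min one_pos (by positivity)

theorem HasExpansions.pull (X : Region p) (σ : Matrix (Fin 2) (Fin 2) ℚ_[p])
    {F : (Fin 2 → ℚ_[p]) → O} {r C : ℝ} (hr : 0 < r) (h : HasExpansions (p := p) F r C) :
    HasExpansions (p := p) (X.carrier.indicator fun w => F (Matrix.vecMul w σ))
      (pullRadius σ r) C := by
  have hp := pullRadius_pos σ hr
  set L := LinearMap.toContinuousLinearMap (Matrix.vecMulLinear σ) with hL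
  have hLr : ‖L‖ * pullRadius σ r ≤ r ∧ (‖L‖ + 1) * pullRadius σ r ≤ r := by
    have h1 : (‖L‖ + 1) * pullRadius σ r ≤ r := by
      have : pullRadius σ r ≤ r / (‖L‖ + 1) := min_le_right _ _
      rwa [le_div_iff₀ (by positivity), mul_comm] at this
    exact ⟨by nlinarith, h1⟩
  intro x
  by_cases hx : x ∈ X.carrier
  · obtain ⟨q, hq, hs⟩ := h (Matrix.vecMul x σ)
    refine ⟨q.compContinuousLinearMap L, fun n => ?_, fun y hy => ?_⟩
    · have h1 : ‖q.compContinuousLinearMap L n‖ ≤ ‖q n‖ * ‖L‖ ^ n := by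
        have := ContinuousMultilinearMap.norm_compContinuousLinearMap_le (q n) (fun _ => L)
        simpa [FormalMultilinearSeries.compContinuousLinearMap] using this
      calc _ ≤ (‖q n‖ * ‖L‖ ^ n) * pullRadius σ r ^ n := by gcongr
        _ = ‖q n‖ * (‖L‖ * pullRadius σ r) ^ n := by rw [mul_pow, mul_assoc]
        _ ≤ ‖q n‖ * r ^ n := by gcongr; exact hLr.1
        _ ≤ C := hq n
    · have hxy : x + y ∈ X.carrier := X.add_mem x y (hy.trans_le (min_le_left _ _)) hx
      rw [Set.indicator_of_mem hxy, Matrix.add_vecMul]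
      have hLy : ‖Matrix.vecMul y σ‖ < r := by
        have h2 : ‖L y‖ ≤ ‖L‖ * ‖y‖ := L.le_opNorm y
        have h3 : L y = Matrix.vecMul y σ := rfl
        rw [← h3]
        have : ‖L‖ * ‖y‖ ≤ ‖L‖ * pullRadius σ r := by gcongr
        nlinarith [norm_nonneg L]
      exact hs _ hLy
  · refine ⟨0, fun n => by simpa using h.nonneg, fun y hy => ?_⟩
    have hxy : x + y ∉ X.carrier := fun h' => hx (by
      have := X.add_mem (x + y) (-y) (by
        rw [norm_neg]; exact hy.trans_le (min_le_left _ _)) h'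
      simpa using this)
    rw [Set.indicator_of_notMem hxy]
    simp

/-- The action of a matrix on functions on `X`: `(σF)(w) = F(wσ)` for `w ∈ X`. It is used only for
`σ` with `Xσ ⊆ X`. -/
def pull (k : ℤ_[p]ˣ →* Oˣ) (X : Region p) (σ : Matrix (Fin 2) (Fin 2) ℚ_[p]) :
    homogFun k X →ₗ[O] homogFun k X where
  toFun F := ⟨X.carrier.indicator fun w => F.1 (Matrix.vecMul w σ), by
    refine ⟨fun w hw => Set.indicator_of_notMem hw _, ?_, fun t w => ?_⟩
    · obtain ⟨r, hr, C, h⟩ := F.2.2.1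
      exact ⟨_, pullRadius_pos σ hr, C, h.pull X σ hr⟩
    · by_cases hw : w ∈ X.carrier
      · rw [Set.indicator_of_mem hw, Set.indicator_of_mem (X.smul_mem t w hw),
          Matrix.smul_vecMul, F.2.2.2]
      · have hw' : ((t : ℤ_[p]) : ℚ_[p]) • w ∉ X.carrier := fun h' => hw (by
          have := X.smul_mem t⁻¹ _ h'
          rwa [smul_smul, ← PadicInt.coe_mul, Units.inv_mul, PadicInt.coe_one, one_smul] at this)
        rw [Set.indicator_of_notMem hw, Set.indicator_of_notMem hw', mul_zero]⟩
  map_add' F G := by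
    ext w
    by_cases hw : w ∈ X.carrier <;> simp [hw]
  map_smul' c F := by
    ext w
    by_cases hw : w ∈ X.carrier <;> simp [hw]

/-- The right action on distributions: `(μσ)(F) = μ(σF)`. -/
def distAct {k : ℤ_[p]ˣ →* Oˣ} {X : Region p} (σ : Matrix (Fin 2) (Fin 2) ℚ_[p])
    (μ : HomDist k X) : HomDist k X :=
  ⟨μ.1.comp (pull k X σ), fun r hr => by
    obtain ⟨M, hM⟩ := μ.2 _ (pullRadius_pos σ hr)
    exact ⟨M, fun F C h => hM _ C (h.pull X σ hr)⟩⟩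

/-- `∫_X f dμ`: the value of `μ ∈ 𝒟_k(X)` on the restriction to `X` of a function `f` which on `X`
is locally analytic and `k`-homogeneous (and `0` for other functions). -/
def distIntegral {k : ℤ_[p]ˣ →* Oˣ} {X : Region p} (μ : HomDist k X)
    (f : (Fin 2 → ℚ_[p]) → O) : O :=
  open Classical in
    if h : X.carrier.indicator f ∈ homogFun k X then μ.1 ⟨X.carrier.indicator f, h⟩ else 0

/-- `(μ₁ ⊠ μ₂ ⊠ μ₃)(Δ) = ∫∫∫ Δ(w₁,w₂,w₃) dμ₃(w₃) dμ₂(w₂) dμ₁(w₁)`. -/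
def tripleIntegral {k₁ k₂ k₃ : ℤ_[p]ˣ →* Oˣ} {X₁ X₂ X₃ : Region p}
    (Δ : (Fin 2 → ℚ_[p]) → (Fin 2 → ℚ_[p]) → (Fin 2 → ℚ_[p]) → O)
    (μ₁ : HomDist k₁ X₁) (μ₂ : HomDist k₂ X₂) (μ₃ : HomDist k₃ X₃) : O :=
  distIntegral μ₁ fun w₁ => distIntegral μ₂ fun w₂ => distIntegral μ₃ fun w₃ => Δ w₁ w₂ w₃

/-- `δ(v, w)`: the determinant of the matrix with rows `v` and `w`. -/
def delta (v w : Fin 2 → ℚ_[p]) : ℚ_[p] := v 0 * w 1 - v 1 * w 0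

/-- The extension by zero to `W × W × Ŵ` of the function
`Δ°₃ = δ(w₂,w₃)^{k₁*} δ(w₁,w₃)^{k₂*} δ(w₁,w₂)^{k₃*}` on `(W × W)₀ × Ŵ`, the locus where
`δ(w₁,w₂)` is a unit (`unitExt` vanishes at non-units). -/
def DeltaCirc (k₁s k₂s k₃s : ℤ_[p]ˣ →* Oˣ) (w₁ w₂ w₃ : Fin 2 → ℚ_[p]) : O :=
  unitExt k₁s (delta w₂ w₃) * unitExt k₂s (delta w₁ w₃) * unitExt k₃s (delta w₁ w₂)

/-- The function `Δ₃` on all of `W × W × Ŵ`, given by the same formula with the character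
`k₃*` of `ℤ_p^×` replaced by a multiplicative extension `κ` of it to `ℤ_p`. -/
def DeltaFull (k₁s k₂s : ℤ_[p]ˣ →* Oˣ) (κ : ℤ_[p] →* O) (w₁ w₂ w₃ : Fin 2 → ℚ_[p]) : O :=
  unitExt k₁s (delta w₂ w₃) * unitExt k₂s (delta w₁ w₃) * intExt κ (delta w₁ w₂)

end Distributions

/-! ### The quaternion algebra and its adelic points -/

/-- The quaternion algebra `(a, b)` over `R`: `i² = a`, `j² = b`, `ij = -ji`. -/
abbrev Quat (a b : ℤ) (R : Type*) [CommRing R] : Type _ := QuaternionAlgebra R (a : R) 0 (b : R)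

/-- The reduced norm. -/
def nrd (a b : ℤ) (R : Type*) [CommRing R] : Quat a b R →* R where
  toFun x := x.re ^ 2 - a * x.imI ^ 2 - b * x.imJ ^ 2 + a * b * x.imK ^ 2
  map_one' := by simp
  map_mul' x y := by simp; ring

/-- Base change of the quaternion algebra along a ring homomorphism. -/
def baseChange (a b : ℤ) {R S : Type*} [CommRing R] [CommRing S] (f : R →+* S) :
    Quat a b R →* Quat a b S where
  toFun x := ⟨f x.re, f x.imI, f x.imJ, f x.imK⟩
  map_one' := by ext <;> simp
  map_mul' x y := by ext <;> simp

instance quatTopology (q : Nat.Primes) (a c b : ℚ_[q]) :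
    TopologicalSpace (QuaternionAlgebra ℚ_[q] a c b) :=
  TopologicalSpace.induced (QuaternionAlgebra.equivProd a c b) inferInstance

/-- The order `ℤ_q ⟨1, i, j, ij⟩`. -/
def stdOrder (a b : ℤ) (q : Nat.Primes) : Submonoid (Quat a b ℚ_[q]) where
  carrier := {x | x.re ∈ PadicInt.subring q ∧ x.imI ∈ PadicInt.subring q ∧
    x.imJ ∈ PadicInt.subring q ∧ x.imK ∈ PadicInt.subring q}
  one_mem' := by simp
  mul_mem' := by
    rintro x y ⟨h1, h2, h3, h4⟩ ⟨g1, g2, g3, g4⟩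
    have ha : (a : ℚ_[q]) ∈ PadicInt.subring q := intCast_mem _ a
    have hb : (b : ℚ_[q]) ∈ PadicInt.subring q := intCast_mem _ b
    refine ⟨?_, ?_, ?_, ?_⟩ <;>
      simp only [QuaternionAlgebra.re_mul, QuaternionAlgebra.imI_mul, QuaternionAlgebra.imJ_mul,
        QuaternionAlgebra.imK_mul] <;>
      apply_rules [add_mem, sub_mem, mul_mem, zero_mem]

/-- The units of the order `ℤ_q ⟨1, i, j, ij⟩`. -/
abbrev ordUnits (a b : ℤ) (q : Nat.Primes) : Subgroup (Quat a b ℚ_[q])ˣ := (stdOrder a b q).units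

/-- `B_f^×`, the finite adelic points of `B^×`: the restricted product of the groups
`B_q^×` with its restricted product topology. -/
abbrev Bf (a b : ℤ) : Type := Πʳ q : Nat.Primes, [(Quat a b ℚ_[q])ˣ, ordUnits a b q]

instance bfMeasurable (a b : ℤ) : MeasurableSpace (Bf a b) := borel _

instance bfBorel (a b : ℤ) : BorelSpace (Bf a b) := ⟨rfl⟩

/-- The units of `ℤ_q` as a subgroup of `ℚ_q^×`. -/
abbrev intUnits (q : Nat.Primes) : Subgroup ℚ_[q]ˣ := (PadicInt.subring q).toSubmonoid.units

/-- The finite ideles `Z_f = 𝔸_f^×`. -/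
abbrev Ideles : Type := Πʳ q : Nat.Primes, [ℚ_[q]ˣ, intUnits q]

theorem eventually_rat_mem (r : ℚ) :
    ∀ᶠ q : Nat.Primes in Filter.cofinite, (r : ℚ_[q]) ∈ PadicInt.subring q := by
  have hfin : {q : Nat.Primes | (q : ℕ) ∣ r.den}.Finite := by
    refine Set.Finite.of_injOn (f := fun q : Nat.Primes => (q : ℕ)) (t := Set.Iic r.den)
      (fun q hq => Nat.le_of_dvd r.pos hq) (fun _ _ _ _ h => Subtype.ext h) (Set.finite_Iic _)
  filter_upwards [hfin.compl_mem_cofinite] with q hq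
  exact Padic.norm_rat_le_one hq

theorem eventually_quat_mem (a b : ℤ) (x : Quat a b ℚ) :
    ∀ᶠ q : Nat.Primes in Filter.cofinite,
      baseChange a b (Rat.castHom ℚ_[q]) x ∈ stdOrder a b q := by
  filter_upwards [eventually_rat_mem x.re, eventually_rat_mem x.imI, eventually_rat_mem x.imJ,
    eventually_rat_mem x.imK] with q h1 h2 h3 h4
  exact ⟨h1, h2, h3, h4⟩

/-- The diagonal embedding `B^× → B_f^×`. -/
def diag (a b : ℤ) : (Quat a b ℚ)ˣ →* Bf a b where
  toFun g := ⟨fun q => Units.map (baseChange a b (Rat.castHom ℚ_[q])) g, by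
    filter_upwards [eventually_quat_mem a b (g : Quat a b ℚ),
      eventually_quat_mem a b ((g⁻¹ : (Quat a b ℚ)ˣ) : Quat a b ℚ)] with q h1 h2
    exact Submonoid.mem_units_iff _ _ |>.2 ⟨h1, h2⟩⟩
  map_one' := RestrictedProduct.ext _ _ fun q =>
    map_one (Units.map (baseChange a b (Rat.castHom ℚ_[q])))
  map_mul' g h := RestrictedProduct.ext _ _ fun q =>
    map_mul (Units.map (baseChange a b (Rat.castHom ℚ_[q]))) g h

/-- The embedding of `Z_f` as the centre of `B_f^×`. -/
def central (a b : ℤ) (z : Ideles) : Bf a b :=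
  ⟨fun q => Units.map (algebraMap ℚ_[q] (Quat a b ℚ_[q]) : ℚ_[q] →* Quat a b ℚ_[q]) (z q), by
    filter_upwards [z.2] with q hq
    have hq' := (Submonoid.mem_units_iff _ _).1 hq
    exact (Submonoid.mem_units_iff _ _).2
      ⟨⟨hq'.1, zero_mem _, zero_mem _, zero_mem _⟩, ⟨hq'.2, zero_mem _, zero_mem _, zero_mem _⟩⟩⟩

theorem nrd_mem (a b : ℤ) (q : Nat.Primes) {x : Quat a b ℚ_[q]} (hx : x ∈ stdOrder a b q) :
    nrd a b ℚ_[q] x ∈ PadicInt.subring q := by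
  obtain ⟨h1, h2, h3, h4⟩ := hx
  have ha : (a : ℚ_[q]) ∈ PadicInt.subring q := intCast_mem _ a
  have hb : (b : ℚ_[q]) ∈ PadicInt.subring q := intCast_mem _ b
  change x.re ^ 2 - a * x.imI ^ 2 - b * x.imJ ^ 2 + a * b * x.imK ^ 2 ∈ PadicInt.subring q
  apply_rules [add_mem, sub_mem, mul_mem, pow_mem]

/-- The reduced norm `B_f^× → 𝔸_f^×`. -/
def nrdIdele {a b : ℤ} (x : Bf a b) : Ideles :=
  ⟨fun q => Units.map (nrd a b ℚ_[q]) (x q), by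
    filter_upwards [x.2] with q hq
    have hq' := (Submonoid.mem_units_iff _ _).1 hq
    exact (Submonoid.mem_units_iff _ _).2 ⟨nrd_mem a b q hq'.1, nrd_mem a b q hq'.2⟩⟩

/-- `N_f(z) = |z|_{𝔸_f}^{-1} = ∏_q q^{v_q(z_q)}`, a positive rational number. -/
def ideleNorm (z : Ideles) : ℚ :=
  ∏ᶠ q : Nat.Primes, ((q : ℕ) : ℚ) ^ (Padic.valuation (z q : ℚ_[q]))

theorem norm_prime_ne {p q : Nat.Primes} (h : q ≠ p) : ‖((p : ℕ) : ℚ_[q])‖ = 1 := by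
  rw [Padic.norm_natCast_eq_one_iff]
  exact (Nat.coprime_primes q.2 p.2).2 fun h' => h (Subtype.ext h')

theorem norm_eq_one_of_mem_intUnits {q : Nat.Primes} {u : ℚ_[q]ˣ} (hu : u ∈ intUnits q) :
    ‖(u : ℚ_[q])‖ = 1 := by
  obtain ⟨h1, h2⟩ := (Submonoid.mem_units_iff _ _).1 hu
  have h1' : ‖(u : ℚ_[q])‖ ≤ 1 := h1
  have h2' : ‖((u⁻¹ : ℚ_[q]ˣ) : ℚ_[q])‖ ≤ 1 := h2
  have h3 : ‖(u : ℚ_[q])‖ * ‖((u⁻¹ : ℚ_[q]ˣ) : ℚ_[q])‖ = 1 := by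
    rw [← norm_mul, Units.mul_inv, norm_one]
  nlinarith [norm_nonneg (u : ℚ_[q])]

theorem norm_ideleNorm (z : Ideles) (q : Nat.Primes) :
    ‖((ideleNorm z : ℚ) : ℚ_[q])‖ = ‖(z q : ℚ_[q])‖ := by
  have hfin : {r : Nat.Primes | z r ∉ intUnits r}.Finite := z.2
  have hsub : Function.mulSupport
      (fun r : Nat.Primes => ((r : ℕ) : ℚ) ^ (Padic.valuation (z r : ℚ_[r]))) ⊆
      ((insert q hfin.toFinset : Finset Nat.Primes) : Set Nat.Primes) := by
    intro r hr
    by_contra hr'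
    simp only [Finset.coe_insert, Set.Finite.coe_toFinset, Set.mem_insert_iff, Set.mem_ofPred_eq,
      not_or, not_not] at hr'
    have h1 := norm_eq_one_of_mem_intUnits hr'.2
    have h2 : Padic.valuation (z r : ℚ_[r]) = 0 := by
      rw [Padic.norm_eq_zpow_neg_valuation (z r).ne_zero,
        zpow_eq_one_iff_right₀ (Nat.cast_nonneg _)
          (by exact_mod_cast r.2.one_lt.ne')] at h1
      lia
    exact hr (by simp [h2])
  rw [ideleNorm, finprod_eq_prod_of_mulSupport_subset _ hsub, Rat.cast_prod, norm_prod,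
    Finset.prod_eq_single q]
  · rw [Padic.norm_eq_zpow_neg_valuation (z q).ne_zero]
    push_cast
    rw [norm_zpow, Padic.norm_p, inv_zpow, zpow_neg]
  · intro r _ hr
    push_cast
    rw [norm_zpow, norm_prime_ne hr.symm, one_zpow]
  · intro h
    exact absurd (Finset.mem_insert_self _ _) h

theorem norm_div_ideleNorm (z : Ideles) (q : Nat.Primes) :
    ‖(z q : ℚ_[q]) / ((ideleNorm z : ℚ) : ℚ_[q])‖ = 1 := by
  rw [norm_div, norm_ideleNorm, div_self (norm_ne_zero_iff.2 (z q).ne_zero)]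

/-- `z / N_f(z)`, an element of `Ẑ^× = ∏_q ℤ_q^×`. -/
def unitPart (z : Ideles) (q : Nat.Primes) : ℤ_[q]ˣ := PadicInt.mkUnits (norm_div_ideleNorm z q)

/-- `Nrd_p(x) = N_f(nrd x) / nrd(x_p) ∈ ℤ_p^×`. -/
def nrdP (p : Nat.Primes) {a b : ℤ} (x : Bf a b) : ℤ_[p]ˣ := (unitPart (nrdIdele x) p)⁻¹

/-- The idele `𝐩'`, an element of `Ẑ^×`: its component is `p` at every prime `q ≠ p`, and `1` at `p`. -/
def pPrime (p q : Nat.Primes) : ℤ_[q]ˣ :=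
  if h : q = p then 1 else PadicInt.mkUnits (norm_prime_ne h)

/-! ### `p`-adic modular forms -/

/-- `m ∈ Γ₀(pℤ_p)`: integral entries, unit determinant, lower left entry in `pℤ_p`. -/
def IsGamma0 {p : Nat.Primes} (m : Matrix (Fin 2) (Fin 2) ℚ_[p]) : Prop :=
  (∀ i j, ‖m i j‖ ≤ 1) ∧ ‖m.det‖ = 1 ∧ ‖m 1 0‖ < 1

section Forms

variable {p : Nat.Primes} {O : Type*} [NormedCommRing O] [NormedAlgebra ℚ_[p] O] {a b : ℤ}
  (θ : Quat a b ℚ_[p] ≃ₐ[ℚ_[p]] Matrix (Fin 2) (Fin 2) ℚ_[p])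

/-- The element of `B_f^×` concentrated at `p`, with `p`-component corresponding to `g`. -/
def atP (g : GL (Fin 2) ℚ_[p]) : Bf a b :=
  RestrictedProduct.mulSingle (fun q => ordUnits a b q) p
    (Units.map (θ.symm : Matrix (Fin 2) (Fin 2) ℚ_[p] →* Quat a b ℚ_[p]) g)

/-- The matrix of the `p`-component of `x ∈ B_f^×`. -/
def matP (x : Bf a b) : Matrix (Fin 2) (Fin 2) ℚ_[p] := θ ((x p : (Quat a b ℚ_[p])ˣ) : Quat a b ℚ_[p])

/-- `K` is an open compact subgroup of the form `K^p × Γ₀(pℤ_p)`. -/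
structure IsLevel (K : Subgroup (Bf a b)) : Prop where
  isOpen : IsOpen (K : Set (Bf a b))
  isCompact : IsCompact (K : Set (Bf a b))
  isGamma0 : ∀ x ∈ K, IsGamma0 (matP θ x)
  atP_mem : ∀ g : GL (Fin 2) ℚ_[p], IsGamma0 (g : Matrix (Fin 2) (Fin 2) ℚ_[p]) → atP θ g ∈ K

/-- The character `z ↦ ω(z / N_f(z)) (z / N_f(z))_p^{-k}` of `Z_f`. -/
def centralChar (ω : (∀ q : Nat.Primes, ℤ_[q]ˣ) →* Oˣ) (k : ℤ_[p]ˣ →* Oˣ) (z : Ideles) : Oˣ :=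
  ω (unitPart z) * (k (unitPart z p))⁻¹

/-- `φ ∈ M_p(𝒟_k(X), ω_{0,p})^K`, where `ω_{0,p}` is the character `centralChar ω k`: a function
on `B_f^× / B^×` with values in `𝒟_k(X)`, with central character `ω_{0,p}` and fixed by `K` acting
through `(φu)(x) = φ(ux) u_p`. -/
structure IsPadicForm (K : Subgroup (Bf a b)) (ω : (∀ q : Nat.Primes, ℤ_[q]ˣ) →* Oˣ)
    {k : ℤ_[p]ˣ →* Oˣ} {X : Region p} (φ : Bf a b → HomDist k X) : Prop where
  right_invariant : ∀ (x : Bf a b) (g : (Quat a b ℚ)ˣ), φ (x * diag a b g) = φ x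
  central_char : ∀ (z : Ideles) (x : Bf a b),
    φ (central a b z * x) = (centralChar ω k z : O) • φ x
  level : ∀ u ∈ K, ∀ x, distAct (matP θ u) (φ (u * x)) = φ x

/-- The operator `φ ↦ φ | [KπK]`, `(φ | [KπK])(y) = ∑ φ(xy) x_p`, the sum being over
representatives `x` of the finite set `K \ KπK`. -/
def hecke (K : Subgroup (Bf a b)) (π : Bf a b) {k : ℤ_[p]ˣ →* Oˣ} {X : Region p}
    (φ : Bf a b → HomDist k X) (y : Bf a b) : HomDist k X :=
  ∑ᶠ (c : Quotient (QuotientGroup.rightRel K))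
    (_ : c.out ∈ DoubleCoset.doubleCoset π (K : Set (Bf a b)) (K : Set (Bf a b))),
    distAct (matP θ c.out) (φ (c.out * y))

theorem prime_ne_zero (p : Nat.Primes) : ((p : ℕ) : ℚ_[p]) ≠ 0 :=
  Nat.cast_ne_zero.2 p.2.ne_zero

/-- `π_p = diag(1, p)`. -/
def piP (p : Nat.Primes) : GL (Fin 2) ℚ_[p] :=
  Matrix.GeneralLinearGroup.mkOfDetNeZero !![1, 0; 0, ((p : ℕ) : ℚ_[p])]
    (by simpa [Matrix.det_fin_two] using prime_ne_zero p)

/-- `π_p^ι = diag(p, 1)`. -/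
def piPiota (p : Nat.Primes) : GL (Fin 2) ℚ_[p] :=
  Matrix.GeneralLinearGroup.mkOfDetNeZero !![((p : ℕ) : ℚ_[p]), 0; 0, 1]
    (by simpa [Matrix.det_fin_two] using prime_ne_zero p)

/-- The `U_p`-operator at level `K`. -/
def Up (K : Subgroup (Bf a b)) {k : ℤ_[p]ˣ →* Oˣ} {X : Region p} (φ : Bf a b → HomDist k X) :
    Bf a b → HomDist k X :=
  hecke θ K (atP θ (piP p)) φ

/-- The `U_p^ι`-operator at level `K`. -/
def UpIota (K : Subgroup (Bf a b)) {k : ℤ_[p]ˣ →* Oˣ} {X : Region p} (φ : Bf a b → HomDist k X) :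
    Bf a b → HomDist k X :=
  hecke θ K (atP θ (piPiota p)) φ

end Forms

/-! ### The trilinear forms -/

/-- The rational number `μ(K)` (when it is one). -/
def ratVol {a b : ℤ} (μ : MeasureTheory.Measure (Bf a b)) (K : Subgroup (Bf a b)) : ℚ :=
  open Classical in
    if h : ∃ c : ℚ, 0 ≤ c ∧ μ (K : Set (Bf a b)) = ENNReal.ofReal (c : ℝ) then h.choose else 0

/-- The finite group `Γ_K(x) = B^× ∩ x⁻¹Kx`. -/
def arithGroup {a b : ℤ} (K : Subgroup (Bf a b)) (x : Bf a b) : Set (Quat a b ℚ)ˣ :=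
  {g | x * diag a b g * x⁻¹ ∈ K}

/-- `T(f) = μ(K) ∑_{x ∈ K \ B_f^× / B^×} f(x) / |Γ_K(x)|` for a function `f` on
`K \ B_f^× / B^×`. -/
def trace {a b : ℤ} (p : Nat.Primes) {O : Type*} [NormedCommRing O] [NormedAlgebra ℚ_[p] O]
    (μ : MeasureTheory.Measure (Bf a b)) (K : Subgroup (Bf a b)) (f : Bf a b → O) : O :=
  ∑ᶠ c : DoubleCoset.Quotient (K : Set (Bf a b)) ((diag a b).range : Set (Bf a b)),
    ((ratVol μ K / (Nat.card (arithGroup K (Quotient.out c)) : ℚ) : ℚ) : ℚ_[p]) • f (Quotient.out c)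

/-- The trilinear form attached to a function `Δ` on `X₁ × X₂ × X₃`, on forms of level `K`:
`μ(K) ∑_{x ∈ K \ B_f^× / B^×} (φ₁(x) ⊠ φ₂(x) ⊠ φ₃(x))(Δ) / (|Γ_K(x)| Nrd_p(x)^{k*})`. -/
def trilinear {p : Nat.Primes} {O : Type*} [NormedCommRing O] [NormedAlgebra ℚ_[p] O] {a b : ℤ}
    (μ : MeasureTheory.Measure (Bf a b)) (K : Subgroup (Bf a b)) (ks : ℤ_[p]ˣ →* Oˣ)
    (Δ : (Fin 2 → ℚ_[p]) → (Fin 2 → ℚ_[p]) → (Fin 2 → ℚ_[p]) → O)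
    {k₁ k₂ k₃ : ℤ_[p]ˣ →* Oˣ} {X₁ X₂ X₃ : Region p}
    (φ₁ : Bf a b → HomDist k₁ X₁) (φ₂ : Bf a b → HomDist k₂ X₂) (φ₃ : Bf a b → HomDist k₃ X₃) : O :=
  trace p μ K fun x => tripleIntegral Δ (φ₁ x) (φ₂ x) (φ₃ x) * (((ks (nrdP p x))⁻¹ : Oˣ) : O)

end TripleProduct

end

open TripleProduct

open scoped RestrictedProduct

noncomputable section

namespace TripleProduct

/-! ### Calculus of uniformly bounded expansions -/

section Calculus

variable {p : Nat.Primes} {E F G H : Type*} [NormedAddCommGroup E] [NormedSpace ℚ_[p] E]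
  [NormedAddCommGroup F] [NormedSpace ℚ_[p] F] [NormedAddCommGroup G] [NormedSpace ℚ_[p] G]
  [NormedAddCommGroup H] [NormedSpace ℚ_[p] H]

/-! Write Δ = Δ° + Δ', where Δ' (`DeltaRest`) lives on the locus where δ(w₁,w₂) is not a unit, and
let t' be the trilinear form attached to Δ'. The claim amounts to α₁α₂ t' = ω₃(p') p^{k₃*} α₃ t.
Expanding α₁φ₁(x) and α₂φ₂(x) through U_p turns the left side into a sum over pairs of cosets Kc,
Kc' in K diag(1,p) K of the Δ'-pairing of φ₁(cx)c, φ₂(c'x)c' and φ₃(x).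

For distinct cosets, δ(w₁c, w₂c') is a unit for all w₁, w₂ in W, so Δ' vanishes
(`IsLevel.mul_inv_mem_of_norm_delta_ne_one`, `tripleIntegral_rest_eq_zero`). For c = c', δ(w₁c, w₂c)
= det(c) δ(w₁,w₂) with det(c) equal to p times a unit. This is never a unit, so Δ' agrees with Δ
there and the factor p^{k₃*} comes out. In the two other pairings c moves to w₃ as its adjugate, a
unit multiple of p c⁻¹, which represents the double coset of diag(p,1) (`tripleIntegral_rest_diag`).

Let z be the idele equal to p at p and to 1 elsewhere. Then φ₃(x) = ω₃(p') φ₃(zx), so with y = cx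
the diagonal term pairs φ₁(y), φ₂(y) and φ₃(zc⁻¹y)(zc⁻¹). This is a kernel in (y, x) invariant under
K on both sides and under diagonal B^× (`heckeKernel`). The Hecke correspondence may therefore be
summed along either projection to the class set (`hecke_adjoint`); summed at fixed y, the third
argument becomes (φ₃|U_p^ι)(y) = α₃φ₃(y).

Two points carry most of the length. Since `distIntegral` is 0 on functions outside 𝒜_k(X), every
partial integral must be shown locally analytic and homogeneous. This is
`tripleIntegrable_triDelta`: the family w ↦ f(δ(w,·)) is an analytic map into a Banach space of
functions of fixed radius (`deltaFun_hasExpansions`), and continuous linear and bilinear maps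
preserve analyticity. Since `finsum` is 0 on infinite supports, the class set and the arithmetic
groups must be finite (`finite_doubleCoset_quotient`, `finite_arithGroup`). Both rest on the
definiteness a, b < 0: the former through a Dirichlet approximation argument replacing the Euclidean
algorithm, the latter through positivity of the norm form. -/

theorem HasExpansions.le_const {f : E → F} {r C D : ℝ} (h : HasExpansions (p := p) f r C)
    (hCD : C ≤ D) : HasExpansions (p := p) f r D := fun x => by
  obtain ⟨q, hq, hs⟩ := h x
  exact ⟨q, fun n => (hq n).trans hCD, hs⟩

theorem HasExpansions.norm_apply_le {f : E → F} {r C : ℝ} (hr : 0 < r)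
    (h : HasExpansions (p := p) f r C) (x : E) : ‖f x‖ ≤ C := by
  obtain ⟨q, hq, hs⟩ := h x
  have h0 := hs 0 (by simpa using hr)
  have h1 : HasSum (fun n => q n (fun _ => (0 : E))) (q 0 fun _ => 0) := by
    refine hasSum_single 0 fun n hn => ?_
    have : Nonempty (Fin n) := ⟨⟨0, Nat.pos_of_ne_zero hn⟩⟩
    exact (q n).map_zero
  rw [add_zero] at h0
  rw [h0.unique h1]
  have h2 := (q 0).le_opNorm (fun _ => (0 : E))
  simp only [Finset.univ_eq_empty, Finset.prod_empty, mul_one] at h2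
  have h3 := hq 0
  rw [pow_zero, mul_one] at h3
  exact h2.trans h3

theorem HasExpansions.clm {f : E → F} {r C M : ℝ} (hr : 0 < r) (h : HasExpansions (p := p) f r C)
    (L : F →L[ℚ_[p]] G) (hL : ‖L‖ ≤ M) : HasExpansions (p := p) (fun x => L (f x)) r (M * C) := by
  intro x
  obtain ⟨q, hq, hs⟩ := h x
  refine ⟨fun n => L.compContinuousMultilinearMap (q n), fun n => ?_, fun y hy => ?_⟩
  · calc _ ≤ (‖L‖ * ‖q n‖) * r ^ n := by
          gcongr; exact ContinuousLinearMap.norm_compContinuousMultilinearMap_le _ _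
      _ = ‖L‖ * (‖q n‖ * r ^ n) := by ring
      _ ≤ M * C := mul_le_mul hL (hq n) (by positivity) ((norm_nonneg _).trans hL)
  · exact (hs y hy).mapL L

theorem HasExpansions.comp_clm {f : F → G} {r C : ℝ} (hr : 0 < r)
    (h : HasExpansions (p := p) f r C) (L : E →L[ℚ_[p]] F) (hL : ‖L‖ ≤ 1) :
    HasExpansions (p := p) (fun x => f (L x)) r C := by
  intro x
  obtain ⟨q, hq, hs⟩ := h (L x)
  refine ⟨q.compContinuousLinearMap L, fun n => ?_, fun y hy => ?_⟩
  · have h1 : ‖q.compContinuousLinearMap L n‖ ≤ ‖q n‖ * ‖L‖ ^ n := by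
      have := ContinuousMultilinearMap.norm_compContinuousLinearMap_le (q n) (fun _ => L)
      simpa [FormalMultilinearSeries.compContinuousLinearMap] using this
    calc _ ≤ (‖q n‖ * ‖L‖ ^ n) * r ^ n := by gcongr
      _ ≤ (‖q n‖ * 1) * r ^ n := by gcongr; exact pow_le_one₀ (norm_nonneg _) hL
      _ ≤ C := by rw [mul_one]; exact hq n
  · change HasSum _ (f (L (x + y)))
    rw [map_add]
    refine hs (L y) (lt_of_le_of_lt ?_ hy)
    exact (L.le_opNorm y).trans (mul_le_of_le_one_left (norm_nonneg _) hL)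

theorem norm_expansion_term_le {q : FormalMultilinearSeries ℚ_[p] E F} {r C : ℝ} (hr : 0 < r)
    (hq : ∀ n, ‖q n‖ * r ^ n ≤ C) (y : E) (n : ℕ) :
    ‖q n (fun _ => y)‖ ≤ C * (‖y‖ / r) ^ n := by
  have h1 : ‖q n (fun _ => y)‖ ≤ ‖q n‖ * ‖y‖ ^ n := by
    simpa using (q n).le_opNorm (fun _ => y)
  rw [div_pow, mul_div_assoc']
  rw [le_div_iff₀ (by positivity)]
  calc _ ≤ ‖q n‖ * ‖y‖ ^ n * r ^ n := by gcongr
    _ = (‖q n‖ * r ^ n) * ‖y‖ ^ n := by ring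
    _ ≤ _ := by gcongr; exact hq n

theorem summable_geometric_bound {r : ℝ} (hr : 0 < r) {y : E} (hy : ‖y‖ < r) (C : ℝ) :
    Summable fun n : ℕ => C * (‖y‖ / r) ^ n :=
  (summable_geometric_of_lt_one (by positivity) ((div_lt_one hr).2 hy)).mul_left C

/-- The termwise sum of a convergent series of expansions. -/
theorem HasExpansions.hasSum [CompleteSpace F] {f : ℕ → E → F} {g : E → F} {r : ℝ} {C : ℕ → ℝ}
    (hr : 0 < r) (h : ∀ n, HasExpansions (p := p) (f n) r (C n)) (hC : Summable C)
    (hg : ∀ x, HasSum (fun n => f n x) (g x)) : HasExpansions (p := p) g r (∑' n, C n) := by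
  intro x
  choose q hq hs using fun n => h n x
  have hle : ∀ n m, ‖q n m‖ ≤ C n / r ^ m := fun n m => by
    rw [le_div_iff₀ (by positivity)]; exact hq n m
  have hsm : ∀ m, Summable fun n => q n m := fun m =>
    Summable.of_norm_bounded (hC.div_const _) (fun n => hle n m)
  refine ⟨fun m => ∑' n, q n m, fun m => ?_, fun y hy => ?_⟩
  · rw [← le_div_iff₀ (by positivity), ← tsum_div_const]
    exact tsum_of_norm_bounded (hC.div_const _).hasSum (fun n => hle n m)
  · have happ : ∀ m, HasSum (fun n => q n m (fun _ => y)) ((∑' n, q n m) (fun _ => y)) := fun m =>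
      (hsm m).hasSum.mapL (ContinuousMultilinearMap.apply ℚ_[p] (fun _ : Fin m => E) F fun _ => y)
    -- The double series over (degree, summand) is dominated by a geometric series times `C`, hence
    -- may be summed in either order.
    have hsum : Summable fun x : ℕ × ℕ => q x.2 x.1 (fun _ => y) := by
      refine Summable.of_norm_bounded (g := fun x : ℕ × ℕ => (‖y‖ / r) ^ x.1 * C x.2) ?_
        fun x => ?_
      · exact (summable_geometric_of_lt_one (by positivity)
          ((div_lt_one hr).2 hy)).mul_of_nonneg hC (fun _ => by positivity)
          (fun n => (h n).nonneg)
      · rw [mul_comm]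
        exact norm_expansion_term_le hr (hq x.2) y x.1
    have h1 := hsum.hasSum.prod_fiberwise happ
    have h2 := ((Equiv.prodComm ℕ ℕ).hasSum_iff.2 hsum.hasSum).prod_fiberwise
      (fun n => hs n y hy)
    rw [(hg (x + y)).unique h2]
    exact h1

/-- The bilinear map `B` with a multilinear map inserted in the second argument. -/
def bilinCurry (B : F →L[ℚ_[p]] G →L[ℚ_[p]] H) {j : ℕ} (b : E [×j]→L[ℚ_[p]] G) :
    F →ₗ[ℚ_[p]] MultilinearMap ℚ_[p] (fun _ : Fin j => E) H where
  toFun e := (B e : G →ₗ[ℚ_[p]] H).compMultilinearMap b.toMultilinearMap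
  map_add' e e' := by ext; simp
  map_smul' c e := by ext; simp

/-- The product of two multilinear maps along a bilinear map, the arguments being split in two
blocks. -/
def bilinBlock (B : F →L[ℚ_[p]] G →L[ℚ_[p]] H) {i j n : ℕ} (hij : i + j = n)
    (a : E [×i]→L[ℚ_[p]] F) (b : E [×j]→L[ℚ_[p]] G) : E [×n]→L[ℚ_[p]] H :=
  MultilinearMap.mkContinuous
    ((MultilinearMap.uncurrySum (N := fun _ : Fin i ⊕ Fin j => E)
      (LinearMap.compMultilinearMap (bilinCurry B b) a.toMultilinearMap)).domDomCongr
      (finSumFinEquiv.trans (finCongr hij)))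
    (‖B‖ * ‖a‖ * ‖b‖) (fun y => by
      have h1 := B.le_opNorm₂
        (a fun s => y ((finSumFinEquiv.trans (finCongr hij)) (Sum.inl s)))
        (b fun s => y ((finSumFinEquiv.trans (finCongr hij)) (Sum.inr s)))
      refine h1.trans ?_
      have h2 := a.le_opNorm fun s => y ((finSumFinEquiv.trans (finCongr hij)) (Sum.inl s))
      have h3 := b.le_opNorm fun s => y ((finSumFinEquiv.trans (finCongr hij)) (Sum.inr s))
      rw [← Equiv.prod_comp (finSumFinEquiv.trans (finCongr hij)), Fintype.prod_sum_type]
      have h4 : 0 ≤ ‖B‖ := norm_nonneg B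
      calc _ ≤ _ := mul_le_mul (mul_le_mul_of_nonneg_left h2 h4) h3 (norm_nonneg _)
            (mul_nonneg h4 (by positivity))
        _ = _ := by ring)

theorem norm_bilinBlock_le (B : F →L[ℚ_[p]] G →L[ℚ_[p]] H) {i j n : ℕ} (hij : i + j = n)
    (a : E [×i]→L[ℚ_[p]] F) (b : E [×j]→L[ℚ_[p]] G) :
    ‖bilinBlock B hij a b‖ ≤ ‖B‖ * ‖a‖ * ‖b‖ :=
  MultilinearMap.mkContinuous_norm_le _
    (mul_nonneg (mul_nonneg (norm_nonneg B) (norm_nonneg a)) (norm_nonneg b)) _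

/-- The ultrametric inequality is inherited by operator norms. It keeps Cauchy products bounded
without a factor counting their terms. -/
theorem norm_multilinear_sum_le [IsUltrametricDist H] {ι : Type*} (s : Finset ι) {n : ℕ}
    (q : ι → E [×n]→L[ℚ_[p]] H) {C : ℝ} (hC : 0 ≤ C) (h : ∀ i ∈ s, ‖q i‖ ≤ C) :
    ‖∑ i ∈ s, q i‖ ≤ C := by
  refine ContinuousMultilinearMap.opNorm_le_bound hC fun y => ?_
  rw [sum_apply]
  refine IsUltrametricDist.norm_sum_le_of_forall_le_of_nonneg (by positivity) fun i hi => ?_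
  exact ((q i).le_opNorm y).trans (by gcongr; exact h i hi)

/-- The Cauchy product of the two expansions. The degree `n` coefficient has `n + 1` terms, each
bounded by the product of the Gauss norms; as `H` is ultrametric so is their sum, and the radius
does not shrink. -/
theorem HasExpansions.bilin [IsUltrametricDist H] [CompleteSpace H] {f : E → F} {g : E → G}
    {r C D : ℝ} (hr : 0 < r) (B : F →L[ℚ_[p]] G →L[ℚ_[p]] H) {M : ℝ} (hB : ‖B‖ ≤ M)
    (hf : HasExpansions (p := p) f r C) (hg : HasExpansions (p := p) g r D) :
    HasExpansions (p := p) (fun x => B (f x) (g x)) r (M * C * D) := by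
  have hC := hf.nonneg
  have hD := hg.nonneg
  have hM : 0 ≤ M := (norm_nonneg B).trans hB
  intro x
  obtain ⟨q, hq, hs⟩ := hf x
  obtain ⟨q', hq', hs'⟩ := hg x
  refine ⟨fun n => ∑ k : Finset.HasAntidiagonal.antidiagonal n,
    bilinBlock B (Finset.HasAntidiagonal.mem_antidiagonal.1 k.2) (q k.1.1) (q' k.1.2), fun n => ?_, fun y hy => ?_⟩
  · rw [← le_div_iff₀ (by positivity)]
    refine norm_multilinear_sum_le _ _ (by positivity) fun k _ => ?_
    refine (norm_bilinBlock_le _ _ _ _).trans ?_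
    rw [le_div_iff₀ (by positivity)]
    have hk := Finset.HasAntidiagonal.mem_antidiagonal.1 k.2
    have hpow : r ^ n = r ^ k.1.1 * r ^ k.1.2 := by rw [← pow_add, hk]
    rw [hpow]
    calc _ = ‖B‖ * (‖q k.1.1‖ * r ^ k.1.1) * (‖q' k.1.2‖ * r ^ k.1.2) := by ring
      _ ≤ _ := by gcongr <;> [exact hq _; exact hq' _]
  · have hsum : Summable fun z : ℕ × ℕ => B (q z.1 fun _ => y) (q' z.2 fun _ => y) := by
      refine Summable.of_norm_bounded
        (g := fun z : ℕ × ℕ => (M * C * (‖y‖ / r) ^ z.1) * (D * (‖y‖ / r) ^ z.2)) ?_ fun z => ?_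
      · exact (summable_geometric_bound hr hy _).mul_of_nonneg (summable_geometric_bound hr hy _)
          (fun _ => by positivity) (fun _ => by positivity)
      · refine (B.le_opNorm₂ _ _).trans ?_
        have h1 := norm_expansion_term_le hr hq y z.1
        have h2 := norm_expansion_term_le hr hq' y z.2
        calc _ ≤ M * (C * (‖y‖ / r) ^ z.1) * (D * (‖y‖ / r) ^ z.2) := by gcongr
          _ = _ := by ring
    have h1 : HasSum (fun z : ℕ × ℕ => B (q z.1 fun _ => y) (q' z.2 fun _ => y))
        (B (f (x + y)) (g (x + y))) := by
      have h2 := hsum.hasSum.prod_fiberwise (fun i => (hs' y hy).mapL (B (q i fun _ => y)))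
      have h3 := (hs y hy).mapL (B.flip (g (x + y)))
      have h5 : B (f (x + y)) (g (x + y)) = _ := h3.unique h2
      rw [h5]
      exact hsum.hasSum
    -- The absolutely convergent double sum is regrouped by total degree.
    rw [← Finset.HasAntidiagonal.sigmaAntidiagonalEquivProd.hasSum_iff] at h1
    have h4 := h1.sigma fun n => hasSum_fintype _
    refine h4.congr_fun fun n => ?_
    simp only [sum_apply]
    rfl

end Calculus

/-! ### Taylor coefficients in one variable -/

section Taylor

variable {p : Nat.Primes} {F : Type*} [NormedAddCommGroup F] [NormedSpace ℚ_[p] F]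

/-- The formal power series in one variable with given coefficients. -/
def powSeries (a : ℕ → F) : FormalMultilinearSeries ℚ_[p] ℚ_[p] F :=
  fun n => ContinuousMultilinearMap.mkPiRing ℚ_[p] (Fin n) (a n)

theorem powSeries_apply (a : ℕ → F) (n : ℕ) (t : ℚ_[p]) :
    powSeries (p := p) a n (fun _ => t) = t ^ n • a n := by
  simp [powSeries]

theorem coeff_powSeries (a : ℕ → F) (n : ℕ) : (powSeries (p := p) a).coeff n = a n := by
  have h := powSeries_apply (p := p) a n 1
  rw [one_pow, one_smul] at h
  exact h

theorem powSeries_coeff_unique {a b : ℕ → F} {g : ℚ_[p] → F} {r : ℝ} (hr : 0 < r)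
    (ha : ∀ t : ℚ_[p], ‖t‖ < r → HasSum (fun n => t ^ n • a n) (g t))
    (hb : ∀ t : ℚ_[p], ‖t‖ < r → HasSum (fun n => t ^ n • b n) (g t)) : a = b := by
  have key : ∀ c : ℕ → F, (∀ t : ℚ_[p], ‖t‖ < r → HasSum (fun n => t ^ n • c n) (g t)) →
      HasFPowerSeriesAt g (powSeries (p := p) c) 0 := fun c hc => by
    rw [hasFPowerSeriesAt_iff]
    filter_upwards [Metric.ball_mem_nhds (0 : ℚ_[p]) hr] with t ht
    rw [zero_add]
    simpa only [coeff_powSeries] using hc t (by simpa using ht)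
  have h := (key a ha).eq_formalMultilinearSeries (key b hb)
  funext n
  rw [← coeff_powSeries (p := p) a n, h, coeff_powSeries]

/-- Expanding f(s + t + u) once about s and once about s + t and comparing coefficients of u^j gives
c_j(s + t) = ∑ᵢ binom(i+j, j) c_{i+j}(s) tⁱ. Binomial coefficients have p-adic norm at most 1, so
c_j keeps the radius `r` with bound C / r^j. These functions become the coefficients of the family w
↦ f(δ(w,·)), where they must be analytic in the remaining variable. -/
theorem HasExpansions.exists_taylor [CompleteSpace F] {f : ℚ_[p] → F} {r C : ℝ}
    (hr : 0 < r) (h : HasExpansions (p := p) f r C) :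
    ∃ c : ℕ → ℚ_[p] → F, (∀ n, HasExpansions (p := p) (c n) r (C / r ^ n)) ∧
      ∀ s t, ‖t‖ < r → HasSum (fun n => t ^ n • c n s) (f (s + t)) := by
  choose q hq hs using h
  set c : ℕ → ℚ_[p] → F := fun n s => (q s).coeff n with hc
  have hsum : ∀ s t, ‖t‖ < r → HasSum (fun n => t ^ n • c n s) (f (s + t)) := fun s t ht => by
    simpa [hc] using hs s t ht
  have hbd : ∀ n s, ‖c n s‖ ≤ C / r ^ n := fun n s => by
    rw [le_div_iff₀ (by positivity), ← (q s).norm_apply_eq_norm_coef]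
    exact hq s n
  refine ⟨c, fun j s => ?_, hsum⟩
  have hC : 0 ≤ C := by simpa using (norm_nonneg _).trans (hbd 0 s)
  have hch : ∀ i j : ℕ, ‖(((i + j).choose j : ℕ) : ℚ_[p])‖ ≤ 1 := fun i j =>
    by simpa using Padic.norm_int_le_one (p := p) ((i + j).choose j : ℤ)
  have hterm : ∀ (t u : ℚ_[p]) (i j : ℕ),
      ‖(((i + j).choose j : ℚ_[p]) * t ^ i * u ^ j) • c (i + j) s‖ ≤
        (C * (‖t‖ / r) ^ i) * (‖u‖ / r) ^ j := fun t u i j => by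
    rw [norm_smul, norm_mul, norm_mul, norm_pow, norm_pow]
    calc _ ≤ (1 * ‖t‖ ^ i * ‖u‖ ^ j) * (C / r ^ (i + j)) := by
          gcongr
          · exact hch i j
          · exact hbd _ _
      _ = _ := by rw [pow_add, div_pow, div_pow]; field_simp
  have hS : ∀ t u : ℚ_[p], ‖t‖ < r → ‖u‖ < r → Summable fun z : ℕ × ℕ =>
      (((z.1 + z.2).choose z.2 : ℚ_[p]) * t ^ z.1 * u ^ z.2) • c (z.1 + z.2) s :=
    fun t u ht hu => Summable.of_norm_bounded
      ((summable_geometric_bound hr ht C).mul_of_nonneg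
        (summable_geometric_of_lt_one (by positivity) ((div_lt_one hr).2 hu))
        (fun _ => by positivity) (fun _ => by positivity)) fun z => hterm t u z.1 z.2
  have hpow : ∀ t u : ℚ_[p], ‖t‖ < r → ‖u‖ < r → HasSum (fun z : ℕ × ℕ =>
      (((z.1 + z.2).choose z.2 : ℚ_[p]) * t ^ z.1 * u ^ z.2) • c (z.1 + z.2) s)
      (f (s + (t + u))) := fun t u ht hu => by
    have h1 := (hS t u ht hu).hasSum
    have h2 := (Finset.HasAntidiagonal.sigmaAntidiagonalEquivProd.hasSum_iff.2 h1).sigma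
      fun n => hasSum_fintype _
    -- The ball of radius `r` is an additive group, so t + u remains inside it.
    have h3 := hsum s (t + u) ((Padic.nonarchimedean _ _).trans_lt (max_lt ht hu))
    have h4 : (fun n : ℕ => (t + u) ^ n • c n s) = fun n => ∑ k : Finset.HasAntidiagonal.antidiagonal n,
        ((((k.1.1 + k.1.2).choose k.1.2 : ℚ_[p]) * t ^ k.1.1 * u ^ k.1.2) •
          c (k.1.1 + k.1.2) s) := by
      funext n
      rw [Finset.sum_coe_sort (Finset.HasAntidiagonal.antidiagonal n) (fun k : ℕ × ℕ =>
        (((k.1 + k.2).choose k.2 : ℚ_[p]) * t ^ k.1 * u ^ k.2) • c (k.1 + k.2) s)]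
      rw [add_comm t u, (Commute.all u t).add_pow', Finset.sum_smul]
      rw [← Finset.Nat.sum_antidiagonal_swap]
      refine Finset.sum_congr rfl fun k hk => ?_
      have hk' := Finset.HasAntidiagonal.mem_antidiagonal.1 hk
      simp only [Prod.fst_swap, Prod.snd_swap]
      rw [hk', nsmul_eq_mul]
      congr 1
      ring
    rw [h4] at h3
    have h5 : f (s + (t + u)) = _ := h3.unique h2
    rw [h5]
    exact h1
  have hcj : ∀ t : ℚ_[p], ‖t‖ < r →
      HasSum (fun i => t ^ i • (((i + j).choose j : ℚ_[p]) • c (i + j) s)) (c j (s + t)) := by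
    intro t ht
    have hinner : ∀ u : ℚ_[p], ‖u‖ < r → ∀ j, Summable fun i =>
        (((i + j).choose j : ℚ_[p]) * t ^ i * u ^ j) • c (i + j) s := fun u hu j =>
      Summable.of_norm_bounded ((summable_geometric_bound hr ht C).mul_right _)
        fun i => hterm t u i j
    have hinner1 : ∀ j, Summable fun i => t ^ i • (((i + j).choose j : ℚ_[p]) • c (i + j) s) := by
      intro j
      refine Summable.of_norm_bounded
        ((summable_geometric_bound hr ht C).mul_right ((1 / r) ^ j)) fun i => ?_
      rw [norm_smul, norm_smul, norm_pow]
      calc _ ≤ ‖t‖ ^ i * (1 * (C / r ^ (i + j))) := by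
            gcongr
            · exact hch i j
            · exact hbd _ _
        _ = _ := by rw [pow_add, div_pow, div_pow]; field_simp; simp
    -- For fixed `t`, both coefficient sequences expand the same function of `u`, namely f(s + t +
    -- u).
    have huniq := powSeries_coeff_unique (p := p) hr
      (a := fun j => ∑' i, t ^ i • (((i + j).choose j : ℚ_[p]) • c (i + j) s))
      (b := fun j => c j (s + t)) (g := fun u => f (s + (t + u)))
      (fun u hu => ?_) (fun u hu => ?_)
    · rw [← congrFun huniq j]
      exact (hinner1 j).hasSum
    · have h1 := ((Equiv.prodComm ℕ ℕ).hasSum_iff.2 (hpow t u ht hu)).prod_fiberwise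
        (fun j => (hinner u hu j).hasSum)
      refine h1.congr_fun fun j => ?_
      rw [← (hinner1 j).tsum_const_smul]
      refine tsum_congr fun i => ?_
      rw [smul_smul, smul_smul]
      congr 1
      ring
    · rw [← add_assoc]
      exact hsum (s + t) u hu
  refine ⟨powSeries fun i => ((i + j).choose j : ℚ_[p]) • c (i + j) s, fun n => ?_, fun t ht => ?_⟩
  · rw [powSeries, ContinuousMultilinearMap.norm_mkPiRing, norm_smul,
      ← le_div_iff₀ (by positivity)]
    calc _ ≤ 1 * (C / r ^ (n + j)) := by
          gcongr
          · exact hch n j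
          · exact hbd _ _
      _ = _ := by rw [pow_add]; field_simp
  · simpa only [powSeries_apply] using hcj t ht

end Taylor

/-! ### Functions of the determinant pairing -/

section DeltaForms

variable {p : Nat.Primes} {F : Type*} [NormedAddCommGroup F] [NormedSpace ℚ_[p] F]

/-- A region is a union of open unit balls, so its indicator is constant on every ball of radius r ≤
1. -/
theorem HasExpansions.indicator (X : Region p) {f : (Fin 2 → ℚ_[p]) → F} {r C : ℝ} (hr1 : r ≤ 1)
    (h : HasExpansions (p := p) f r C) : HasExpansions (p := p) (X.carrier.indicator f) r C := by
  intro x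
  by_cases hx : x ∈ X.carrier
  · obtain ⟨q, hq, hs⟩ := h x
    refine ⟨q, hq, fun y hy => ?_⟩
    rw [Set.indicator_of_mem (X.add_mem x y (hy.trans_le hr1) hx)]
    exact hs y hy
  · refine ⟨0, fun n => by simpa using h.nonneg, fun y hy => ?_⟩
    have hxy : x + y ∉ X.carrier := fun h' => hx (by
      have := X.add_mem (x + y) (-y) (by rw [norm_neg]; exact hy.trans_le hr1) h'
      simpa using this)
    rw [Set.indicator_of_notMem hxy]
    simp

theorem norm_delta_le (x z : Fin 2 → ℚ_[p]) : ‖delta x z‖ ≤ ‖x‖ * ‖z‖ := by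
  have h : ∀ i j, ‖x i * z j‖ ≤ ‖x‖ * ‖z‖ := fun i j => by
    rw [norm_mul]
    gcongr
    · exact norm_le_pi_norm x i
    · exact norm_le_pi_norm z j
  rw [delta, sub_eq_add_neg]
  refine (Padic.nonarchimedean _ _).trans (max_le (h 0 1) ?_)
  rw [norm_neg]
  exact h 1 0

/-- The pairing `δ` as a bilinear map. -/
def deltaBilin (p : Nat.Primes) : (Fin 2 → ℚ_[p]) →ₗ[ℚ_[p]] (Fin 2 → ℚ_[p]) →ₗ[ℚ_[p]] ℚ_[p] :=
  LinearMap.mk₂ ℚ_[p] delta (fun _ _ _ => by simp [delta]; ring) (fun _ _ _ => by simp [delta]; ring)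
    (fun _ _ _ => by simp [delta]; ring) (fun _ _ _ => by simp [delta]; ring)

/-- The linear form `δ(x, ·)`. -/
def deltaL (x : Fin 2 → ℚ_[p]) : (Fin 2 → ℚ_[p]) →L[ℚ_[p]] ℚ_[p] :=
  (deltaBilin p x).mkContinuous ‖x‖ (norm_delta_le x)

theorem deltaL_apply (x z : Fin 2 → ℚ_[p]) : deltaL x z = delta x z := rfl

theorem norm_deltaL_le (x : Fin 2 → ℚ_[p]) : ‖deltaL x‖ ≤ ‖x‖ :=
  LinearMap.mkContinuous_norm_le _ (norm_nonneg _) _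

theorem delta_add_left (x y z : Fin 2 → ℚ_[p]) : delta (x + y) z = delta x z + delta y z := by
  simp [delta]; ring

theorem delta_smul_left (c : ℚ_[p]) (x z : Fin 2 → ℚ_[p]) : delta (c • x) z = c * delta x z := by
  simp [delta]; ring

theorem delta_smul_right (c : ℚ_[p]) (x z : Fin 2 → ℚ_[p]) : delta x (c • z) = c * delta x z := by
  simp [delta]; ring

theorem HasExpansions.indicator_comp_delta (X : Region p) {f : ℚ_[p] → F} {r C : ℝ} (hr : 0 < r)
    (hr1 : r ≤ 1) (h : HasExpansions (p := p) f r C) {x : Fin 2 → ℚ_[p]} (hx : ‖x‖ ≤ 1) :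
    HasExpansions (p := p) (X.carrier.indicator fun z => f (delta x z)) r C :=
  (h.comp_clm hr (deltaL x) ((norm_deltaL_le x).trans hx)).indicator X hr1

theorem hasExpansions_indicator_delta (X : Region p) {r : ℝ} (hr : 0 < r) (hr1 : r ≤ 1)
    (y : Fin 2 → ℚ_[p]) :
    HasExpansions (p := p) (X.carrier.indicator fun z => delta y z) r ‖y‖ := by
  intro z
  by_cases hz : z ∈ X.carrier
  · refine ⟨(deltaL y).fpowerSeries z, fun n => ?_, fun u hu => ?_⟩
    · rcases n with _ | _ | n
      · have : ‖delta y z‖ ≤ ‖y‖ := (norm_delta_le y z).trans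
          (mul_le_of_le_one_right (norm_nonneg _) (X.norm_le z hz))
        simpa [ContinuousLinearMap.fpowerSeries, deltaL_apply] using this
      · have : ‖deltaL y‖ * r ≤ ‖y‖ * 1 := by
          gcongr
          exact norm_deltaL_le y
        simpa [ContinuousLinearMap.fpowerSeries] using this
      · simp [ContinuousLinearMap.fpowerSeries]
    · rw [Set.indicator_of_mem (X.add_mem z u (hu.trans_le hr1) hz)]
      exact ((deltaL y).hasFPowerSeriesOnBall z).hasSum (by simp)
  · refine ⟨0, fun n => by simp, fun u hu => ?_⟩
    have hxy : z + u ∉ X.carrier := fun h' => hz (by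
      have := X.add_mem (z + u) (-u) (by rw [norm_neg]; exact hu.trans_le hr1) h'
      simpa using this)
    rw [Set.indicator_of_notMem hxy]
    simp

/-- Multiplication by one linear form δ(y,·) costs at most ‖y‖ in the Gauss norm, because points of
`X` have norm at most 1. Iterating bounds the multilinear coefficients of the family in
`deltaFun_hasExpansions`. -/
theorem HasExpansions.prod_delta_smul [IsUltrametricDist F] [CompleteSpace F] (X : Region p)
    {g : (Fin 2 → ℚ_[p]) → F} {r D : ℝ} (hr : 0 < r) (hr1 : r ≤ 1)
    (h : HasExpansions (p := p) (X.carrier.indicator g) r D) {ι : Type*} (s : Finset ι)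
    (y : ι → Fin 2 → ℚ_[p]) :
    HasExpansions (p := p) (X.carrier.indicator fun z => (∏ i ∈ s, delta (y i) z) • g z) r
      ((∏ i ∈ s, ‖y i‖) * D) := by
  classical
  induction s using Finset.induction_on with
  | empty => simpa using h
  | insert i s hi ih =>
    have h1 := (hasExpansions_indicator_delta X hr hr1 (y i)).bilin hr
      (ContinuousLinearMap.lsmul ℚ_[p] ℚ_[p] : ℚ_[p] →L[ℚ_[p]] F →L[ℚ_[p]] F)
      ContinuousLinearMap.opNorm_lsmul_le ih
    rw [Finset.prod_insert hi]
    convert h1 using 1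
    · funext z
      by_cases hz : z ∈ X.carrier
      · simp [hz, Finset.prod_insert hi, mul_smul, smul_comm (delta (y i) z)]
      · simp [hz]
    · ring

end DeltaForms

/-! ### The Banach spaces of homogeneous functions with a given radius of analyticity -/

section AnFun

variable {p : Nat.Primes} {O : Type*} [NormedCommRing O] [NormedAlgebra ℚ_[p] O]

/-- This makes the Gauss norm ultrametric, so that `AnFun` can serve as the target space in
`HasExpansions.bilin`. -/
theorem HasExpansions.add_max {E F : Type*} [NormedAddCommGroup E] [NormedSpace ℚ_[p] E]
    [NormedAddCommGroup F] [NormedSpace ℚ_[p] F] [IsUltrametricDist F] {f g : E → F} {r C D : ℝ}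
    (hr : 0 < r) (hf : HasExpansions (p := p) f r C) (hg : HasExpansions (p := p) g r D) :
    HasExpansions (p := p) (f + g) r (max C D) := by
  intro x
  obtain ⟨q, hq, hs⟩ := hf x
  obtain ⟨q', hq', hs'⟩ := hg x
  refine ⟨q + q', fun n => ?_, fun y hy => (hs y hy).add (hs' y hy)⟩
  have hC := hf.nonneg
  rw [← le_div_iff₀ (by positivity)]
  have h := norm_multilinear_sum_le (Finset.univ : Finset (Fin 2)) ![q n, q' n]
    (C := max C D / r ^ n) (by positivity) (fun i _ => by
      rw [le_div_iff₀ (by positivity)]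
      fin_cases i
      · exact (hq n).trans (le_max_left _ _)
      · exact (hq' n).trans (le_max_right _ _))
  simpa using h

theorem HasExpansions.const_smul {E F : Type*} [NormedAddCommGroup E] [NormedSpace ℚ_[p] E]
    [NormedAddCommGroup F] [NormedSpace ℚ_[p] F] {f : E → F} {r C : ℝ} (hr : 0 < r)
    (hf : HasExpansions (p := p) f r C) (c : ℚ_[p]) :
    HasExpansions (p := p) (c • f) r (‖c‖ * C) :=
  hf.clm hr (c • ContinuousLinearMap.id ℚ_[p] F) (by
    refine ContinuousLinearMap.opNorm_le_bound _ (norm_nonneg _) fun x => ?_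
    simp [norm_smul])

theorem HasExpansions.zero {E F : Type*} [NormedAddCommGroup E] [NormedSpace ℚ_[p] E]
    [NormedAddCommGroup F] [NormedSpace ℚ_[p] F] (r : ℝ) :
    HasExpansions (p := p) (0 : E → F) r 0 :=
  fun _ => ⟨0, fun n => by simp, fun y _ => by simp⟩

/-- The functions in `𝒜_k(X)` with uniform radius of analyticity `r`. -/
def anFun (k : ℤ_[p]ˣ →* Oˣ) (X : Region p) (r : Set.Ioi (0 : ℝ)) :
    Submodule ℚ_[p] ((Fin 2 → ℚ_[p]) → O) where
  carrier := {F | F ∈ homogFun k X ∧ ∃ C, HasExpansions (p := p) F r C}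
  zero_mem' := ⟨zero_mem _, 0, HasExpansions.zero _⟩
  add_mem' := fun {F G} ⟨hF, C, hC⟩ ⟨hG, D, hD⟩ => ⟨add_mem hF hG, C + D, hC.add r.2 hD⟩
  smul_mem' := fun c F ⟨hF, C, hC⟩ => ⟨by
    rw [← algebraMap_smul O c F]
    exact Submodule.smul_mem _ _ hF, _, hC.const_smul r.2 c⟩

/-- `anFun`, to be equipped with the Gauss norm. -/
def AnFun (k : ℤ_[p]ˣ →* Oˣ) (X : Region p) (r : Set.Ioi (0 : ℝ)) : Type _ := anFun k X r

variable {k k' : ℤ_[p]ˣ →* Oˣ} {X : Region p} {r : Set.Ioi (0 : ℝ)}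

instance : AddCommGroup (AnFun k X r) := inferInstanceAs (AddCommGroup (anFun k X r))

instance : Module ℚ_[p] (AnFun k X r) := inferInstanceAs (Module ℚ_[p] (anFun k X r))

/-- The underlying function, as a linear map. -/
def AnFun.val : AnFun k X r →ₗ[ℚ_[p]] ((Fin 2 → ℚ_[p]) → O) := (anFun k X r).subtype

/-- The constructor of `AnFun`. -/
def AnFun.mk (F : (Fin 2 → ℚ_[p]) → O) (hF : F ∈ homogFun k X)
    (h : ∃ C, HasExpansions (p := p) F r C) : AnFun k X r := ⟨F, hF, h⟩

theorem AnFun.val_mk (F : (Fin 2 → ℚ_[p]) → O) (hF : F ∈ homogFun k X)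
    (h : ∃ C, HasExpansions (p := p) F r C) : (AnFun.mk (r := r) F hF h).val = F := rfl

theorem AnFun.val_injective : Function.Injective (AnFun.val : AnFun k X r → _) :=
  Subtype.val_injective

theorem AnFun.mem (F : AnFun k X r) : F.val ∈ homogFun k X := F.2.1

/-- The Gauss norm. -/
instance : Norm (AnFun k X r) := ⟨fun F => sInf {C | HasExpansions (p := p) F.val r C}⟩

theorem AnFun.norm_le (F : AnFun k X r) {C : ℝ} (h : HasExpansions (p := p) F.val r C) : ‖F‖ ≤ C :=
  csInf_le ⟨0, fun _ hD => hD.nonneg⟩ h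

/-- The infimum defining the norm is not claimed to be attained, hence the strict inequality; sharp
bounds are recovered by a limit. -/
theorem AnFun.hasExpansions (F : AnFun k X r) {C : ℝ} (hC : ‖F‖ < C) :
    HasExpansions (p := p) F.val r C := by
  obtain ⟨D, hD, hDC⟩ := exists_lt_of_csInf_lt F.2.2 hC
  exact HasExpansions.le_const hD hDC.le

theorem AnFun.norm_nonneg' (F : AnFun k X r) : 0 ≤ ‖F‖ :=
  le_csInf F.2.2 fun _ hC => hC.nonneg

theorem AnFun.norm_apply_le (F : AnFun k X r) (w : Fin 2 → ℚ_[p]) : ‖F.val w‖ ≤ ‖F‖ :=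
  le_of_forall_gt_imp_ge_of_dense fun _ hC => (F.hasExpansions hC).norm_apply_le r.2 w

theorem AnFun.norm_smul_le' (c : ℚ_[p]) (F : AnFun k X r) : ‖c • F‖ ≤ ‖c‖ * ‖F‖ := by
  refine le_of_forall_pos_le_add fun ε hε => ?_
  -- The slack is chosen so that multiplying it by ‖c‖ gives at most ε, including when c = 0.
  have h1 : HasExpansions (p := p) F.val r (‖F‖ + ε / (‖c‖ + 1)) :=
    F.hasExpansions (lt_add_of_pos_right _ (by positivity))
  have h2 := (c • F).norm_le (C := ‖c‖ * (‖F‖ + ε / (‖c‖ + 1))) (by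
    rw [map_smul]
    exact h1.const_smul r.2 c)
  refine h2.trans ?_
  rw [mul_add]
  gcongr
  rw [mul_div_assoc', div_le_iff₀ (by positivity)]
  nlinarith [norm_nonneg c]

theorem AnFun.norm_add_le_max' [IsUltrametricDist O] (F G : AnFun k X r) :
    ‖F + G‖ ≤ max ‖F‖ ‖G‖ := by
  refine le_of_forall_gt_imp_ge_of_dense fun C hC => ?_
  obtain ⟨h1, h2⟩ := max_lt_iff.1 hC
  refine (F + G).norm_le ?_
  rw [map_add]
  simpa using (F.hasExpansions h1).add_max r.2 (G.hasExpansions h2)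

theorem AnFun.normCore [IsUltrametricDist O] : NormedSpace.Core ℚ_[p] (AnFun k X r) where
  norm_nonneg := AnFun.norm_nonneg'
  norm_smul c F := by
    refine le_antisymm (F.norm_smul_le' c) ?_
    by_cases hc : c = 0
    · subst hc
      rw [norm_zero, zero_mul]
      exact AnFun.norm_nonneg' _
    · have h := (c • F).norm_smul_le' c⁻¹
      rw [smul_smul, inv_mul_cancel₀ hc, one_smul, norm_inv] at h
      rwa [← div_eq_inv_mul, le_div_iff₀' (norm_pos_iff.2 hc)] at h
  norm_triangle F G := (F.norm_add_le_max' G).trans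
    (max_le_add_of_nonneg F.norm_nonneg' G.norm_nonneg')
  norm_eq_zero_iff F := by
    refine ⟨fun h => AnFun.val_injective ?_, fun h => le_antisymm ?_ F.norm_nonneg'⟩
    · funext w
      rw [map_zero]
      exact norm_le_zero_iff.1 (h ▸ F.norm_apply_le w)
    · subst h
      exact AnFun.norm_le _ (by rw [map_zero]; exact HasExpansions.zero _)

variable [IsUltrametricDist O]

instance : NormedAddCommGroup (AnFun k X r) := NormedAddCommGroup.ofCore AnFun.normCore

instance : NormedSpace ℚ_[p] (AnFun k X r) := NormedSpace.ofCore AnFun.normCore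

instance : IsUltrametricDist (AnFun k X r) :=
  IsUltrametricDist.isUltrametricDist_of_forall_norm_add_le_max_norm AnFun.norm_add_le_max'

variable [CompleteSpace O]

/-- A pointwise convergent series of elements of `AnFun` with summable bounds converges in
norm. -/
theorem AnFun.hasSum_of_summable {F : ℕ → AnFun k X r} {C : ℕ → ℝ} (hC : Summable C)
    (hF : ∀ n, HasExpansions (p := p) (F n).val r (C n)) (G : AnFun k X r)
    (hG : ∀ w, HasSum (fun n => (F n).val w) (G.val w)) : HasSum F G := by
  have hs : Summable fun n => ‖F n‖ := hC.of_nonneg_of_le (fun n => norm_nonneg (F n))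
    fun n => (F n).norm_le (hF n)
  -- The remainder is the pointwise sum of the tail, so its Gauss norm is at most the tail of ∑ C n.
  have hsum : ∀ N, HasExpansions (p := p) (G - ∑ n ∈ Finset.range N, F n).val r
      (∑' n, C (n + N)) := fun N => by
    refine HasExpansions.hasSum r.2 (fun n => hF (n + N)) ((summable_nat_add_iff N).2 hC)
      fun w => ?_
    have h := (hasSum_nat_add_iff' N).2 (hG w)
    simpa [map_sub, map_sum] using h
  have ht : Filter.Tendsto (fun N => ∑ n ∈ Finset.range N, F n) Filter.atTop (nhds G) := by
    rw [tendsto_iff_norm_sub_tendsto_zero]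
    refine squeeze_zero (fun _ => norm_nonneg _) (fun N => ?_) (tendsto_sum_nat_add C)
    rw [norm_sub_rev]
    exact AnFun.norm_le _ (hsum N)
  exact (hasSum_iff_tendsto_nat_of_summable_norm hs).2 ht

instance : CompleteSpace (AnFun k X r) := by
  refine NormedAddCommGroup.completeSpace_of_summable_imp_tendsto fun F hF => ?_
  -- A summable slack, since expansions exist only for constants strictly above the norm.
  have hC : Summable fun n => ‖F n‖ + (1 / 2) ^ n := hF.add summable_geometric_two
  have hexp : ∀ n, HasExpansions (p := p) (F n).val r (‖F n‖ + (1 / 2) ^ n) := fun n =>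
    (F n).hasExpansions (lt_add_of_pos_right _ (by positivity))
  have hsum : ∀ w, HasSum (fun n => (F n).val w) (∑' n, (F n).val w) := fun w =>
    (Summable.of_norm_bounded hF fun n => (F n).norm_apply_le w).hasSum
  have hG := HasExpansions.hasSum r.2 hexp hC hsum
  refine ⟨AnFun.mk (fun w => ∑' n, (F n).val w) ⟨fun w hw => ?_, ⟨r, r.2, _, hG⟩, fun t w => ?_⟩
    ⟨_, hG⟩, (AnFun.hasSum_of_summable hC hexp _ hsum).tendsto_sum_nat⟩
  · simp [(F _).mem.1 w hw]
  · simp only [(F _).mem.2.2 t w]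
    exact (hsum w).summable.tsum_mul_left _

end AnFun

/-! ### Functions of the determinant pairing as analytic families in a Banach space -/

section DeltaFamilies

variable {p : Nat.Primes} {O : Type*} [NormedCommRing O] [NormedAlgebra ℚ_[p] O]

/-- A locally analytic function on `ℚ_p` on which `ℤ_p^×` acts through the character `k`. -/
structure IsHomAnalytic (k : ℤ_[p]ˣ →* Oˣ) (f : ℚ_[p] → O) : Prop where
  analytic : IsLocAnalytic (p := p) f
  homog : ∀ (t : ℤ_[p]ˣ) (s : ℚ_[p]), f (((t : ℤ_[p]) : ℚ_[p]) * s) = (k t : O) * f s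

theorem unit_smul_mem_iff (X : Region p) (t : ℤ_[p]ˣ) (w : Fin 2 → ℚ_[p]) :
    ((t : ℤ_[p]) : ℚ_[p]) • w ∈ X.carrier ↔ w ∈ X.carrier := by
  refine ⟨fun h => ?_, X.smul_mem t w⟩
  have := X.smul_mem t⁻¹ _ h
  rwa [smul_smul, ← PadicInt.coe_mul, Units.inv_mul, PadicInt.coe_one, one_smul] at this

theorem indicator_mem_homogFun {k : ℤ_[p]ˣ →* Oˣ} {X : Region p} {g : (Fin 2 → ℚ_[p]) → O}
    (h : IsLocAnalytic (p := p) (X.carrier.indicator g))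
    (hg : ∀ (t : ℤ_[p]ˣ), ∀ w ∈ X.carrier, g (((t : ℤ_[p]) : ℚ_[p]) • w) = (k t : O) * g w) :
    X.carrier.indicator g ∈ homogFun k X := by
  refine ⟨fun w hw => Set.indicator_of_notMem hw _, h, fun t w => ?_⟩
  by_cases hw : w ∈ X.carrier
  · rw [Set.indicator_of_mem hw, Set.indicator_of_mem (X.smul_mem t w hw), hg t w hw]
  · rw [Set.indicator_of_notMem hw, Set.indicator_of_notMem (by rwa [unit_smul_mem_iff]), mul_zero]

/-- Compare the expansions in u of f(t(s + u)) = k(t) f(s + u). Consequently z ↦ δ(y,z)ⁿ c_n(δ(x,z))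
is again homogeneous of weight k. -/
theorem taylor_homog {k : ℤ_[p]ˣ →* Oˣ} {f : ℚ_[p] → O} {r : ℝ} (hr : 0 < r)
    (hf : ∀ (t : ℤ_[p]ˣ) (s : ℚ_[p]), f (((t : ℤ_[p]) : ℚ_[p]) * s) = (k t : O) * f s)
    {c : ℕ → ℚ_[p] → O} (hc : ∀ s t, ‖t‖ < r → HasSum (fun n => t ^ n • c n s) (f (s + t)))
    (t : ℤ_[p]ˣ) (s : ℚ_[p]) (n : ℕ) :
    ((t : ℤ_[p]) : ℚ_[p]) ^ n • c n (((t : ℤ_[p]) : ℚ_[p]) * s) = (k t : O) * c n s := by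
  refine congrFun (powSeries_coeff_unique (p := p) hr
    (a := fun n => ((t : ℤ_[p]) : ℚ_[p]) ^ n • c n (((t : ℤ_[p]) : ℚ_[p]) * s))
    (b := fun n => (k t : O) * c n s) (g := fun u => (k t : O) * f (s + u))
    (fun u hu => ?_) (fun u hu => ?_)) n
  · have h := hc (((t : ℤ_[p]) : ℚ_[p]) * s) (((t : ℤ_[p]) : ℚ_[p]) * u)
      (by rwa [norm_unit_mul])
    rw [← mul_add, hf] at h
    refine h.congr_fun fun n => ?_
    rw [smul_smul, mul_pow, mul_comm]
  · refine ((hc s u hu).mul_left (k t : O)).congr_fun fun n => ?_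
    rw [mul_smul_comm]

variable [IsUltrametricDist O] [CompleteSpace O]

open Classical in
/-- The family `w ↦ (z ↦ f(δ(w, z)))` of functions on `Y`, parametrized by `w ∈ X`. -/
def deltaFun {k : ℤ_[p]ˣ →* Oˣ} {f : ℚ_[p] → O} {r : Set.Ioi (0 : ℝ)} {C : ℝ} (X Y : Region p)
    (hr1 : (r : ℝ) ≤ 1) (hC : HasExpansions (p := p) f r C) (hf : IsHomAnalytic k f)
    (w : Fin 2 → ℚ_[p]) : AnFun k Y r :=
  if hw : w ∈ X.carrier then
    have h := hC.indicator_comp_delta Y r.2 hr1 (X.norm_le w hw)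
    AnFun.mk (Y.carrier.indicator fun z => f (delta w z))
      (indicator_mem_homogFun ⟨r, r.2, C, h⟩ fun t z _ => by rw [delta_smul_right, hf.homog]) ⟨C, h⟩
  else 0

section

variable {k : ℤ_[p]ˣ →* Oˣ} {f : ℚ_[p] → O} {r : Set.Ioi (0 : ℝ)} {C : ℝ} (X Y : Region p)
  (hr1 : (r : ℝ) ≤ 1) (hC : HasExpansions (p := p) f r C) (hf : IsHomAnalytic k f)

omit [IsUltrametricDist O] [CompleteSpace O] in
theorem deltaFun_val {w : Fin 2 → ℚ_[p]} (hw : w ∈ X.carrier) :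
    (deltaFun X Y hr1 hC hf w).val = Y.carrier.indicator fun z => f (delta w z) := by
  rw [deltaFun, dif_pos hw, AnFun.val_mk]

omit [IsUltrametricDist O] [CompleteSpace O] in
theorem deltaFun_of_notMem {w : Fin 2 → ℚ_[p]} (hw : w ∉ X.carrier) :
    deltaFun X Y hr1 hC hf w = 0 := by
  rw [deltaFun, dif_neg hw]

omit [IsUltrametricDist O] [CompleteSpace O] in
theorem deltaFun_smul_val (t : ℤ_[p]ˣ) (w : Fin 2 → ℚ_[p]) :
    (deltaFun X Y hr1 hC hf (((t : ℤ_[p]) : ℚ_[p]) • w)).val =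
      (k t : O) • (deltaFun X Y hr1 hC hf w).val := by
  by_cases hw : w ∈ X.carrier
  · rw [deltaFun_val X Y hr1 hC hf hw, deltaFun_val X Y hr1 hC hf (X.smul_mem t w hw)]
    funext z
    by_cases hz : z ∈ Y.carrier <;> simp [hz, delta_smul_left, hf.homog]
  · rw [deltaFun_of_notMem X Y hr1 hC hf hw,
      deltaFun_of_notMem X Y hr1 hC hf (by rwa [unit_smul_mem_iff]), map_zero, smul_zero]

/-- By bilinearity f(δ(x + y, z)) = f(δ(x,z) + δ(y,z)) = ∑ₙ δ(y,z)ⁿ c_n(δ(x,z)) with c_n the Taylor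
coefficients of f. Polarized in y, the n-th term is multilinear with values in `AnFun` and norm at
most C / rⁿ, so the family has the radius and the constant of f itself. -/
theorem deltaFun_hasExpansions :
    HasExpansions (p := p) (deltaFun X Y hr1 hC hf) (r : ℝ) C := by
  obtain ⟨c, hcn, hcs⟩ := hC.exists_taylor r.2
  have hC0 := hC.nonneg
  have hr : 0 < (r : ℝ) := r.2
  intro x
  by_cases hx : x ∈ X.carrier
  · have hexp : ∀ (n : ℕ) (y : Fin n → Fin 2 → ℚ_[p]), HasExpansions (p := p)
        (Y.carrier.indicator fun z => (∏ i, delta (y i) z) • c n (delta x z)) r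
        ((∏ i, ‖y i‖) * (C / (r : ℝ) ^ n)) := fun n y =>
      HasExpansions.prod_delta_smul Y r.2 hr1
        ((hcn n).indicator_comp_delta Y r.2 hr1 (X.norm_le x hx)) Finset.univ y
    have hmem : ∀ (n : ℕ) (y : Fin n → Fin 2 → ℚ_[p]),
        (Y.carrier.indicator fun z => (∏ i, delta (y i) z) • c n (delta x z)) ∈ homogFun k Y :=
      fun n y => indicator_mem_homogFun ⟨r, r.2, _, hexp n y⟩ fun t z _ => by
        simp only [delta_smul_right, Finset.prod_mul_distrib, Finset.prod_const, Finset.card_univ,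
          Fintype.card_fin]
        rw [mul_comm, mul_smul, taylor_homog r.2 hf.homog hcs, mul_smul_comm]
    -- At each z the term is a product of linear forms in the yᵢ times a constant; multilinearity in
    -- `AnFun` is then checked pointwise.
    have hval : ∀ (n : ℕ) (y : Fin n → Fin 2 → ℚ_[p]) (z : Fin 2 → ℚ_[p]),
        (AnFun.mk (r := r) _ (hmem n y) ⟨_, hexp n y⟩).val z =
          (((MultilinearMap.mkPiAlgebra ℚ_[p] (Fin n) ℚ_[p]).compLinearMap
            fun _ => (deltaBilin p).flip z).smulRight
              (Y.carrier.indicator (fun z => c n (delta x z)) z)) y := fun n y z => by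
      rw [AnFun.val_mk]
      by_cases hz : z ∈ Y.carrier
      · simp only [hz, Set.indicator_of_mem]
        rfl
      · simp [hz]
    refine ⟨fun n => MultilinearMap.mkContinuous
      { toFun := fun y => AnFun.mk (r := r) _ (hmem n y) ⟨_, hexp n y⟩
        map_update_add' := fun y i u v => AnFun.val_injective <| by
          funext z
          rw [map_add, Pi.add_apply, hval, hval, hval, MultilinearMap.map_update_add]
        map_update_smul' := fun y i a u => AnFun.val_injective <| by
          funext z
          rw [map_smul, Pi.smul_apply, hval, hval, MultilinearMap.map_update_smul] }
      (C / (r : ℝ) ^ n) (fun y => ?_), fun n => ?_, fun y hy => ?_⟩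
    · refine (AnFun.norm_le _ (hexp n y)).trans_eq (mul_comm _ _)
    · rw [← le_div_iff₀ (pow_pos hr n)]
      exact MultilinearMap.mkContinuous_norm_le _ (by positivity) _
    · have hxy := X.add_mem x y (hy.trans_le hr1) hx
      refine AnFun.hasSum_of_summable (summable_geometric_bound hr hy C)
        (fun n => (hexp n fun _ => y).le_const (le_of_eq ?_)) _ fun z => ?_
      · rw [Finset.prod_const, Finset.card_univ, Fintype.card_fin, div_pow]
        field_simp
      · rw [deltaFun_val X Y hr1 hC hf hxy]
        by_cases hz : z ∈ Y.carrier
        · rw [Set.indicator_of_mem hz, delta_add_left]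
          refine (hcs (delta x z) (delta y z) ?_).congr_fun fun n => ?_
          · refine ((norm_delta_le y z).trans ?_).trans_lt hy
            exact mul_le_of_le_one_right (norm_nonneg _) (Y.norm_le z hz)
          · refine (congrFun (AnFun.val_mk _ (hmem n fun _ => y) ⟨_, hexp n fun _ => y⟩) z).trans ?_
            rw [Set.indicator_of_mem hz]
            simp
        · rw [Set.indicator_of_notMem hz]
          convert hasSum_zero using 2 with n
          refine (congrFun (AnFun.val_mk _ (hmem n fun _ => y) ⟨_, hexp n fun _ => y⟩) z).trans ?_
          rw [Set.indicator_of_notMem hz]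
  -- Outside `X` the family vanishes on a whole ball, because the complement of a region is also a
  -- union of unit balls.
  · refine ⟨0, fun n => by simpa using hC0, fun y hy => ?_⟩
    have hxy : x + y ∉ X.carrier := fun h' => hx (by
      have := X.add_mem (x + y) (-y) (by rw [norm_neg]; exact hy.trans_le hr1) h'
      simpa using this)
    rw [deltaFun_of_notMem X Y hr1 hC hf hxy]
    simp

end

theorem le_mul_of_forall_pos {a b x : ℝ} (h : ∀ ε > 0, x ≤ (a + ε) * (b + ε)) : x ≤ a * b := by
  have hlim : Filter.Tendsto (fun ε : ℝ => (a + ε) * (b + ε)) (nhdsWithin 0 (Set.Ioi 0))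
      (nhds (a * b)) := by
    have : ContinuousAt (fun ε : ℝ => (a + ε) * (b + ε)) 0 := by fun_prop
    simpa using this.tendsto.mono_left nhdsWithin_le_nhds
  exact ge_of_tendsto hlim (Filter.eventually_of_mem self_mem_nhdsWithin h)

theorem AnFun.hasExpansions_mul {k₁ k₂ : ℤ_[p]ˣ →* Oˣ} {X : Region p} {r : Set.Ioi (0 : ℝ)}
    (F : AnFun k₁ X r) (G : AnFun k₂ X r) {C D : ℝ} (hC : ‖F‖ < C) (hD : ‖G‖ < D) :
    HasExpansions (p := p) (F.val * G.val) r (C * D) := by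
  have h := (F.hasExpansions hC).bilin r.2 (ContinuousLinearMap.mul ℚ_[p] O)
    (ContinuousLinearMap.opNorm_mul_le _ _) (G.hasExpansions hD)
  rwa [one_mul] at h

/-- The product of homogeneous functions. -/
def AnFun.mul {k₁ k₂ k₃ : ℤ_[p]ˣ →* Oˣ} (hk : k₁ * k₂ = k₃) {X : Region p} {r : Set.Ioi (0 : ℝ)}
    (F : AnFun k₁ X r) (G : AnFun k₂ X r) : AnFun k₃ X r :=
  have h : ∃ C, HasExpansions (p := p) (F.val * G.val) r C :=
    ⟨_, F.hasExpansions_mul G (lt_add_one _) (lt_add_one _)⟩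
  AnFun.mk (F.val * G.val) ⟨fun w hw => by simp [F.mem.1 w hw], ⟨r, r.2, h⟩, fun t w => by
    simp only [Pi.mul_apply, F.mem.2.2, G.mem.2.2, ← hk, MonoidHom.mul_apply, Units.val_mul]
    ring⟩ h

theorem AnFun.mul_val {k₁ k₂ k₃ : ℤ_[p]ˣ →* Oˣ} (hk : k₁ * k₂ = k₃) {X : Region p}
    {r : Set.Ioi (0 : ℝ)} (F : AnFun k₁ X r) (G : AnFun k₂ X r) :
    (AnFun.mul hk F G).val = F.val * G.val := rfl

/-- Multiplication of homogeneous functions as a bilinear map. -/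
def mulAnₗ {k₁ k₂ k₃ : ℤ_[p]ˣ →* Oˣ} (hk : k₁ * k₂ = k₃) (X : Region p) (r : Set.Ioi (0 : ℝ)) :
    AnFun k₁ X r →ₗ[ℚ_[p]] AnFun k₂ X r →ₗ[ℚ_[p]] AnFun k₃ X r :=
  LinearMap.mk₂ ℚ_[p] (AnFun.mul hk)
    (fun _ _ _ => AnFun.val_injective <| by simp only [AnFun.mul_val, map_add, add_mul])
    (fun _ _ _ => AnFun.val_injective <| by simp only [AnFun.mul_val, map_smul, smul_mul_assoc])
    (fun _ _ _ => AnFun.val_injective <| by simp only [AnFun.mul_val, map_add, mul_add])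
    (fun _ _ _ => AnFun.val_injective <| by simp only [AnFun.mul_val, map_smul, mul_smul_comm])

theorem AnFun.norm_mul_le {k₁ k₂ k₃ : ℤ_[p]ˣ →* Oˣ} (hk : k₁ * k₂ = k₃) {X : Region p}
    {r : Set.Ioi (0 : ℝ)} (F : AnFun k₁ X r) (G : AnFun k₂ X r) :
    ‖AnFun.mul hk F G‖ ≤ 1 * ‖F‖ * ‖G‖ := by
  rw [one_mul]
  exact le_mul_of_forall_pos fun ε hε => AnFun.norm_le _
    (F.hasExpansions_mul G (lt_add_of_pos_right _ hε) (lt_add_of_pos_right _ hε))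

/-- Multiplication of homogeneous functions as a continuous bilinear map. -/
def mulAn {k₁ k₂ k₃ : ℤ_[p]ˣ →* Oˣ} (hk : k₁ * k₂ = k₃) (X : Region p) (r : Set.Ioi (0 : ℝ)) :
    AnFun k₁ X r →L[ℚ_[p]] AnFun k₂ X r →L[ℚ_[p]] AnFun k₃ X r :=
  LinearMap.mkContinuous₂ (mulAnₗ hk X r) 1 (AnFun.norm_mul_le hk)

theorem mulAn_val {k₁ k₂ k₃ : ℤ_[p]ˣ →* Oˣ} (hk : k₁ * k₂ = k₃) (X : Region p)
    (r : Set.Ioi (0 : ℝ)) (F : AnFun k₁ X r) (G : AnFun k₂ X r) :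
    (mulAn hk X r F G).val = F.val * G.val := rfl

omit [IsUltrametricDist O] [CompleteSpace O] in
-- The bounds M * C for all C > ‖F‖ pass to the limit C → ‖F‖; this needs no sign condition on M.
theorem HomDist.exists_bound {k : ℤ_[p]ˣ →* Oˣ} {X : Region p} (μ : HomDist k X)
    (r : Set.Ioi (0 : ℝ)) : ∃ M : ℝ, ∀ F : AnFun k X r, ‖μ.1 ⟨F.val, F.mem⟩‖ ≤ M * ‖F‖ := by
  obtain ⟨M, hM⟩ := μ.2 r r.2
  refine ⟨M, fun F => ?_⟩
  have hlim : Filter.Tendsto (fun ε : ℝ => M * (‖F‖ + ε))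
      (nhdsWithin 0 (Set.Ioi 0)) (nhds (M * ‖F‖)) := by
    have : ContinuousAt (fun ε : ℝ => M * (‖F‖ + ε)) 0 := by fun_prop
    simpa using this.tendsto.mono_left nhdsWithin_le_nhds
  exact ge_of_tendsto hlim (Filter.eventually_of_mem self_mem_nhdsWithin fun ε hε =>
    hM ⟨F.val, F.mem⟩ _ (F.hasExpansions (lt_add_of_pos_right _ hε)))

/-- A distribution as a linear functional on functions with a given radius of analyticity. -/
def distLin {k : ℤ_[p]ˣ →* Oˣ} {X : Region p} (μ : HomDist k X) (r : Set.Ioi (0 : ℝ)) :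
    AnFun k X r →ₗ[ℚ_[p]] O where
  toFun F := μ.1 ⟨F.val, F.mem⟩
  map_add' F G := by
    rw [← map_add]
    rfl
  map_smul' c F := by
    have h : (⟨(c • F).val, (c • F).mem⟩ : homogFun k X) =
        algebraMap ℚ_[p] O c • ⟨F.val, F.mem⟩ := by
      ext1
      exact (algebraMap_smul O c F.val).symm
    rw [h, map_smul, algebraMap_smul, RingHom.id_apply]

/-- A distribution as a continuous functional on functions with a given radius of analyticity. -/
def distCLM {k : ℤ_[p]ˣ →* Oˣ} {X : Region p} (μ : HomDist k X) (r : Set.Ioi (0 : ℝ)) :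
    AnFun k X r →L[ℚ_[p]] O :=
  LinearMap.mkContinuousOfExistsBound (distLin μ r) (HomDist.exists_bound μ r)

omit [CompleteSpace O] in
theorem distCLM_apply {k : ℤ_[p]ˣ →* Oˣ} {X : Region p} (μ : HomDist k X) (r : Set.Ioi (0 : ℝ))
    (F : AnFun k X r) : distCLM μ r F = μ.1 ⟨F.val, F.mem⟩ := rfl

omit [CompleteSpace O] in
-- `AnFun` is given only a ℚ_p-linear structure, so the `O`-linearity of a distribution is expressed
-- through the underlying functions.
theorem distCLM_of_val_eq_smul {k : ℤ_[p]ˣ →* Oˣ} {X : Region p} (μ : HomDist k X)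
    (r : Set.Ioi (0 : ℝ)) {F G : AnFun k X r} {c : O} (h : F.val = c • G.val) :
    distCLM μ r F = c * distCLM μ r G := by
  rw [distCLM_apply, distCLM_apply, ← smul_eq_mul, ← map_smul]
  congr 1
  ext1
  exact h

end DeltaFamilies

/-! ### Iterated integrals of functions of the determinant pairing -/

section TripleIntegrals

variable {p : Nat.Primes} {O : Type*} [NormedCommRing O] [NormedAlgebra ℚ_[p] O]

/-- `f₁(δ(w₂,w₃)) f₂(δ(w₁,w₃)) f₃(δ(w₁,w₂))`. -/
def triDelta (f₁ f₂ f₃ : ℚ_[p] → O) (w₁ w₂ w₃ : Fin 2 → ℚ_[p]) : O :=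
  f₁ (delta w₂ w₃) * f₂ (delta w₁ w₃) * f₃ (delta w₁ w₂)

theorem distIntegral_of_mem {k : ℤ_[p]ˣ →* Oˣ} {X : Region p} (μ : HomDist k X)
    {f : (Fin 2 → ℚ_[p]) → O} (h : X.carrier.indicator f ∈ homogFun k X) :
    distIntegral μ f = μ.1 ⟨X.carrier.indicator f, h⟩ := dif_pos h

theorem distIntegral_congr {k : ℤ_[p]ˣ →* Oˣ} {X : Region p} (μ : HomDist k X)
    {f g : (Fin 2 → ℚ_[p]) → O} (h : ∀ w ∈ X.carrier, f w = g w) :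
    distIntegral μ f = distIntegral μ g := by
  unfold distIntegral
  rw [Set.indicator_congr h]

/-- Membership in 𝒜_k(X) is essential: `distIntegral` is 0 off that space, so it is linear in the
integrand only there. Linearity in the distribution holds unconditionally. -/
theorem distIntegral_add {k : ℤ_[p]ˣ →* Oˣ} {X : Region p} (μ : HomDist k X)
    {f g : (Fin 2 → ℚ_[p]) → O} (hf : X.carrier.indicator f ∈ homogFun k X)
    (hg : X.carrier.indicator g ∈ homogFun k X) :
    distIntegral μ (fun w => f w + g w) = distIntegral μ f + distIntegral μ g := by
  have h : X.carrier.indicator (fun w => f w + g w) =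
      X.carrier.indicator f + X.carrier.indicator g := Set.indicator_add _ _ _
  have hfg : X.carrier.indicator (fun w => f w + g w) ∈ homogFun k X := by
    rw [h]; exact add_mem hf hg
  rw [distIntegral_of_mem μ hf, distIntegral_of_mem μ hg, distIntegral_of_mem μ hfg, ← map_add]
  congr 1
  ext1
  exact h

theorem distIntegral_const_mul {k : ℤ_[p]ˣ →* Oˣ} {X : Region p} (μ : HomDist k X)
    {f : (Fin 2 → ℚ_[p]) → O} (hf : X.carrier.indicator f ∈ homogFun k X) (c : O) :
    distIntegral μ (fun w => c * f w) = c * distIntegral μ f := by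
  have h : X.carrier.indicator (fun w => c * f w) = c • X.carrier.indicator f := by
    funext w
    by_cases hw : w ∈ X.carrier <;> simp [hw]
  have hcf : X.carrier.indicator (fun w => c * f w) ∈ homogFun k X := by
    rw [h]; exact Submodule.smul_mem _ _ hf
  rw [distIntegral_of_mem μ hf, distIntegral_of_mem μ hcf, ← smul_eq_mul, ← map_smul]
  congr 1
  ext1
  exact h

theorem distIntegral_zero {k : ℤ_[p]ˣ →* Oˣ} {X : Region p} (μ : HomDist k X) :
    distIntegral μ (fun _ => 0) = 0 := by
  have h : X.carrier.indicator (fun _ => (0 : O)) = 0 := Set.indicator_zero _ _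
  rw [distIntegral_of_mem μ (by rw [h]; exact zero_mem _)]
  convert map_zero μ.1
  exact h

theorem add_distIntegral {k : ℤ_[p]ˣ →* Oˣ} {X : Region p} (μ ν : HomDist k X)
    (f : (Fin 2 → ℚ_[p]) → O) :
    distIntegral (μ + ν) f = distIntegral μ f + distIntegral ν f := by
  by_cases h : X.carrier.indicator f ∈ homogFun k X
  · simp only [distIntegral_of_mem _ h]
    rfl
  · simp [distIntegral, h]

theorem smul_distIntegral {k : ℤ_[p]ˣ →* Oˣ} {X : Region p} (c : O) (μ : HomDist k X)
    (f : (Fin 2 → ℚ_[p]) → O) : distIntegral (c • μ) f = c * distIntegral μ f := by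
  by_cases h : X.carrier.indicator f ∈ homogFun k X
  · simp only [distIntegral_of_mem _ h]
    rfl
  · simp [distIntegral, h]

/-- The matrix `σ` maps the region `X` into itself. -/
def Region.StableUnder (X : Region p) (σ : Matrix (Fin 2) (Fin 2) ℚ_[p]) : Prop :=
  ∀ w ∈ X.carrier, Matrix.vecMul w σ ∈ X.carrier

theorem distIntegral_distAct {k : ℤ_[p]ˣ →* Oˣ} {X : Region p}
    {σ : Matrix (Fin 2) (Fin 2) ℚ_[p]} (hσ : X.StableUnder σ) (μ : HomDist k X)
    {f : (Fin 2 → ℚ_[p]) → O} (hf : X.carrier.indicator f ∈ homogFun k X) :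
    distIntegral (distAct σ μ) f = distIntegral μ fun w => f (Matrix.vecMul w σ) := by
  have h : (pull k X σ ⟨X.carrier.indicator f, hf⟩).1 =
      X.carrier.indicator fun w => f (Matrix.vecMul w σ) := by
    change (X.carrier.indicator fun w => X.carrier.indicator f (Matrix.vecMul w σ)) = _
    exact Set.indicator_congr fun w hw => Set.indicator_of_mem (hσ w hw) f
  have hmem : (X.carrier.indicator fun w => f (Matrix.vecMul w σ)) ∈ homogFun k X := by
    rw [← h]; exact (pull k X σ _).2
  rw [distIntegral_of_mem _ hf, distIntegral_of_mem _ hmem]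
  change μ.1 (pull k X σ ⟨X.carrier.indicator f, hf⟩) = _
  congr 1
  ext1
  exact h

/-- Since wσ stays in `X`, the truncation built into `pull` for τ has no effect there; no stability
under τ is needed. -/
theorem distAct_mul {k : ℤ_[p]ˣ →* Oˣ} {X : Region p} {σ : Matrix (Fin 2) (Fin 2) ℚ_[p]}
    (hσ : X.StableUnder σ) (τ : Matrix (Fin 2) (Fin 2) ℚ_[p]) (μ : HomDist k X) :
    distAct τ (distAct σ μ) = distAct (σ * τ) μ := by
  ext F
  change μ.1 (pull k X σ (pull k X τ F)) = μ.1 (pull k X (σ * τ) F)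
  congr 1
  ext1
  change (X.carrier.indicator fun w =>
    X.carrier.indicator (fun w => F.1 (Matrix.vecMul w τ)) (Matrix.vecMul w σ)) =
      X.carrier.indicator fun w => F.1 (Matrix.vecMul w (σ * τ))
  refine Set.indicator_congr fun w hw => ?_
  rw [Set.indicator_of_mem (hσ w hw), Matrix.vecMul_vecMul]

theorem distAct_unit_smul {k : ℤ_[p]ˣ →* Oˣ} {X : Region p} (t : ℤ_[p]ˣ)
    (σ : Matrix (Fin 2) (Fin 2) ℚ_[p]) (μ : HomDist k X) :
    distAct (((t : ℤ_[p]) : ℚ_[p]) • σ) μ = (k t : O) • distAct σ μ := by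
  ext F
  change μ.1 (pull k X _ F) = (k t : O) • μ.1 (pull k X σ F)
  rw [← map_smul]
  congr 1
  ext1
  change (X.carrier.indicator fun w => F.1 (Matrix.vecMul w _)) =
    (k t : O) • X.carrier.indicator fun w => F.1 (Matrix.vecMul w σ)
  funext w
  by_cases hw : w ∈ X.carrier
  · rw [Pi.smul_apply, Set.indicator_of_mem hw, Set.indicator_of_mem hw, Matrix.vecMul_smul,
      F.2.2.2, smul_eq_mul]
  · rw [Pi.smul_apply, Set.indicator_of_notMem hw, Set.indicator_of_notMem hw, smul_zero]

variable [IsUltrametricDist O] [CompleteSpace O]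

/-- Integration of a family of products in the last variable. -/
def integrateFamily {k₁ k₂ k₃ : ℤ_[p]ˣ →* Oˣ} (hk : k₁ * k₂ = k₃) {f : ℚ_[p] → O}
    {r : Set.Ioi (0 : ℝ)} {C : ℝ} (X : Region p) {Y : Region p} (hr1 : (r : ℝ) ≤ 1)
    (hC : HasExpansions (p := p) f r C) (hf : IsHomAnalytic k₁ f) (μ : HomDist k₃ Y)
    (F : AnFun k₂ Y r) (w : Fin 2 → ℚ_[p]) : O :=
  distCLM μ r ((mulAn hk Y r).flip F (deltaFun X Y hr1 hC hf w))

section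

variable {k₁ k₂ k₃ : ℤ_[p]ˣ →* Oˣ} (hk : k₁ * k₂ = k₃) {f : ℚ_[p] → O}
  {r : Set.Ioi (0 : ℝ)} {C : ℝ} (X : Region p) {Y : Region p} (hr1 : (r : ℝ) ≤ 1)
  (hC : HasExpansions (p := p) f r C) (hf : IsHomAnalytic k₁ f) (μ : HomDist k₃ Y)
  (F : AnFun k₂ Y r)

/-- The integral is a fixed continuous linear functional applied to the analytic family `deltaFun`.
-/
theorem integrateFamily_hasExpansions :
    HasExpansions (p := p) (integrateFamily hk X hr1 hC hf μ F) r
      (‖distCLM μ r‖ * (‖(mulAn hk Y r).flip‖ * ‖F‖) * C) :=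
  (deltaFun_hasExpansions X Y hr1 hC hf).clm r.2 ((distCLM μ r).comp ((mulAn hk Y r).flip F))
    ((ContinuousLinearMap.opNorm_comp_le _ _).trans
      (mul_le_mul_of_nonneg_left (ContinuousLinearMap.le_opNorm _ _) (norm_nonneg (distCLM μ r))))

theorem integrateFamily_mem : integrateFamily hk X hr1 hC hf μ F ∈ homogFun k₁ X := by
  refine ⟨fun w hw => ?_, ⟨r, r.2, _, integrateFamily_hasExpansions hk X hr1 hC hf μ F⟩,
    fun t w => ?_⟩
  · rw [integrateFamily, deltaFun_of_notMem X Y hr1 hC hf hw, map_zero, map_zero]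
  · refine distCLM_of_val_eq_smul μ r ?_
    change (deltaFun X Y hr1 hC hf _).val * F.val =
      (k₁ t : O) • ((deltaFun X Y hr1 hC hf _).val * F.val)
    rw [deltaFun_smul_val, smul_mul_assoc]

/-- Integration of a family of products in the last variable, as a linear map. -/
def integrateLin : AnFun k₂ Y r →ₗ[ℚ_[p]] AnFun k₁ X r where
  toFun F := AnFun.mk (integrateFamily hk X hr1 hC hf μ F)
    (integrateFamily_mem hk X hr1 hC hf μ F) ⟨_, integrateFamily_hasExpansions hk X hr1 hC hf μ F⟩
  map_add' F G := AnFun.val_injective <| by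
    funext w
    rw [map_add]
    simp only [AnFun.val_mk, Pi.add_apply, integrateFamily, map_add, add_apply]
  map_smul' c F := AnFun.val_injective <| by
    funext w
    rw [map_smul]
    simp only [AnFun.val_mk, Pi.smul_apply, integrateFamily, map_smul,
      smul_apply, RingHom.id_apply]

/-- Integration of a family of products in the last variable, as a continuous linear map. -/
def integrateCLM : AnFun k₂ Y r →L[ℚ_[p]] AnFun k₁ X r :=
  LinearMap.mkContinuous (integrateLin hk X hr1 hC hf μ)
    (‖distCLM μ r‖ * ‖(mulAn hk Y r).flip‖ * C) fun F => by
      refine (AnFun.norm_le _ (integrateFamily_hasExpansions hk X hr1 hC hf μ F)).trans_eq ?_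
      ring

theorem integrateCLM_val (w : Fin 2 → ℚ_[p]) : (integrateCLM hk X hr1 hC hf μ F).val w =
    distCLM μ r (mulAn hk Y r (deltaFun X Y hr1 hC hf w) F) := rfl

end

omit [IsUltrametricDist O] [CompleteSpace O] in
theorem exists_common_expansions {f₁ f₂ f₃ : ℚ_[p] → O} (h₁ : IsLocAnalytic (p := p) f₁)
    (h₂ : IsLocAnalytic (p := p) f₂) (h₃ : IsLocAnalytic (p := p) f₃) :
    ∃ (r : Set.Ioi (0 : ℝ)) (C₁ C₂ C₃ : ℝ), (r : ℝ) ≤ 1 ∧ HasExpansions (p := p) f₁ r C₁ ∧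
      HasExpansions (p := p) f₂ r C₂ ∧ HasExpansions (p := p) f₃ r C₃ := by
  obtain ⟨r₁, hr₁, C₁, hC₁⟩ := h₁
  obtain ⟨r₂, hr₂, C₂, hC₂⟩ := h₂
  obtain ⟨r₃, hr₃, C₃, hC₃⟩ := h₃
  have h0 : 0 < min (min r₁ r₂) (min r₃ 1) := by positivity
  exact ⟨⟨_, h0⟩, C₁, C₂, C₃, (min_le_right _ _).trans (min_le_right _ _),
    hC₁.mono h0 ((min_le_left _ _).trans (min_le_left _ _)),
    hC₂.mono h0 ((min_le_left _ _).trans (min_le_right _ _)),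
    hC₃.mono h0 ((min_le_right _ _).trans (min_le_left _ _))⟩

/-- The iterated integrals of `triDelta` are integrals of homogeneous locally analytic
functions. -/
structure TripleIntegrable (k₁ k₂ k₃ : ℤ_[p]ˣ →* Oˣ) (X₁ X₂ X₃ : Region p)
    (Δ : (Fin 2 → ℚ_[p]) → (Fin 2 → ℚ_[p]) → (Fin 2 → ℚ_[p]) → O) : Prop where
  inner : ∀ w₁ ∈ X₁.carrier, ∀ w₂ ∈ X₂.carrier, X₃.carrier.indicator (Δ w₁ w₂) ∈ homogFun k₃ X₃
  middle : ∀ (μ₃ : HomDist k₃ X₃), ∀ w₁ ∈ X₁.carrier,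
    X₂.carrier.indicator (fun w₂ => distIntegral μ₃ (Δ w₁ w₂)) ∈ homogFun k₂ X₂
  outer : ∀ (μ₂ : HomDist k₂ X₂) (μ₃ : HomDist k₃ X₃),
    X₁.carrier.indicator (fun w₁ => distIntegral μ₂ fun w₂ => distIntegral μ₃ (Δ w₁ w₂)) ∈
      homogFun k₁ X₁

/-- The inner integrand is a product of members of the families f₁(δ(w₂,·)) and f₂(δ(w₁,·)).
Integrating it against μ₃ gives an element of `AnFun` in w₂ depending continuously and linearly on
f₂(δ(w₁,·)). After multiplication by f₃(δ(w₁,·)) and integration against μ₂, the result is a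
continuous bilinear expression in two analytic families of the parameter w₁. The hypotheses on
weights say that each variable occurs in exactly two of the three pairings. -/
theorem tripleIntegrable_triDelta {k₁ k₂ k₃ l₁ l₂ l₃ : ℤ_[p]ˣ →* Oˣ} (h₁ : l₂ * l₃ = k₁)
    (h₂ : l₁ * l₃ = k₂) (h₃ : l₁ * l₂ = k₃) {f₁ f₂ f₃ : ℚ_[p] → O} (hf₁ : IsHomAnalytic l₁ f₁)
    (hf₂ : IsHomAnalytic l₂ f₂) (hf₃ : IsHomAnalytic l₃ f₃) (X₁ X₂ X₃ : Region p) :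
    TripleIntegrable k₁ k₂ k₃ X₁ X₂ X₃ (triDelta f₁ f₂ f₃) := by
  obtain ⟨r, C₁, C₂, C₃, hr1, hC₁, hC₂, hC₃⟩ :=
    exists_common_expansions hf₁.analytic hf₂.analytic hf₃.analytic
  have hinner : ∀ w₁ ∈ X₁.carrier, ∀ w₂ ∈ X₂.carrier, X₃.carrier.indicator (triDelta f₁ f₂ f₃ w₁ w₂)
      = f₃ (delta w₁ w₂) • (mulAn h₃ X₃ r (deltaFun X₂ X₃ hr1 hC₁ hf₁ w₂)
        (deltaFun X₁ X₃ hr1 hC₂ hf₂ w₁)).val := fun w₁ hw₁ w₂ hw₂ => by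
    rw [mulAn_val, deltaFun_val _ _ _ _ _ hw₁, deltaFun_val _ _ _ _ _ hw₂]
    funext z
    by_cases hz : z ∈ X₃.carrier
    · simp [hz, triDelta, mul_comm]
    · simp [hz]
  have hinner_mem : ∀ w₁ ∈ X₁.carrier, ∀ w₂ ∈ X₂.carrier,
      X₃.carrier.indicator (triDelta f₁ f₂ f₃ w₁ w₂) ∈ homogFun k₃ X₃ := fun w₁ hw₁ w₂ hw₂ => by
    rw [hinner w₁ hw₁ w₂ hw₂]
    exact Submodule.smul_mem _ _ (AnFun.mem _)
  have hmiddle : ∀ (μ₃ : HomDist k₃ X₃), ∀ w₁ ∈ X₁.carrier,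
      X₂.carrier.indicator (fun w₂ => distIntegral μ₃ (triDelta f₁ f₂ f₃ w₁ w₂)) =
        (mulAn (mul_comm l₁ l₃ ▸ h₂) X₂ r (deltaFun X₁ X₂ hr1 hC₃ hf₃ w₁)
          (integrateCLM h₃ X₂ hr1 hC₁ hf₁ μ₃ (deltaFun X₁ X₃ hr1 hC₂ hf₂ w₁))).val := by
    intro μ₃ w₁ hw₁
    rw [mulAn_val, deltaFun_val _ _ _ _ _ hw₁]
    funext w₂
    by_cases hw₂ : w₂ ∈ X₂.carrier
    · rw [Set.indicator_of_mem hw₂, Pi.mul_apply, Set.indicator_of_mem hw₂, integrateCLM_val,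
        distIntegral_of_mem _ (hinner_mem w₁ hw₁ w₂ hw₂), distCLM_apply, ← smul_eq_mul, ← map_smul]
      congr 1
      ext1
      exact hinner w₁ hw₁ w₂ hw₂
    · rw [Set.indicator_of_notMem hw₂, Pi.mul_apply, Set.indicator_of_notMem hw₂, zero_mul]
  have hmiddle_mem : ∀ (μ₃ : HomDist k₃ X₃), ∀ w₁ ∈ X₁.carrier,
      X₂.carrier.indicator (fun w₂ => distIntegral μ₃ (triDelta f₁ f₂ f₃ w₁ w₂)) ∈
        homogFun k₂ X₂ := fun μ₃ w₁ hw₁ => by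
    rw [hmiddle μ₃ w₁ hw₁]
    exact AnFun.mem _
  refine ⟨hinner_mem, hmiddle_mem, fun μ₂ μ₃ => indicator_mem_homogFun ?_ fun t w₁ hw₁ => ?_⟩
  · have hval : ∀ w₁ ∈ X₁.carrier,
        distIntegral μ₂ (fun w₂ => distIntegral μ₃ (triDelta f₁ f₂ f₃ w₁ w₂)) =
          distCLM μ₂ r (mulAn (mul_comm l₁ l₃ ▸ h₂) X₂ r (deltaFun X₁ X₂ hr1 hC₃ hf₃ w₁)
          (integrateCLM h₃ X₂ hr1 hC₁ hf₁ μ₃ (deltaFun X₁ X₃ hr1 hC₂ hf₂ w₁))) := fun w₁ hw₁ => by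
      rw [distIntegral_of_mem _ (hmiddle_mem μ₃ w₁ hw₁), distCLM_apply]
      congr 1
      ext1
      exact hmiddle μ₃ w₁ hw₁
    rw [Set.indicator_congr hval]
    -- Both factors are `AnFun`-valued analytic functions of w₁; their product is taken in `AnFun`
    -- and μ₂ is applied last.
    have hexp := ((deltaFun_hasExpansions X₁ X₂ hr1 hC₃ hf₃).bilin r.2
      (mulAn (mul_comm l₁ l₃ ▸ h₂) X₂ r) le_rfl
      ((deltaFun_hasExpansions X₁ X₃ hr1 hC₂ hf₂).clm r.2
        (integrateCLM h₃ X₂ hr1 hC₁ hf₁ μ₃) le_rfl)).clm r.2 (distCLM μ₂ r) le_rfl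
    exact ⟨r, r.2, _, hexp.indicator X₁ hr1⟩
  · have hc : (k₁ t : O) = (l₂ t : O) * (l₃ t : O) := by simp [← h₁]
    have h3 : ∀ w₂ ∈ X₂.carrier,
        distIntegral μ₃ (triDelta f₁ f₂ f₃ (((t : ℤ_[p]) : ℚ_[p]) • w₁) w₂) =
          (k₁ t : O) * distIntegral μ₃ (triDelta f₁ f₂ f₃ w₁ w₂) := fun w₂ hw₂ => by
      rw [← distIntegral_const_mul μ₃ (hinner_mem w₁ hw₁ w₂ hw₂)]
      congr 1
      funext w₃
      rw [triDelta, triDelta, delta_smul_left, delta_smul_left, hf₂.homog, hf₃.homog, hc]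
      ring
    rw [distIntegral_congr μ₂ h3, distIntegral_const_mul μ₂ (hmiddle_mem μ₃ w₁ hw₁)]

end TripleIntegrals

/-! ### Weights -/

section Weights

variable {p : Nat.Primes} {O : Type*} [NormedCommRing O]

theorem unitExt_of_norm_eq_one (k : ℤ_[p]ˣ →* Oˣ) {x : ℚ_[p]} (h : ‖x‖ = 1) :
    unitExt k x = (k (PadicInt.mkUnits h) : O) := dif_pos h

theorem unitExt_of_norm_ne_one (k : ℤ_[p]ˣ →* Oˣ) {x : ℚ_[p]} (h : ‖x‖ ≠ 1) :
    unitExt k x = 0 := dif_neg h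

theorem unitExt_unit (k : ℤ_[p]ˣ →* Oˣ) (t : ℤ_[p]ˣ) :
    unitExt k ((t : ℤ_[p]) : ℚ_[p]) = (k t : O) := by
  have h : ‖((t : ℤ_[p]) : ℚ_[p])‖ = 1 := by
    rw [PadicInt.padic_norm_e_of_padicInt, PadicInt.norm_units]
  rw [unitExt_of_norm_eq_one k h]
  congr 2
  ext
  rfl

theorem exists_unit_of_norm_eq_one {x : ℚ_[p]} (h : ‖x‖ = 1) :
    ∃ t : ℤ_[p]ˣ, ((t : ℤ_[p]) : ℚ_[p]) = x := ⟨PadicInt.mkUnits h, rfl⟩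

theorem norm_unit_coe (t : ℤ_[p]ˣ) : ‖((t : ℤ_[p]) : ℚ_[p])‖ = 1 := by
  rw [PadicInt.padic_norm_e_of_padicInt, PadicInt.norm_units]

theorem unitExt_mul (k : ℤ_[p]ˣ →* Oˣ) (x y : ℚ_[p]) (hx : ‖x‖ = 1) :
    unitExt k (x * y) = unitExt k x * unitExt k y := by
  obtain ⟨t, rfl⟩ := exists_unit_of_norm_eq_one hx
  by_cases hy : ‖y‖ = 1
  · obtain ⟨s, rfl⟩ := exists_unit_of_norm_eq_one hy
    rw [← PadicInt.coe_mul, ← Units.val_mul, unitExt_unit, unitExt_unit, unitExt_unit, map_mul,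
      Units.val_mul]
  · rw [unitExt_of_norm_ne_one k hy, mul_zero, unitExt_of_norm_ne_one]
    rwa [norm_mul, hx, one_mul]

theorem intExt_mul (κ : ℤ_[p] →* O) (x y : ℚ_[p]) (hx : ‖x‖ = 1) :
    intExt κ (x * y) = intExt κ x * intExt κ y := by
  have h : ‖x * y‖ ≤ 1 ↔ ‖y‖ ≤ 1 := by rw [norm_mul, hx, one_mul]
  by_cases hy : ‖y‖ ≤ 1
  · rw [intExt, intExt, intExt, dif_pos (h.2 hy), dif_pos hx.le, dif_pos hy]
    exact map_mul κ ⟨x, hx.le⟩ ⟨y, hy⟩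
  · rw [intExt, intExt, intExt, dif_neg (mt h.1 hy), dif_neg hy, mul_zero]

/-- Unlike `intExt_mul`, neither factor has to be a unit. This version extracts κ(p), while the
other gives homogeneity on all of ℚ_p. -/
theorem intExt_mul_of_norm_le (κ : ℤ_[p] →* O) {x y : ℚ_[p]} (hx : ‖x‖ ≤ 1) (hy : ‖y‖ ≤ 1) :
    intExt κ (x * y) = intExt κ x * intExt κ y := by
  have h : ‖x * y‖ ≤ 1 := by rw [norm_mul]; exact mul_le_one₀ hx (norm_nonneg _) hy
  rw [intExt, intExt, intExt, dif_pos h, dif_pos hx, dif_pos hy]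
  exact map_mul κ ⟨x, hx⟩ ⟨y, hy⟩

variable [NormedAlgebra ℚ_[p] O]

theorem IsWeight.isHomAnalytic {k : ℤ_[p]ˣ →* Oˣ} (hk : IsWeight k) :
    IsHomAnalytic k (unitExt k) :=
  ⟨hk, fun t s => by rw [unitExt_mul k _ _ (norm_unit_coe t), unitExt_unit]⟩

theorem IsAnalyticExtension.intExt_eq {k : ℤ_[p]ˣ →* Oˣ} {κ : ℤ_[p] →* O}
    (hκ : IsAnalyticExtension k κ) {x : ℚ_[p]} (hx : ‖x‖ = 1) : intExt κ x = unitExt k x := by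
  obtain ⟨t, rfl⟩ := exists_unit_of_norm_eq_one hx
  rw [unitExt_unit, ← hκ.extends_char, intExt, dif_pos hx.le]
  rfl

theorem IsAnalyticExtension.isHomAnalytic {k : ℤ_[p]ˣ →* Oˣ} {κ : ℤ_[p] →* O}
    (hκ : IsAnalyticExtension k κ) : IsHomAnalytic k (intExt κ) :=
  ⟨hκ.analytic, fun t s => by
    rw [intExt_mul κ _ _ (norm_unit_coe t), hκ.intExt_eq (norm_unit_coe t), unitExt_unit]⟩

theorem IsHomAnalytic.sub {k : ℤ_[p]ˣ →* Oˣ} {f g : ℚ_[p] → O} (hf : IsHomAnalytic k f)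
    (hg : IsHomAnalytic k g) : IsHomAnalytic k (f - g) := by
  refine ⟨?_, fun t s => ?_⟩
  · rw [sub_eq_add_neg, ← neg_one_smul O g]
    exact hf.analytic.add (hg.analytic.smul _)
  · rw [Pi.sub_apply, Pi.sub_apply, hf.homog, hg.homog, mul_sub]

variable [CompleteSpace O]

theorem IsWeight.mul [IsUltrametricDist O] {k l : ℤ_[p]ˣ →* Oˣ} (hk : IsWeight k)
    (hl : IsWeight l) : IsWeight (k * l) := by
  obtain ⟨r, hr, C, hC⟩ := hk
  obtain ⟨s, hs, D, hD⟩ := hl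
  have h0 : 0 < min r s := lt_min hr hs
  refine ⟨min r s, h0, 1 * C * D, ?_⟩
  have h := (hC.mono h0 (min_le_left _ _)).bilin h0 (ContinuousLinearMap.mul ℚ_[p] O)
    (ContinuousLinearMap.opNorm_mul_le _ _) (hD.mono h0 (min_le_right _ _))
  convert h using 1
  funext x
  by_cases hx : ‖x‖ = 1
  · simp [unitExt_of_norm_eq_one _ hx]
  · simp [unitExt_of_norm_ne_one _ hx]

omit [NormedAlgebra ℚ_[p] O] [CompleteSpace O] in
theorem unitExt_inv (k : ℤ_[p]ˣ →* Oˣ) (x : ℚ_[p]) : unitExt k⁻¹ x = unitExt k x⁻¹ := by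
  by_cases hx : ‖x‖ = 1
  · obtain ⟨t, rfl⟩ := exists_unit_of_norm_eq_one hx
    have h : ((t : ℤ_[p]) : ℚ_[p])⁻¹ = ((t⁻¹ : ℤ_[p]ˣ) : ℤ_[p]) := by
      refine inv_eq_of_mul_eq_one_right ?_
      rw [← PadicInt.coe_mul, Units.mul_inv, PadicInt.coe_one]
    rw [h, unitExt_unit, unitExt_unit, map_inv, MonoidHom.inv_apply]
  · rw [unitExt_of_norm_ne_one _ hx, unitExt_of_norm_ne_one]
    rwa [norm_inv, Ne, inv_eq_one]

omit [CompleteSpace O] in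
-- Near 1, k⁻¹ is k composed with inversion, hence analytic. Writing s + t = s(1 + s⁻¹t) transports
-- this expansion to every unit s with the same radius ρ, since ‖s‖ = 1. As ρ ≤ 1, a ball of radius
-- ρ about a non-unit contains no units, and the extension by zero vanishes on it.
theorem IsWeight.inv {k : ℤ_[p]ˣ →* Oˣ} (hk : IsWeight k) : IsWeight k⁻¹ := by
  obtain ⟨r, hr, C, hC⟩ := hk
  have han : AnalyticAt ℚ_[p] (unitExt k) (1⁻¹ : ℚ_[p]) := by
    rw [inv_one]
    obtain ⟨q, -, hs⟩ := hC 1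
    refine ⟨q, hasFPowerSeriesAt_iff.2 ?_⟩
    filter_upwards [Metric.ball_mem_nhds (0 : ℚ_[p]) hr] with t ht
    simpa using hs t (by simpa using ht)
  obtain ⟨q, R, hq⟩ := han.comp (analyticAt_inv (one_ne_zero : (1 : ℚ_[p]) ≠ 0))
  obtain ⟨ρ, hρ0, hρ⟩ := ENNReal.lt_iff_exists_nnreal_btwn.1
    (lt_min hq.r_pos (by norm_num : (0 : ENNReal) < 1))
  have hρ0' : 0 < (ρ : ℝ) := by exact_mod_cast hρ0
  have hρ1 : (ρ : ℝ) ≤ 1 := by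
    have := (hρ.trans_le (min_le_right _ _)).le
    exact_mod_cast this
  obtain ⟨D, hD0, hD⟩ := q.norm_mul_pow_le_of_lt_radius
    ((hρ.trans_le (min_le_left _ _)).trans_le hq.r_le)
  have hqs : ∀ t : ℚ_[p], ‖t‖ < ρ → HasSum (fun n => t ^ n • q.coeff n) (unitExt k⁻¹ (1 + t)) := by
    intro t ht
    have h := hq.hasSum (y := t) (by
      rw [Metric.mem_eball, edist_zero_right]
      refine lt_trans ?_ (hρ.trans_le (min_le_left _ _))
      rw [← ofReal_norm, ENNReal.ofReal_lt_coe_iff (norm_nonneg _)]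
      exact ht)
    rw [unitExt_inv]
    simpa using h
  refine ⟨ρ, hρ0', C * D, fun s => ?_⟩
  have hC0 := hC.nonneg
  by_cases hs : ‖s‖ = 1
  · have hs0 : s ≠ 0 := fun h => by simp [h] at hs
    refine ⟨powSeries fun n => s⁻¹ ^ n • (unitExt k⁻¹ s * q.coeff n), fun n => ?_, fun t ht => ?_⟩
    · rw [powSeries, ContinuousMultilinearMap.norm_mkPiRing, norm_smul, norm_pow, norm_inv, hs,
        inv_one, one_pow, one_mul]
      have h1 : ‖unitExt k⁻¹ s‖ ≤ C := by
        rw [unitExt_inv]; exact hC.norm_apply_le hr _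
      calc _ ≤ (‖unitExt k⁻¹ s‖ * ‖q.coeff n‖) * (ρ : ℝ) ^ n := by gcongr; exact norm_mul_le _ _
        _ ≤ (C * ‖q.coeff n‖) * (ρ : ℝ) ^ n := by gcongr
        _ = C * (‖q n‖ * (ρ : ℝ) ^ n) := by rw [q.norm_apply_eq_norm_coef]; ring
        _ ≤ _ := by gcongr; exact hD n
    · have h := (hqs (s⁻¹ * t) (by rwa [norm_mul, norm_inv, hs, inv_one, one_mul])).mul_left
        (unitExt k⁻¹ s)
      rw [← unitExt_mul _ _ _ hs, mul_add, mul_one, mul_inv_cancel_left₀ hs0] at h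
      refine h.congr_fun fun n => ?_
      rw [powSeries_apply, smul_smul, mul_smul_comm, mul_pow, mul_comm (t ^ n)]
  · refine ⟨0, fun n => by simpa using mul_nonneg hC0 hD0.le, fun t ht => ?_⟩
    rw [unitExt_of_norm_ne_one]
    · simp
    · intro h
      have := norm_add_eq_one h (y := -t) (by rw [norm_neg]; exact ht.trans_le hρ1)
      rw [add_neg_cancel_right] at this
      exact hs this

theorem IsWeight.div [IsUltrametricDist O] {k l : ℤ_[p]ˣ →* Oˣ} (hk : IsWeight k)
    (hl : IsWeight l) : IsWeight (k / l) := by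
  have h : k / l = k * l⁻¹ := div_eq_mul_inv k l
  exact h ▸ hk.mul hl.inv

end Weights

/-! ### Triple integrals -/

section TripleIntegrals

variable {p : Nat.Primes} {O : Type*} [NormedCommRing O] [NormedAlgebra ℚ_[p] O]
  {k₁ k₂ k₃ : ℤ_[p]ˣ →* Oˣ} {X₁ X₂ X₃ : Region p}
  {Δ Δ' : (Fin 2 → ℚ_[p]) → (Fin 2 → ℚ_[p]) → (Fin 2 → ℚ_[p]) → O}

theorem tripleIntegral_congr (h : ∀ w₁ ∈ X₁.carrier, ∀ w₂ ∈ X₂.carrier, ∀ w₃ ∈ X₃.carrier,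
    Δ w₁ w₂ w₃ = Δ' w₁ w₂ w₃) (μ₁ : HomDist k₁ X₁) (μ₂ : HomDist k₂ X₂) (μ₃ : HomDist k₃ X₃) :
    tripleIntegral Δ μ₁ μ₂ μ₃ = tripleIntegral Δ' μ₁ μ₂ μ₃ :=
  distIntegral_congr _ fun w₁ h₁ => distIntegral_congr _ fun w₂ h₂ => distIntegral_congr _ fun w₃ h₃ =>
    h w₁ h₁ w₂ h₂ w₃ h₃

theorem TripleIntegrable.tripleIntegral_add (h : TripleIntegrable k₁ k₂ k₃ X₁ X₂ X₃ Δ)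
    (h' : TripleIntegrable k₁ k₂ k₃ X₁ X₂ X₃ Δ') (μ₁ : HomDist k₁ X₁) (μ₂ : HomDist k₂ X₂)
    (μ₃ : HomDist k₃ X₃) :
    tripleIntegral (fun w₁ w₂ w₃ => Δ w₁ w₂ w₃ + Δ' w₁ w₂ w₃) μ₁ μ₂ μ₃ =
      tripleIntegral Δ μ₁ μ₂ μ₃ + tripleIntegral Δ' μ₁ μ₂ μ₃ := by
  unfold tripleIntegral
  rw [← distIntegral_add μ₁ (h.outer μ₂ μ₃) (h'.outer μ₂ μ₃)]
  refine distIntegral_congr μ₁ fun w₁ h₁ => ?_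
  rw [← distIntegral_add μ₂ (h.middle μ₃ w₁ h₁) (h'.middle μ₃ w₁ h₁)]
  refine distIntegral_congr μ₂ fun w₂ h₂ => ?_
  exact distIntegral_add μ₃ (h.inner w₁ h₁ w₂ h₂) (h'.inner w₁ h₁ w₂ h₂)

theorem TripleIntegrable.tripleIntegral_const_mul (h : TripleIntegrable k₁ k₂ k₃ X₁ X₂ X₃ Δ)
    (c : O) (μ₁ : HomDist k₁ X₁) (μ₂ : HomDist k₂ X₂) (μ₃ : HomDist k₃ X₃) :
    tripleIntegral (fun w₁ w₂ w₃ => c * Δ w₁ w₂ w₃) μ₁ μ₂ μ₃ =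
      c * tripleIntegral Δ μ₁ μ₂ μ₃ := by
  unfold tripleIntegral
  rw [← distIntegral_const_mul μ₁ (h.outer μ₂ μ₃)]
  refine distIntegral_congr μ₁ fun w₁ h₁ => ?_
  rw [← distIntegral_const_mul μ₂ (h.middle μ₃ w₁ h₁)]
  refine distIntegral_congr μ₂ fun w₂ h₂ => ?_
  exact distIntegral_const_mul μ₃ (h.inner w₁ h₁ w₂ h₂) c

theorem tripleIntegral_zero (μ₁ : HomDist k₁ X₁) (μ₂ : HomDist k₂ X₂) (μ₃ : HomDist k₃ X₃) :
    tripleIntegral (fun _ _ _ => 0) μ₁ μ₂ μ₃ = 0 := by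
  simp only [tripleIntegral, distIntegral_zero]

theorem tripleIntegral_add_left (μ₁ ν₁ : HomDist k₁ X₁) (μ₂ : HomDist k₂ X₂) (μ₃ : HomDist k₃ X₃) :
    tripleIntegral Δ (μ₁ + ν₁) μ₂ μ₃ =
      tripleIntegral Δ μ₁ μ₂ μ₃ + tripleIntegral Δ ν₁ μ₂ μ₃ :=
  add_distIntegral _ _ _

theorem tripleIntegral_smul_left (c : O) (μ₁ : HomDist k₁ X₁) (μ₂ : HomDist k₂ X₂)
    (μ₃ : HomDist k₃ X₃) :
    tripleIntegral Δ (c • μ₁) μ₂ μ₃ = c * tripleIntegral Δ μ₁ μ₂ μ₃ :=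
  smul_distIntegral _ _ _

theorem TripleIntegrable.add_middle (h : TripleIntegrable k₁ k₂ k₃ X₁ X₂ X₃ Δ)
    (μ₁ : HomDist k₁ X₁) (μ₂ ν₂ : HomDist k₂ X₂) (μ₃ : HomDist k₃ X₃) :
    tripleIntegral Δ μ₁ (μ₂ + ν₂) μ₃ =
      tripleIntegral Δ μ₁ μ₂ μ₃ + tripleIntegral Δ μ₁ ν₂ μ₃ := by
  unfold tripleIntegral
  rw [← distIntegral_add μ₁ (h.outer μ₂ μ₃) (h.outer ν₂ μ₃)]
  exact distIntegral_congr μ₁ fun w₁ _ => add_distIntegral _ _ _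

theorem TripleIntegrable.smul_middle (h : TripleIntegrable k₁ k₂ k₃ X₁ X₂ X₃ Δ) (c : O)
    (μ₁ : HomDist k₁ X₁) (μ₂ : HomDist k₂ X₂) (μ₃ : HomDist k₃ X₃) :
    tripleIntegral Δ μ₁ (c • μ₂) μ₃ = c * tripleIntegral Δ μ₁ μ₂ μ₃ := by
  unfold tripleIntegral
  rw [← distIntegral_const_mul μ₁ (h.outer μ₂ μ₃)]
  exact distIntegral_congr μ₁ fun w₁ _ => smul_distIntegral _ _ _

theorem TripleIntegrable.add_right (h : TripleIntegrable k₁ k₂ k₃ X₁ X₂ X₃ Δ)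
    (μ₁ : HomDist k₁ X₁) (μ₂ : HomDist k₂ X₂) (μ₃ ν₃ : HomDist k₃ X₃) :
    tripleIntegral Δ μ₁ μ₂ (μ₃ + ν₃) =
      tripleIntegral Δ μ₁ μ₂ μ₃ + tripleIntegral Δ μ₁ μ₂ ν₃ := by
  unfold tripleIntegral
  rw [← distIntegral_add μ₁ (h.outer μ₂ μ₃) (h.outer μ₂ ν₃)]
  refine distIntegral_congr μ₁ fun w₁ h₁ => ?_
  rw [← distIntegral_add μ₂ (h.middle μ₃ w₁ h₁) (h.middle ν₃ w₁ h₁)]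
  exact distIntegral_congr μ₂ fun w₂ _ => add_distIntegral _ _ _

theorem TripleIntegrable.smul_right (h : TripleIntegrable k₁ k₂ k₃ X₁ X₂ X₃ Δ) (c : O)
    (μ₁ : HomDist k₁ X₁) (μ₂ : HomDist k₂ X₂) (μ₃ : HomDist k₃ X₃) :
    tripleIntegral Δ μ₁ μ₂ (c • μ₃) = c * tripleIntegral Δ μ₁ μ₂ μ₃ := by
  unfold tripleIntegral
  rw [← distIntegral_const_mul μ₁ (h.outer μ₂ μ₃)]
  refine distIntegral_congr μ₁ fun w₁ h₁ => ?_
  rw [← distIntegral_const_mul μ₂ (h.middle μ₃ w₁ h₁)]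
  exact distIntegral_congr μ₂ fun w₂ _ => smul_distIntegral _ _ _

/-- The triple integral as a trilinear map in the distributions. -/
def TripleIntegrable.linear (h : TripleIntegrable k₁ k₂ k₃ X₁ X₂ X₃ Δ) :
    HomDist k₁ X₁ →ₗ[O] HomDist k₂ X₂ →ₗ[O] HomDist k₃ X₃ →ₗ[O] O where
  toFun μ₁ := LinearMap.mk₂ O (tripleIntegral Δ μ₁) (h.add_middle μ₁)
    (fun c => h.smul_middle c μ₁) (h.add_right μ₁) (fun c μ₂ μ₃ => h.smul_right c μ₁ μ₂ μ₃)
  map_add' μ₁ ν₁ := by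
    ext μ₂ μ₃
    exact tripleIntegral_add_left μ₁ ν₁ μ₂ μ₃
  map_smul' c μ₁ := by
    ext μ₂ μ₃
    exact tripleIntegral_smul_left c μ₁ μ₂ μ₃

theorem TripleIntegrable.linear_apply (h : TripleIntegrable k₁ k₂ k₃ X₁ X₂ X₃ Δ)
    (μ₁ : HomDist k₁ X₁) (μ₂ : HomDist k₂ X₂) (μ₃ : HomDist k₃ X₃) :
    h.linear μ₁ μ₂ μ₃ = tripleIntegral Δ μ₁ μ₂ μ₃ := rfl

/-- Two independent matrices are allowed because the off-diagonal terms of the product of two Hecke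
sums involve different representatives. -/
theorem TripleIntegrable.distAct₁₂ (h : TripleIntegrable k₁ k₂ k₃ X₁ X₂ X₃ Δ)
    {σ τ : Matrix (Fin 2) (Fin 2) ℚ_[p]} (hσ : X₁.StableUnder σ) (hτ : X₂.StableUnder τ)
    (μ₁ : HomDist k₁ X₁) (μ₂ : HomDist k₂ X₂) (μ₃ : HomDist k₃ X₃) :
    tripleIntegral Δ (distAct σ μ₁) (distAct τ μ₂) μ₃ =
      tripleIntegral (fun w₁ w₂ w₃ => Δ (Matrix.vecMul w₁ σ) (Matrix.vecMul w₂ τ) w₃) μ₁ μ₂ μ₃ := by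
  unfold tripleIntegral
  rw [distIntegral_distAct hσ μ₁ (h.outer _ _)]
  refine distIntegral_congr μ₁ fun w₁ h₁ => ?_
  exact distIntegral_distAct hτ μ₂ (h.middle μ₃ _ (hσ w₁ h₁))

theorem TripleIntegrable.distAct₁₂₃ (h : TripleIntegrable k₁ k₂ k₃ X₁ X₂ X₃ Δ)
    {σ : Matrix (Fin 2) (Fin 2) ℚ_[p]} (h₁ : X₁.StableUnder σ) (h₂ : X₂.StableUnder σ)
    (h₃ : X₃.StableUnder σ) (μ₁ : HomDist k₁ X₁) (μ₂ : HomDist k₂ X₂) (μ₃ : HomDist k₃ X₃) :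
    tripleIntegral Δ (distAct σ μ₁) (distAct σ μ₂) (distAct σ μ₃) =
      tripleIntegral (fun w₁ w₂ w₃ => Δ (Matrix.vecMul w₁ σ) (Matrix.vecMul w₂ σ)
        (Matrix.vecMul w₃ σ)) μ₁ μ₂ μ₃ := by
  rw [h.distAct₁₂ h₁ h₂]
  exact distIntegral_congr μ₁ fun w₁ hw₁ => distIntegral_congr μ₂ fun w₂ hw₂ =>
    distIntegral_distAct h₃ μ₃ (h.inner _ (h₁ w₁ hw₁) _ (h₂ w₂ hw₂))

/-! ### Transformation of the determinant pairing -/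

theorem delta_vecMul (σ : Matrix (Fin 2) (Fin 2) ℚ_[p]) (v w : Fin 2 → ℚ_[p]) :
    delta (Matrix.vecMul v σ) (Matrix.vecMul w σ) = σ.det * delta v w := by
  simp only [delta, Matrix.vecMul, dotProduct, Fin.sum_univ_two, Matrix.det_fin_two]
  ring

/-- The adjoint of a matrix for the alternating form δ is its adjugate. This moves a representative
of U_p from the first two variables to the third, where it acts as one of U_p^ι. -/
theorem delta_vecMul_adjugate (σ : Matrix (Fin 2) (Fin 2) ℚ_[p]) (v w : Fin 2 → ℚ_[p]) :
    delta (Matrix.vecMul v σ) w = delta v (Matrix.vecMul w σ.adjugate) := by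
  simp only [delta, Matrix.vecMul, dotProduct, Fin.sum_univ_two, Matrix.adjugate_fin_two,
    Matrix.of_apply, Matrix.cons_val', Matrix.cons_val_zero, Matrix.cons_val_one]
  ring

theorem IsGamma0.regionW_stable {m : Matrix (Fin 2) (Fin 2) ℚ_[p]} (hm : IsGamma0 m)
    (h00 : ‖m 0 0‖ = 1) : (regionW p).StableUnder m := by
  rintro w ⟨h0, h1⟩
  refine ⟨?_, ?_⟩
  · simp only [Matrix.vecMul, dotProduct, Fin.sum_univ_two]
    refine norm_add_eq_one (by rw [norm_mul, h0, h00, one_mul]) ?_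
    rw [norm_mul]
    exact mul_lt_one_of_nonneg_of_lt_one_right h1 (norm_nonneg _) hm.2.2
  · simp only [Matrix.vecMul, dotProduct, Fin.sum_univ_two]
    refine (Padic.nonarchimedean _ _).trans (max_le ?_ ?_) <;> rw [norm_mul]
    · exact mul_le_one₀ h0.le (norm_nonneg _) (hm.1 0 1)
    · exact mul_le_one₀ h1 (norm_nonneg _) (hm.1 1 1)

end TripleIntegrals

/-! ### Weighted sums over orbits -/

theorem finsum_eq_of_support_subset_range {α β M : Type*} [AddCommMonoid M] {f : α → β}
    (hf : Function.Injective f) {g : β → M} (hg : g.support ⊆ Set.range f) :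
    ∑ᶠ b, g b = ∑ᶠ a, g (f a) := by
  rw [← finsum_mem_univ, ← finsum_mem_inter_support, Set.univ_inter,
    ← Set.inter_eq_self_of_subset_right hg, finsum_mem_inter_support, finsum_mem_range hf]

section Unfolding

variable {Γ Q D R M : Type*} [Group Γ] [MulAction Γ Q] [Field R] [AddCommGroup M] [Module R M]

/-- Here χ is a weighted fundamental domain. Inserting 1 = ∑_γ χ(γx) turns the left side into the
sum of χ(y) χ(γx) P(x, y) over triples (y, x, γ), which is symmetric by invariance of P. The
finiteness hypotheses make the support on triples finite, as Fubini for `finsum` requires. -/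
theorem finsum_unfold (χ : Q → R) (hχ : ∀ x, ∑ᶠ γ : Γ, χ (γ • x) = 1)
    (hfin : ∀ x, {γ : Γ | χ (γ • x) ≠ 0}.Finite) (hsupp : χ.support.Finite) (P : Q → Q → M)
    (hP : ∀ (γ : Γ) x y, P (γ • x) (γ • y) = P x y) (h₁ : ∀ y, {x | P x y ≠ 0}.Finite) :
    ∑ᶠ y, χ y • ∑ᶠ x, P x y = ∑ᶠ x, χ x • ∑ᶠ y, P x y := by
  classical
  set H : Q × Q × Γ → M := fun z => (χ z.1 * χ (z.2.2 • z.2.1)) • P z.2.1 z.1 with hH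
  set H' : Q × Q × Γ → M := fun z => (χ z.1 * χ (z.2.2 • z.2.1)) • P z.1 z.2.1 with hH'
  have hHs : H.support.Finite := by
    refine Set.Finite.subset (s := ⋃ y ∈ χ.support, ⋃ x ∈ {x | P x y ≠ 0},
      (fun γ => (y, x, γ)) '' {γ : Γ | χ (γ • x) ≠ 0}) ?_ ?_
    · exact hsupp.biUnion fun y _ => (h₁ y).biUnion fun x _ => (hfin x).image _
    · rintro ⟨y, x, γ⟩ hz
      simp only [hH, Function.mem_support, ne_eq, smul_eq_zero, mul_eq_zero, not_or] at hz
      simp only [Set.mem_iUnion]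
      exact ⟨y, hz.1.1, x, hz.2, γ, hz.1.2, rfl⟩
  -- The involution (y, x, γ) ↦ (γx, γy, γ⁻¹) exchanges the two weights and, by invariance, the two
  -- arguments of `P`.
  let e : Q × Q × Γ ≃ Q × Q × Γ :=
    { toFun := fun z => (z.2.2 • z.2.1, z.2.2 • z.1, z.2.2⁻¹)
      invFun := fun z => (z.2.2 • z.2.1, z.2.2 • z.1, z.2.2⁻¹)
      left_inv := fun z => by simp
      right_inv := fun z => by simp }
  have heq : ∀ z, H' (e z) = H z := fun z => by
    simp only [hH, hH', e, Equiv.coe_fn_mk, inv_smul_smul, hP, mul_comm]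
  have hHs' : H'.support.Finite := by
    have : H'.support = e '' H.support := by
      ext z
      rw [Set.mem_image_equiv, Function.mem_support, Function.mem_support, ← heq,
        Equiv.apply_symm_apply]
    rw [this]
    exact hHs.image _
  -- Summing over γ first removes the inserted partition of unity.
  have key : ∀ (T : Q → Q → M), (Function.support fun z : Q × Q × Γ =>
      (χ z.1 * χ (z.2.2 • z.2.1)) • T z.1 z.2.1).Finite →
      ∑ᶠ z : Q × Q × Γ, (χ z.1 * χ (z.2.2 • z.2.1)) • T z.1 z.2.1 = ∑ᶠ y, χ y • ∑ᶠ x, T y x := by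
    intro T hT
    rw [finsum_curry _ hT]
    refine finsum_congr fun y => ?_
    have hT' : (Function.support fun z : Q × Γ => (χ y * χ (z.2 • z.1)) • T y z.1).Finite :=
      (hT.preimage (f := fun z : Q × Γ => (y, z)) (Prod.mk_right_injective y).injOn)
    rw [finsum_curry _ hT']
    have hinner : ∀ x, ∑ᶠ γ : Γ, (χ y * χ (γ • x)) • T y x = χ y • T y x := fun x => by
      have h1 : (Function.support fun γ : Γ => χ (γ • x)).Finite := hfin x
      simp only [mul_smul]
      rw [← smul_finsum, ← finsum_smul, hχ, one_smul]
    simp only [hinner]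
    rw [smul_finsum]
  have h1 := key (fun y x => P x y) hHs
  have h2 := key P hHs'
  rw [← h1, ← h2]
  exact finsum_eq_of_bijective e e.bijective fun z => (heq z).symm

open Classical in
/-- The weight function supported on the chosen representatives of the orbits. -/
def orbitWeight (R : Type*) [Field R] (Γ : Type*) {Q D : Type*} [Group Γ] [MulAction Γ Q]
    (π : Q → D) (s : D → Q) (q : Q) : R :=
  if s (π q) = q then (Nat.card (MulAction.stabilizer Γ q) : R)⁻¹ else 0

variable {π : Q → D} {s : D → Q} (hs : ∀ c, π (s c) = c)
  (hπ : ∀ x y : Q, π x = π y ↔ ∃ γ : Γ, γ • x = y)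

include hs hπ in
-- The elements carrying x to the chosen representative of its orbit form one coset of the
-- stabilizer of that representative.
theorem orbitWeight_smul_ne_zero (x : Q) :
    ∃ γ₀ : Γ, ∀ γ : Γ, s (π (γ • x)) = γ • x ↔ γ * γ₀⁻¹ ∈ MulAction.stabilizer Γ (s (π x)) := by
  obtain ⟨γ₀, hγ₀⟩ := (hπ x (s (π x))).1 (hs _).symm
  refine ⟨γ₀, fun γ => ?_⟩
  have h1 : π (γ • x) = π x := ((hπ x (γ • x)).2 ⟨γ, rfl⟩).symm
  have h2 : γ₀⁻¹ • s (π x) = x := by rw [← hγ₀, inv_smul_smul]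
  rw [h1, MulAction.mem_stabilizer_iff, mul_smul, h2, eq_comm]

include hs hπ in
-- Exactly |Stab| elements γ contribute, each with weight 1/|Stab|. Characteristic zero makes this
-- cardinality invertible.
theorem finsum_orbitWeight [CharZero R] (hst : ∀ q : Q, Finite (MulAction.stabilizer Γ q)) (x : Q) :
    (∑ᶠ γ : Γ, orbitWeight R Γ π s (γ • x) = 1) ∧
      {γ : Γ | orbitWeight R Γ π s (γ • x) ≠ 0}.Finite := by
  obtain ⟨γ₀, hγ₀⟩ := orbitWeight_smul_ne_zero (Γ := Γ) hs hπ x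
  set q := s (π x) with hq
  have hfin := hst q
  have hval : ∀ γ : MulAction.stabilizer Γ q, orbitWeight R Γ π s (((γ : Γ) * γ₀) • x) =
      (Nat.card (MulAction.stabilizer Γ q) : R)⁻¹ := fun γ => by
    have h := (hγ₀ (γ * γ₀)).2 (by rw [mul_inv_cancel_right]; exact γ.2)
    have h1 : π (((γ : Γ) * γ₀) • x) = π x := ((hπ x _).2 ⟨_, rfl⟩).symm
    rw [orbitWeight, if_pos h, ← h, h1]
  set f : MulAction.stabilizer Γ q → Γ := fun γ => (γ : Γ) * γ₀ with hf
  have hinj : Function.Injective f := fun a b h => Subtype.ext (mul_right_cancel h)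
  have hsub : (Function.support fun γ : Γ => orbitWeight R Γ π s (γ • x)) ⊆ Set.range f := by
    intro γ hγ
    by_cases h : s (π (γ • x)) = γ • x
    · exact ⟨⟨_, (hγ₀ γ).1 h⟩, by simp [hf]⟩
    · exact absurd (if_neg h) hγ
  refine ⟨?_, (Set.finite_range f).subset hsub⟩
  rw [finsum_eq_of_support_subset_range hinj hsub]
  simp only [hf, hval]
  have := Fintype.ofFinite (MulAction.stabilizer Γ q)
  rw [finsum_eq_sum_of_fintype, Finset.sum_const, Finset.card_univ, nsmul_eq_mul,
    Nat.card_eq_fintype_card]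
  exact mul_inv_cancel₀ (Nat.cast_ne_zero.2 Fintype.card_ne_zero)

include hs in
theorem finsum_orbitWeight_smul (f : Q → M) :
    ∑ᶠ q, orbitWeight R Γ π s q • f q =
      ∑ᶠ c, (Nat.card (MulAction.stabilizer Γ (s c)) : R)⁻¹ • f (s c) := by
  have hinj : Function.Injective s := fun a b h => by rw [← hs a, h, hs b]
  have hsub : (Function.support fun q => orbitWeight R Γ π s q • f q) ⊆ Set.range s := by
    intro q hq
    by_cases h : s (π q) = q
    · exact ⟨_, h⟩
    · exact absurd (by simp only [orbitWeight, if_neg h, zero_smul]) hq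
  rw [finsum_eq_of_support_subset_range hinj hsub]
  refine finsum_congr fun c => ?_
  rw [orbitWeight, if_pos (by rw [hs])]

include hs hπ in
/-- A correspondence `P` on a set with group action may be summed over the orbits of either
factor. -/
theorem finsum_orbits_comm [CharZero R] [Finite D]
    (hst : ∀ q : Q, Finite (MulAction.stabilizer Γ q)) (P : Q → Q → M)
    (hP : ∀ (γ : Γ) x y, P (γ • x) (γ • y) = P x y) (h₁ : ∀ y, {x | P x y ≠ 0}.Finite) :
    ∑ᶠ c, (Nat.card (MulAction.stabilizer Γ (s c)) : R)⁻¹ • ∑ᶠ x, P x (s c) =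
      ∑ᶠ c, (Nat.card (MulAction.stabilizer Γ (s c)) : R)⁻¹ • ∑ᶠ y, P (s c) y := by
  rw [← finsum_orbitWeight_smul hs (fun y => ∑ᶠ x, P x y),
    ← finsum_orbitWeight_smul hs (fun x => ∑ᶠ y, P x y)]
  refine finsum_unfold _ (fun x => (finsum_orbitWeight hs hπ hst x).1)
    (fun x => (finsum_orbitWeight hs hπ hst x).2) ?_ P hP h₁
  refine (Set.finite_range s).subset fun q hq => ?_
  by_cases h : s (π q) = q
  · exact ⟨_, h⟩
  · exact absurd (if_neg h) hq

end Unfolding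

/-! ### Cosets and double cosets -/

section Cosets

variable {G Γ : Type*} [Group G] [Group Γ] (K : Subgroup G) (ι : Γ →* G)

/-- The set `K \ G`. -/
abbrev RightCosets : Type _ := Quotient (QuotientGroup.rightRel K)

theorem rightCosets_mk_eq_iff {x y : G} :
    (Quotient.mk _ x : RightCosets K) = Quotient.mk _ y ↔ y * x⁻¹ ∈ K := by
  rw [Quotient.eq]
  exact QuotientGroup.rightRel_apply

/-- Right translation on `K \ G`. -/
def rightTranslate (g : G) (q : RightCosets K) : RightCosets K :=
  Quotient.map (fun x => x * g) (fun x y h => by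
    have h' := QuotientGroup.rightRel_apply.1 h
    refine QuotientGroup.rightRel_apply.2 ?_
    rwa [mul_inv_rev, ← mul_assoc, mul_inv_cancel_right]) q

theorem rightTranslate_mk (g x : G) :
    rightTranslate K g (Quotient.mk _ x) = Quotient.mk _ (x * g) := rfl

theorem rightTranslate_bijective (g : G) : Function.Bijective (rightTranslate K g) := by
  refine Function.bijective_iff_has_inverse.2 ⟨rightTranslate K g⁻¹, fun q => ?_, fun q => ?_⟩ <;>
  · induction q using Quotient.inductionOn
    simp [rightTranslate_mk]

/-- The action of `Γ` on `K \ G` through `ι` by `γ • Kx = K x ι(γ)⁻¹`. -/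
@[reducible] def cosetAction : MulAction Γ (RightCosets K) where
  smul γ := rightTranslate K (ι γ)⁻¹
  one_smul q := by
    induction q using Quotient.inductionOn
    change Quotient.mk _ _ = _
    simp
  mul_smul a b q := by
    induction q using Quotient.inductionOn
    change Quotient.mk _ _ = Quotient.mk _ _
    simp [mul_assoc]

/-- The projection `K \ G → K \ G / Γ`. -/
def toDoubleCoset : RightCosets K → DoubleCoset.Quotient (K : Set G) (ι.range : Set G) :=
  Quotient.lift (fun x => DoubleCoset.mk K ι.range x) fun x y h => by
    rw [DoubleCoset.eq]
    exact ⟨y * x⁻¹, QuotientGroup.rightRel_apply.1 h, 1, one_mem _, by simp⟩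

theorem toDoubleCoset_out (c : DoubleCoset.Quotient (K : Set G) (ι.range : Set G)) :
    toDoubleCoset K ι (Quotient.mk _ (Quotient.out c)) = c :=
  Quotient.out_eq c

open Classical in
/-- The sum over `K \ G / Γ` of the sums of a function of two variables over the Hecke
correspondence attached to a bi-`K`-invariant set `S`. -/
theorem hecke_adjoint {R M : Type*} [Field R] [CharZero R] [AddCommGroup M] [Module R M]
    [Finite (DoubleCoset.Quotient (K : Set G) (ι.range : Set G))]
    (hst : ∀ x : G, {γ : Γ | x * ι γ * x⁻¹ ∈ K}.Finite) (S : Set G)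
    (hS : ∀ u ∈ K, ∀ v ∈ K, ∀ x, u * x * v ∈ S ↔ x ∈ S)
    (hSfin : {q : RightCosets K | q.out ∈ S}.Finite) (E : G → G → M)
    (hE : ∀ u ∈ K, ∀ v ∈ K, ∀ x y, y * x⁻¹ ∈ S → E (u * y) (v * x) = E y x)
    (hEΓ : ∀ (γ : Γ) x y, y * x⁻¹ ∈ S → E (y * ι γ) (x * ι γ) = E y x) :
    ∑ᶠ c : DoubleCoset.Quotient (K : Set G) (ι.range : Set G),
        (Nat.card {γ : Γ | Quotient.out c * ι γ * (Quotient.out c)⁻¹ ∈ K} : R)⁻¹ •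
          ∑ᶠ (q : RightCosets K) (_ : q.out ∈ S), E (q.out * Quotient.out c) (Quotient.out c) =
      ∑ᶠ c : DoubleCoset.Quotient (K : Set G) (ι.range : Set G),
        (Nat.card {γ : Γ | Quotient.out c * ι γ * (Quotient.out c)⁻¹ ∈ K} : R)⁻¹ •
          ∑ᶠ (q : RightCosets K) (_ : q.out⁻¹ ∈ S), E (Quotient.out c) (q.out * Quotient.out c) := by
  let _ := cosetAction K ι
  have hsmul : ∀ (γ : Γ) (x : G), γ • (Quotient.mk _ x : RightCosets K) =
    Quotient.mk _ (x * (ι γ)⁻¹) := fun _ _ => rfl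
  have hSdiv : ∀ u ∈ K, ∀ v ∈ K, ∀ x y, (u * y) * (v * x)⁻¹ ∈ S ↔ y * x⁻¹ ∈ S :=
    fun u hu v hv x y => by
      rw [← hS u hu v⁻¹ (inv_mem hv) (y * x⁻¹)]
      simp [mul_assoc]
  -- `E` is invariant only on pairs with y x⁻¹ ∈ S; cut off by zero elsewhere, it descends to pairs
  -- of cosets because `S` is bi-`K`-invariant.
  let P : RightCosets K → RightCosets K → M := Quotient.lift₂
    (fun y x => if y * x⁻¹ ∈ S then E y x else 0) fun y x y' x' hy hx => by
      have hy' := QuotientGroup.rightRel_apply.1 hy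
      have hx' := QuotientGroup.rightRel_apply.1 hx
      have h1 : y' = (y' * y⁻¹) * y := by simp
      have h2 : x' = (x' * x⁻¹) * x := by simp
      have h3 : y' * x'⁻¹ ∈ S ↔ y * x⁻¹ ∈ S := by
        conv_lhs => rw [h1, h2]
        exact hSdiv _ hy' _ hx' x y
      simp only [h3]
      split_ifs with h
      · rw [h1, h2, hE _ hy' _ hx' x y h]
      · rfl
  have hPmk : ∀ y x, P (Quotient.mk _ y) (Quotient.mk _ x) = if y * x⁻¹ ∈ S then E y x else 0 :=
    fun _ _ => rfl
  have hstab : ∀ x : G, (MulAction.stabilizer Γ (Quotient.mk _ x : RightCosets K) : Set Γ) =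
      {γ : Γ | x * ι γ * x⁻¹ ∈ K} := fun x => by
    ext γ
    rw [SetLike.mem_coe, MulAction.mem_stabilizer_iff, hsmul, rightCosets_mk_eq_iff]
    simp [mul_assoc]
  -- Right translation by x permutes K \ G and turns the condition y x⁻¹ ∈ S into a condition on the
  -- coset alone.
  have hleft : ∀ x : G, ∑ᶠ q, P q (Quotient.mk _ x) =
      ∑ᶠ (q : RightCosets K) (_ : q.out ∈ S), E (q.out * x) x := fun x => by
    refine (finsum_eq_of_bijective (rightTranslate K x) (rightTranslate_bijective K x)
      fun q => ?_).symm
    conv_rhs => rw [← Quotient.out_eq q, rightTranslate_mk]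
    rw [hPmk, mul_inv_cancel_right, finsum_eq_if]
  have hright : ∀ x : G, ∑ᶠ q, P (Quotient.mk _ x) q =
      ∑ᶠ (q : RightCosets K) (_ : q.out⁻¹ ∈ S), E x (q.out * x) := fun x => by
    refine (finsum_eq_of_bijective (rightTranslate K x) (rightTranslate_bijective K x)
      fun q => ?_).symm
    conv_rhs => rw [← Quotient.out_eq q, rightTranslate_mk]
    rw [hPmk, mul_inv_rev, mul_inv_cancel_left, finsum_eq_if]
  have h := finsum_orbits_comm (R := R) (Γ := Γ) (π := toDoubleCoset K ι)
    (s := fun c => (Quotient.mk _ (Quotient.out c) : RightCosets K)) (toDoubleCoset_out K ι)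
    (fun x y => ?_) (fun q => ?_) P (fun γ x y => ?_) (fun y => ?_)
  · simp only [hleft, hright] at h
    have hcard : ∀ x : G, Nat.card (MulAction.stabilizer Γ (Quotient.mk _ x : RightCosets K)) =
        Nat.card {γ : Γ | x * ι γ * x⁻¹ ∈ K} := fun x => by
      rw [← hstab x]
      rfl
    simpa only [hcard] using h
  · induction x using Quotient.inductionOn with | h x => ?_
    induction y using Quotient.inductionOn with | h y => ?_
    change DoubleCoset.mk K ι.range x = DoubleCoset.mk K ι.range y ↔ _
    rw [DoubleCoset.eq]
    constructor
    · rintro ⟨u, hu, -, ⟨γ, rfl⟩, rfl⟩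
      refine ⟨γ⁻¹, ?_⟩
      rw [hsmul, rightCosets_mk_eq_iff]
      simpa [mul_assoc] using hu
    · rintro ⟨γ, hγ⟩
      rw [hsmul, rightCosets_mk_eq_iff] at hγ
      exact ⟨_, hγ, ι γ⁻¹, ⟨_, rfl⟩, by simp [mul_assoc]⟩
  · induction q using Quotient.inductionOn with | h x => ?_
    have := (hst x).to_subtype
    rw [← hstab x] at this
    exact this
  · induction x using Quotient.inductionOn with | h x => ?_
    induction y using Quotient.inductionOn with | h y => ?_
    rw [hsmul, hsmul, hPmk, hPmk]
    have h1 : x * (ι γ)⁻¹ * (y * (ι γ)⁻¹)⁻¹ = x * y⁻¹ := by simp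
    rw [h1]
    split_ifs with h
    · rw [← map_inv, hEΓ _ _ _ h]
    · rfl
  · induction y using Quotient.inductionOn with | h y => ?_
    refine (hSfin.image (rightTranslate K y)).subset fun q hq => ?_
    obtain ⟨q, rfl⟩ := (rightTranslate_bijective K y).2 q
    refine ⟨q, ?_, rfl⟩
    by_contra hq'
    refine hq ?_
    rw [← Quotient.out_eq q, rightTranslate_mk, hPmk, mul_inv_cancel_right]
    exact if_neg hq'

end Cosets

/-! ### Topology of the adelic group -/

section Topology

variable {a b : ℤ} {q : Nat.Primes}

theorem isEmbedding_equivProd (a b : ℤ) (q : Nat.Primes) :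
    Topology.IsEmbedding (QuaternionAlgebra.equivProd (a : ℚ_[q]) 0 (b : ℚ_[q])) :=
  ⟨⟨rfl⟩, (QuaternionAlgebra.equivProd _ _ _).injective⟩

theorem isHomeomorph_equivProd (a b : ℤ) (q : Nat.Primes) :
    IsHomeomorph (QuaternionAlgebra.equivProd (a : ℚ_[q]) 0 (b : ℚ_[q])) :=
  isHomeomorph_iff_isEmbedding_surjective.2
    ⟨isEmbedding_equivProd a b q, (QuaternionAlgebra.equivProd _ _ _).surjective⟩

theorem continuous_quat_re : Continuous fun x : Quat a b ℚ_[q] => x.re :=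
  continuous_fst.comp (isEmbedding_equivProd a b q).continuous

theorem continuous_quat_imI : Continuous fun x : Quat a b ℚ_[q] => x.imI :=
  (continuous_fst.comp continuous_snd).comp (isEmbedding_equivProd a b q).continuous

theorem continuous_quat_imJ : Continuous fun x : Quat a b ℚ_[q] => x.imJ :=
  (continuous_fst.comp (continuous_snd.comp continuous_snd)).comp
    (isEmbedding_equivProd a b q).continuous

theorem continuous_quat_imK : Continuous fun x : Quat a b ℚ_[q] => x.imK :=
  (continuous_snd.comp (continuous_snd.comp continuous_snd)).comp
    (isEmbedding_equivProd a b q).continuous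

theorem continuous_quat_mk {X : Type*} [TopologicalSpace X] {f : X → Quat a b ℚ_[q]}
    (h1 : Continuous fun x => (f x).re) (h2 : Continuous fun x => (f x).imI)
    (h3 : Continuous fun x => (f x).imJ) (h4 : Continuous fun x => (f x).imK) : Continuous f :=
  (isEmbedding_equivProd a b q).continuous_iff.2 (h1.prodMk (h2.prodMk (h3.prodMk h4)))

instance quat_t2Space : T2Space (Quat a b ℚ_[q]) := (isEmbedding_equivProd a b q).t2Space

instance quat_continuousMul : ContinuousMul (Quat a b ℚ_[q]) where
  continuous_mul := by
    have r1 := (continuous_quat_re (a := a) (b := b) (q := q)).comp continuous_fst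
      (f := fun z : Quat a b ℚ_[q] × Quat a b ℚ_[q] => z.1)
    have i1 := (continuous_quat_imI (a := a) (b := b) (q := q)).comp continuous_fst
      (f := fun z : Quat a b ℚ_[q] × Quat a b ℚ_[q] => z.1)
    have j1 := (continuous_quat_imJ (a := a) (b := b) (q := q)).comp continuous_fst
      (f := fun z : Quat a b ℚ_[q] × Quat a b ℚ_[q] => z.1)
    have k1 := (continuous_quat_imK (a := a) (b := b) (q := q)).comp continuous_fst
      (f := fun z : Quat a b ℚ_[q] × Quat a b ℚ_[q] => z.1)
    have r2 := (continuous_quat_re (a := a) (b := b) (q := q)).comp continuous_snd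
      (f := fun z : Quat a b ℚ_[q] × Quat a b ℚ_[q] => z.2)
    have i2 := (continuous_quat_imI (a := a) (b := b) (q := q)).comp continuous_snd
      (f := fun z : Quat a b ℚ_[q] × Quat a b ℚ_[q] => z.2)
    have j2 := (continuous_quat_imJ (a := a) (b := b) (q := q)).comp continuous_snd
      (f := fun z : Quat a b ℚ_[q] × Quat a b ℚ_[q] => z.2)
    have k2 := (continuous_quat_imK (a := a) (b := b) (q := q)).comp continuous_snd
      (f := fun z : Quat a b ℚ_[q] × Quat a b ℚ_[q] => z.2)
    simp only [Function.comp_def] at r1 i1 j1 k1 r2 i2 j2 k2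
    refine continuous_quat_mk ?_ ?_ ?_ ?_ <;>
      simp only [QuaternionAlgebra.re_mul, QuaternionAlgebra.imI_mul, QuaternionAlgebra.imJ_mul,
        QuaternionAlgebra.imK_mul] <;>
      fun_prop

theorem continuous_nrd : Continuous (nrd a b ℚ_[q]) := by
  have h1 := continuous_quat_re (a := a) (b := b) (q := q)
  have h2 := continuous_quat_imI (a := a) (b := b) (q := q)
  have h3 := continuous_quat_imJ (a := a) (b := b) (q := q)
  have h4 := continuous_quat_imK (a := a) (b := b) (q := q)
  change Continuous fun x : Quat a b ℚ_[q] =>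
    x.re ^ 2 - a * x.imI ^ 2 - b * x.imJ ^ 2 + a * b * x.imK ^ 2
  fun_prop

/-- The integral quaternions scaled so that coordinates have norm at most `r`. -/
def quatBall (a b : ℤ) (q : Nat.Primes) (r : ℝ) : Set (Quat a b ℚ_[q]) :=
  {x | ‖x.re‖ ≤ r ∧ ‖x.imI‖ ≤ r ∧ ‖x.imJ‖ ≤ r ∧ ‖x.imK‖ ≤ r}

theorem quatBall_eq (r : ℝ) : quatBall a b q r =
    QuaternionAlgebra.equivProd (a : ℚ_[q]) 0 (b : ℚ_[q]) ⁻¹'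
      (Metric.closedBall 0 r ×ˢ Metric.closedBall 0 r ×ˢ Metric.closedBall 0 r ×ˢ
        Metric.closedBall 0 r) := by
  ext x
  simp [quatBall]

theorem coe_stdOrder : (stdOrder a b q : Set (Quat a b ℚ_[q])) = quatBall a b q 1 := rfl

theorem isCompact_quatBall (r : ℝ) : IsCompact (quatBall a b q r) := by
  rw [quatBall_eq]
  refine (isHomeomorph_equivProd a b q).isClosedEmbedding.isCompact_preimage ?_
  have h := isCompact_closedBall (0 : ℚ_[q]) r
  exact h.prod (h.prod (h.prod h))

theorem isOpen_stdOrder : IsOpen (stdOrder a b q : Set (Quat a b ℚ_[q])) := by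
  rw [coe_stdOrder, quatBall_eq]
  refine IsOpen.preimage (isEmbedding_equivProd a b q).continuous ?_
  have h := IsUltrametricDist.isOpen_closedBall (0 : ℚ_[q]) one_ne_zero
  exact h.prod (h.prod (h.prod h))

theorem isOpen_ordUnits : IsOpen (ordUnits a b q : Set (Quat a b ℚ_[q])ˣ) :=
  Submonoid.isOpen_units isOpen_stdOrder

instance fact_isOpen_ordUnits : Fact (∀ q : Nat.Primes, IsOpen (ordUnits a b q : Set (Quat a b ℚ_[q])ˣ)) :=
  ⟨fun _ => isOpen_ordUnits⟩

/-- The elements of `B_f^×` that are integral at all primes, with inverse integral up to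
bounded denominators. -/
def boundedInverse (a b : ℤ) (M : ℤ) : Set (Bf a b) :=
  {y | ∀ q, ((y q : (Quat a b ℚ_[q])ˣ) : Quat a b ℚ_[q]) ∈ stdOrder a b q ∧
    (M : ℚ_[q]) • (((y q)⁻¹ : (Quat a b ℚ_[q])ˣ) : Quat a b ℚ_[q]) ∈ stdOrder a b q}

theorem isCompact_units_quatBall (r s : ℝ) : IsCompact {u : (Quat a b ℚ_[q])ˣ |
    (u : Quat a b ℚ_[q]) ∈ quatBall a b q r ∧
      ((u⁻¹ : (Quat a b ℚ_[q])ˣ) : Quat a b ℚ_[q]) ∈ quatBall a b q s} := by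
  have h := ((isCompact_quatBall (a := a) (b := b) (q := q) r).prod
    ((isCompact_quatBall (a := a) (b := b) (q := q) s).image
      MulOpposite.continuous_op))
  convert Units.isClosedEmbedding_embedProduct.isCompact_preimage h using 1
  ext u
  simp

theorem smul_mem_stdOrder_iff {c : ℚ_[q]} (hc : c ≠ 0) (x : Quat a b ℚ_[q]) :
    c • x ∈ stdOrder a b q ↔ x ∈ quatBall a b q ‖c‖⁻¹ := by
  have hc' := norm_pos_iff.2 hc
  rw [← SetLike.mem_coe, coe_stdOrder]
  simp only [quatBall, Set.mem_ofPred_eq, QuaternionAlgebra.re_smul, QuaternionAlgebra.imI_smul,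
    QuaternionAlgebra.imJ_smul, QuaternionAlgebra.imK_smul, smul_eq_mul, norm_mul,
    inv_eq_one_div, le_div_iff₀' hc']

/-- At the primes where M is a unit, these elements lie in the unit group of the order, so the set
lies in the restricted product relative to one fixed cofinite set `S`. That space has the topology
induced from the full product, where Tychonoff applies, and it maps continuously to `Bf a b`. -/
theorem isCompact_boundedInverse {M : ℤ} (hM : M ≠ 0) : IsCompact (boundedInverse a b M) := by
  set S : Set Nat.Primes := {q | ‖(M : ℚ_[q])‖ = 1} with hS
  have hfin : Filter.cofinite ≤ Filter.principal S := by
    rw [Filter.le_principal_iff]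
    filter_upwards [eventually_rat_mem ((M : ℚ)⁻¹)] with q hq
    have h2 : ‖(M : ℚ_[q])⁻¹‖ ≤ 1 := by
      have : ‖(((M : ℚ)⁻¹ : ℚ) : ℚ_[q])‖ ≤ 1 := hq
      rwa [Rat.cast_inv, Rat.cast_intCast] at this
    have h3 : ‖(M : ℚ_[q])‖ ≤ 1 := Padic.norm_int_le_one M
    have h4 : 0 < ‖(M : ℚ_[q])‖ := norm_pos_iff.2 (Int.cast_ne_zero.2 hM)
    rw [norm_inv, inv_le_one₀ h4] at h2
    exact le_antisymm h3 h2
  set D : ∀ q : Nat.Primes, Set (Quat a b ℚ_[q])ˣ := fun q : Nat.Primes => {u | (u : Quat a b ℚ_[q]) ∈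
    quatBall a b q 1 ∧ ((u⁻¹ : (Quat a b ℚ_[q])ˣ) : Quat a b ℚ_[q]) ∈
      quatBall a b q ‖(M : ℚ_[q])‖⁻¹} with hD
  have hcpt : IsCompact (Set.pi Set.univ D) :=
    isCompact_univ_pi fun q => isCompact_units_quatBall _ _
  set e : Πʳ q : Nat.Primes, [(Quat a b ℚ_[q])ˣ, ordUnits a b q]_[Filter.principal S] →
    ∀ q : Nat.Primes, (Quat a b ℚ_[q])ˣ := fun x => x
  have hemb : Topology.IsEmbedding e := RestrictedProduct.isEmbedding_coe_of_principal
  have hrange : Set.pi Set.univ D ⊆ Set.range e := by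
    intro y hy
    refine ⟨⟨y, fun q hq => ?_⟩, rfl⟩
    have h := hy q trivial
    rw [hS, Set.mem_ofPred_eq] at hq
    rw [hD] at h
    simp only [hq, inv_one] at h
    exact (Submonoid.mem_units_iff _ _).2 h
  have hpre : IsCompact (e ⁻¹' Set.pi Set.univ D) := by
    rw [hemb.isCompact_iff, Set.image_preimage_eq_of_subset hrange]
    exact hcpt
  convert hpre.image (RestrictedProduct.continuous_inclusion hfin) using 1
  ext y
  constructor
  · intro hy
    have hyD : ∀ q, y q ∈ D q := fun q =>
      ⟨(hy q).1, (smul_mem_stdOrder_iff (Int.cast_ne_zero.2 hM) _).1 (hy q).2⟩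
    obtain ⟨y', hy'⟩ := hrange fun q _ => hyD q
    refine ⟨y', ?_, ?_⟩
    · change e y' ∈ Set.pi Set.univ D
      rw [hy']
      exact fun q _ => hyD q
    · exact RestrictedProduct.ext _ _ fun q => congrFun hy' q
  · rintro ⟨y', hy', rfl⟩ q
    exact ⟨(hy' q trivial).1, (smul_mem_stdOrder_iff (Int.cast_ne_zero.2 hM) _).2 (hy' q trivial).2⟩

/-- The subgroup `∏_q 𝒪_q^×`. -/
def ordLevel (a b : ℤ) : Subgroup (Bf a b) where
  carrier := {x | ∀ q, x q ∈ ordUnits a b q}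
  one_mem' := fun _ => one_mem _
  mul_mem' := fun hx hy q => mul_mem (hx q) (hy q)
  inv_mem' := fun hx q => inv_mem (hx q)

theorem isOpen_ordLevel : IsOpen (ordLevel a b : Set (Bf a b)) :=
  RestrictedProduct.isOpen_forall_mem fun _ => isOpen_ordUnits

end Topology

/-! ### Compact sets and open subgroups -/

section OpenSubgroup

variable {G : Type*} [Group G] [TopologicalSpace G] [IsTopologicalGroup G]

theorem exists_finite_cover {U : Subgroup G} (hU : IsOpen (U : Set G)) {C : Set G}
    (hC : IsCompact C) : ∃ t : Finset G, ∀ x ∈ C, ∃ g ∈ t, x * g⁻¹ ∈ U := by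
  obtain ⟨t, ht⟩ := hC.elim_finite_subcover (fun g : G => (fun x => x * g⁻¹) ⁻¹' (U : Set G))
    (fun g => hU.preimage (continuous_mul_const _))
    fun x _ => Set.mem_iUnion.2 ⟨x, by simp⟩
  refine ⟨t, fun x hx => ?_⟩
  obtain ⟨g, hg, hxg⟩ := Set.mem_iUnion₂.1 (ht hx)
  exact ⟨g, hg, hxg⟩

/-- Finitely many cosets of an open subgroup cover a compact set. For C = KπK this makes the
`finsum` defining a Hecke operator a genuine finite sum. -/
theorem finite_out_mem {U : Subgroup G} (hU : IsOpen (U : Set G)) {C : Set G}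
    (hC : IsCompact C) : {q : RightCosets U | q.out ∈ C}.Finite := by
  obtain ⟨t, ht⟩ := exists_finite_cover hU hC
  refine (t.finite_toSet.image fun g => (Quotient.mk _ g : RightCosets U)).subset fun q hq => ?_
  obtain ⟨g, hg, h⟩ := ht _ hq
  refine ⟨g, hg, ?_⟩
  conv_rhs => rw [← Quotient.out_eq q]
  exact (rightCosets_mk_eq_iff U).2 h

theorem isCompact_doubleCoset {K : Subgroup G} (hK : IsCompact (K : Set G)) (π : G) :
    IsCompact (DoubleCoset.doubleCoset π (K : Set G) (K : Set G)) :=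
  (hK.mul isCompact_singleton).mul hK

omit [IsTopologicalGroup G] in
-- f is bounded on K, and powers remain in K, so no value exceeds 1; applying this also to the
-- inverse gives equality.
theorem norm_eq_one_of_isCompact {K : Subgroup G} (hK : IsCompact (K : Set G)) (f : G →* ℝ)
    (hf : Continuous f) (hf0 : ∀ x, 0 ≤ f x) {u : G} (hu : u ∈ K) : f u = 1 := by
  obtain ⟨C, hC⟩ := (hK.image hf).bddAbove
  have hle : ∀ v ∈ K, f v ≤ 1 := fun v hv => by
    by_contra! h
    obtain ⟨n, hn⟩ := pow_unbounded_of_one_lt C h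
    have := hC ⟨v ^ n, pow_mem hv n, rfl⟩
    rw [map_pow] at this
    linarith
  have h1 := hle _ hu
  have h2 := hle _ (inv_mem hu)
  have h3 : f u * f u⁻¹ = 1 := by rw [← map_mul, mul_inv_cancel, map_one]
  nlinarith [hf0 u, hf0 u⁻¹]

end OpenSubgroup

theorem norm_nrd_eq_one {a b : ℤ} {K : Subgroup (Bf a b)} (hK : IsCompact (K : Set (Bf a b)))
    {u : Bf a b} (hu : u ∈ K) (q : Nat.Primes) :
    ‖nrd a b ℚ_[q] ((u q : (Quat a b ℚ_[q])ˣ) : Quat a b ℚ_[q])‖ = 1 := by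
  refine norm_eq_one_of_isCompact hK
    ⟨⟨fun x : Bf a b => ‖nrd a b ℚ_[q] ((x q : (Quat a b ℚ_[q])ˣ) : Quat a b ℚ_[q])‖, ?_⟩, ?_⟩
    ?_ (fun x => norm_nonneg (nrd a b ℚ_[q] ((x q : (Quat a b ℚ_[q])ˣ) : Quat a b ℚ_[q]))) hu
  · change ‖nrd a b ℚ_[q] 1‖ = 1
    rw [map_one, norm_one]
  · intro x y
    change ‖nrd a b ℚ_[q] (((x q : (Quat a b ℚ_[q])ˣ) : Quat a b ℚ_[q]) *
      ((y q : (Quat a b ℚ_[q])ˣ) : Quat a b ℚ_[q]))‖ = _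
    rw [map_mul, norm_mul]
  · exact (continuous_nrd.comp (Units.continuous_val.comp
      (RestrictedProduct.continuous_eval q))).norm

/-! ### Rational numbers and rational quaternions -/

theorem exists_int_of_norm_le_one {r : ℚ} (h : ∀ q : Nat.Primes, ‖(r : ℚ_[q])‖ ≤ 1) :
    ∃ n : ℤ, (n : ℚ) = r := by
  refine ⟨r.num, Rat.coe_int_num_of_den_eq_one ?_⟩
  by_contra hden
  obtain ⟨q, hq, hqd⟩ := Nat.exists_prime_and_dvd hden
  obtain ⟨l, rfl⟩ : ∃ l : Nat.Primes, (l : ℕ) = q := ⟨⟨q, hq⟩, rfl⟩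
  have hr := h l
  have h1 : ‖((r.den : ℕ) : ℚ_[l])‖ < 1 := Padic.norm_natCast_lt_one_iff.2 hqd
  have h2 : ‖((r.num : ℤ) : ℚ_[l])‖ = 1 := by
    rw [Padic.norm_intCast_eq_one_iff, Int.isCoprime_iff_gcd_eq_one]
    exact Nat.Coprime.coprime_dvd_right hqd r.reduced
  have h3 : (r : ℚ_[l]) * ((r.den : ℕ) : ℚ_[l]) = ((r.num : ℤ) : ℚ_[l]) := by
    exact_mod_cast congrArg (Rat.cast : ℚ → ℚ_[l]) (Rat.mul_den_eq_num r)
  rw [← h3, norm_mul] at h2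
  nlinarith [norm_nonneg (r : ℚ_[l]), norm_nonneg ((r.den : ℕ) : ℚ_[l])]

/-- The rational numbers that are integral at all primes different from `q`. -/
def integralAway (q : Nat.Primes) : Set ℚ := {r | ∀ l : Nat.Primes, l ≠ q → ‖(r : ℚ_[l])‖ ≤ 1}

/-- Clear the denominator of z by a power q^k, approximate z q^k by a natural number m, and use m /
q^k, whose denominator is a power of q. -/
theorem denseRange_integralAway (q : Nat.Primes) :
    DenseRange fun r : integralAway q => ((r : ℚ) : ℚ_[q]) := by
  refine Metric.denseRange_iff.2 fun z ε hε => ?_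
  have hq1 : (1 : ℝ) < ((q : ℕ) : ℝ) := by exact_mod_cast q.2.one_lt
  obtain ⟨k, hk⟩ := pow_unbounded_of_one_lt ‖z‖ hq1
  have hqk : 0 < ((q : ℕ) : ℝ) ^ k := by positivity
  have hnq : ‖((q : ℕ) : ℚ_[q]) ^ k‖ = (((q : ℕ) : ℝ) ^ k)⁻¹ := by
    rw [norm_pow, Padic.norm_p, inv_pow]
  have hz : ‖z * ((q : ℕ) : ℚ_[q]) ^ k‖ ≤ 1 := by
    rw [norm_mul, hnq, ← div_eq_mul_inv, div_le_one hqk]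
    exact hk.le
  obtain ⟨m, hm⟩ := Metric.denseRange_iff.1 (PadicInt.denseRange_natCast (p := (q : ℕ)))
    ⟨_, hz⟩ (ε / ((q : ℕ) : ℝ) ^ k) (by positivity)
  have hm' : ‖z * ((q : ℕ) : ℚ_[q]) ^ k - (m : ℚ_[q])‖ < ε / ((q : ℕ) : ℝ) ^ k := hm
  refine ⟨⟨(m : ℚ) / ((q : ℕ) : ℚ) ^ k, fun l hl => ?_⟩, ?_⟩
  · have h1 : ‖((q : ℕ) : ℚ_[l])‖ = 1 := norm_prime_ne hl
    have h2 : ‖((m : ℤ) : ℚ_[l])‖ ≤ 1 := Padic.norm_int_le_one m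
    rw [Rat.cast_div, Rat.cast_pow, Rat.cast_natCast, Rat.cast_natCast, norm_div, norm_pow, h1,
      one_pow, div_one]
    exact_mod_cast h2
  · have h0 : ((q : ℕ) : ℚ_[q]) ^ k ≠ 0 := pow_ne_zero _ (prime_ne_zero q)
    have heq : z - (((m : ℚ) / ((q : ℕ) : ℚ) ^ k : ℚ) : ℚ_[q]) =
        (z * ((q : ℕ) : ℚ_[q]) ^ k - (m : ℚ_[q])) / ((q : ℕ) : ℚ_[q]) ^ k := by
      push_cast
      field_simp
    rw [dist_eq_norm, heq, norm_div, hnq, div_inv_eq_mul]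
    rwa [lt_div_iff₀ hqk] at hm'

section Quaternions

variable {a b : ℤ}

theorem exists_unit_of_nrd_ne_zero {F : Type*} [Field F] {x : Quat a b F} (hx : nrd a b F x ≠ 0) :
    ∃ u : (Quat a b F)ˣ, (u : Quat a b F) = x ∧ ((u⁻¹ : (Quat a b F)ˣ) : Quat a b F) =
      (nrd a b F x)⁻¹ • (⟨x.re, -x.imI, -x.imJ, -x.imK⟩ : Quat a b F) := by
  have hx' : x.re ^ 2 - a * x.imI ^ 2 - b * x.imJ ^ 2 + a * b * x.imK ^ 2 ≠ 0 := hx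
  have hn : nrd a b F x = x.re ^ 2 - a * x.imI ^ 2 - b * x.imJ ^ 2 + a * b * x.imK ^ 2 := rfl
  refine ⟨⟨x, (nrd a b F x)⁻¹ • (⟨x.re, -x.imI, -x.imJ, -x.imK⟩ : Quat a b F), ?_, ?_⟩, rfl, rfl⟩
  · rw [hn]
    ext <;> simp <;> field_simp <;> ring
  · rw [hn]
    ext <;> simp <;> field_simp <;> ring

theorem nrd_pos (ha : a < 0) (hb : b < 0) {x : Quat a b ℚ} (hx : x ≠ 0) : 0 < nrd a b ℚ x := by
  change 0 < x.re ^ 2 - a * x.imI ^ 2 - b * x.imJ ^ 2 + a * b * x.imK ^ 2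
  have ha' : (0 : ℚ) < -a := by exact_mod_cast Int.neg_pos_of_neg ha
  have hb' : (0 : ℚ) < -b := by exact_mod_cast Int.neg_pos_of_neg hb
  have h1 : 0 ≤ x.re ^ 2 := sq_nonneg _
  have h2 : 0 ≤ -a * x.imI ^ 2 := by positivity
  have h3 : 0 ≤ -b * x.imJ ^ 2 := by positivity
  have h4 : 0 ≤ (-a * -b) * x.imK ^ 2 := by positivity
  by_contra! h
  refine hx (QuaternionAlgebra.ext ?_ ?_ ?_ ?_)
  · have : x.re ^ 2 = 0 := by nlinarith
    simpa using this
  · have : -a * x.imI ^ 2 = 0 := by nlinarith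
    simpa [ha'.ne', ha.ne] using this
  · have : -b * x.imJ ^ 2 = 0 := by nlinarith
    simpa [hb'.ne', hb.ne] using this
  · have : (-a * -b) * x.imK ^ 2 = 0 := by nlinarith
    simpa [ha'.ne', ha.ne, hb'.ne', hb.ne] using this

theorem nrd_baseChange {R S : Type*} [CommRing R] [CommRing S] (f : R →+* S) (x : Quat a b R) :
    nrd a b S (baseChange a b f x) = f (nrd a b R x) := by
  change (f x.re) ^ 2 - a * (f x.imI) ^ 2 - b * (f x.imJ) ^ 2 + a * b * (f x.imK) ^ 2 =
    f (x.re ^ 2 - a * x.imI ^ 2 - b * x.imJ ^ 2 + a * b * x.imK ^ 2)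
  simp

theorem baseChange_sub {R S : Type*} [CommRing R] [CommRing S] (f : R →+* S) (x y : Quat a b R) :
    baseChange a b f (x - y) = baseChange a b f x - baseChange a b f y := by
  ext <;> simp [baseChange]

theorem baseChange_smul {R S : Type*} [CommRing R] [CommRing S] (f : R →+* S) (c : R)
    (x : Quat a b R) : baseChange a b f (c • x) = f c • baseChange a b f x := by
  ext <;> simp [baseChange]

theorem sub_mem_stdOrder {q : Nat.Primes} {x y : Quat a b ℚ_[q]} (hx : x ∈ stdOrder a b q)
    (hy : y ∈ stdOrder a b q) : x - y ∈ stdOrder a b q :=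
  ⟨sub_mem hx.1 hy.1, sub_mem hx.2.1 hy.2.1, sub_mem hx.2.2.1 hy.2.2.1,
    sub_mem hx.2.2.2 hy.2.2.2⟩

theorem smul_mem_stdOrder {q : Nat.Primes} {c : ℚ_[q]} (hc : ‖c‖ ≤ 1) {x : Quat a b ℚ_[q]}
    (hx : x ∈ stdOrder a b q) : c • x ∈ stdOrder a b q := by
  have hc' : c ∈ PadicInt.subring q := hc
  exact ⟨mul_mem hc' hx.1, mul_mem hc' hx.2.1, mul_mem hc' hx.2.2.1, mul_mem hc' hx.2.2.2⟩

theorem exists_unit_mem_ordUnits {q : Nat.Primes} {x : Quat a b ℚ_[q]} (hx : x ∈ stdOrder a b q)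
    (hn : ‖nrd a b ℚ_[q] x‖ = 1) : ∃ u ∈ ordUnits a b q, (u : Quat a b ℚ_[q]) = x := by
  have h0 : nrd a b ℚ_[q] x ≠ 0 := norm_ne_zero_iff.1 (by rw [hn]; exact one_ne_zero)
  obtain ⟨u, hu, hu'⟩ := exists_unit_of_nrd_ne_zero h0
  refine ⟨u, (Submonoid.mem_units_iff _ _).2 ⟨by rwa [hu], ?_⟩, hu⟩
  rw [hu']
  refine smul_mem_stdOrder (by rw [norm_inv, hn, inv_one]) ?_
  exact ⟨hx.1, neg_mem hx.2.1, neg_mem hx.2.2.1, neg_mem hx.2.2.2⟩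

/-- The c for which hc is integral with reduced norm in the open unit ball about 1 form an open set
containing h⁻¹. Hence it contains a quaternion with coordinates in the dense set of rationals
integral away from q. -/
theorem exists_rational_approx {q : Nat.Primes} (h : (Quat a b ℚ_[q])ˣ) :
    ∃ c : Quat a b ℚ, (∀ l : Nat.Primes, l ≠ q →
      baseChange a b (Rat.castHom ℚ_[l]) c ∈ stdOrder a b l) ∧
      ∃ u ∈ ordUnits a b q, (u : Quat a b ℚ_[q]) = h * baseChange a b (Rat.castHom ℚ_[q]) c := by
  have hd := denseRange_integralAway q
  have hd4 := hd.prodMap (hd.prodMap (hd.prodMap hd))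
  set g : ℚ_[q] × ℚ_[q] × ℚ_[q] × ℚ_[q] → Quat a b ℚ_[q] := fun z => ⟨z.1, z.2.1, z.2.2.1, z.2.2.2⟩
  have hg : Function.Surjective g := fun z => ⟨(z.re, z.imI, z.imJ, z.imK), rfl⟩
  have hgc : Continuous g := continuous_quat_mk continuous_fst (continuous_fst.comp continuous_snd)
    (continuous_fst.comp (continuous_snd.comp continuous_snd))
    (continuous_snd.comp (continuous_snd.comp continuous_snd))
  have hdense := hg.denseRange.comp hd4 hgc
  set U : Set (Quat a b ℚ_[q]) := {c | (h : Quat a b ℚ_[q]) * c ∈ stdOrder a b q ∧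
    nrd a b ℚ_[q] ((h : Quat a b ℚ_[q]) * c) ∈ Metric.ball 1 1} with hU
  have hUo : IsOpen U :=
    (isOpen_stdOrder.preimage (continuous_const_mul _)).inter
      (Metric.isOpen_ball.preimage (continuous_nrd.comp (continuous_const_mul _)))
  obtain ⟨⟨r₁, r₂, r₃, r₄⟩, hr⟩ := hdense.exists_mem_open hUo
    ⟨((h⁻¹ : (Quat a b ℚ_[q])ˣ) : Quat a b ℚ_[q]), by
      rw [hU, Set.mem_ofPred_eq, Units.mul_inv, map_one]
      exact ⟨one_mem _, Metric.mem_ball_self one_pos⟩⟩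
  refine ⟨⟨r₁, r₂, r₃, r₄⟩, fun l hl => ⟨r₁.2 l hl, r₂.2 l hl, r₃.2 l hl, r₄.2 l hl⟩, ?_⟩
  refine exists_unit_mem_ordUnits hr.1 ?_
  have h1 := hr.2
  rw [mem_ball_iff_norm] at h1
  have h2 := norm_add_eq_one (norm_one (α := ℚ_[q])) h1
  rw [add_sub_cancel] at h2
  exact h2

theorem exists_common_denominator (x : Bf a b) : ∃ N : ℕ, N ≠ 0 ∧ ∀ q,
    (N : ℚ_[q]) • ((x q : (Quat a b ℚ_[q])ˣ) : Quat a b ℚ_[q]) ∈ stdOrder a b q := by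
  classical
  have hfin : {q : Nat.Primes | x q ∉ ordUnits a b q}.Finite := x.2
  have hloc : ∀ q : Nat.Primes, ∃ k : ℕ, (((q : ℕ) : ℚ_[q]) ^ k) •
      ((x q : (Quat a b ℚ_[q])ˣ) : Quat a b ℚ_[q]) ∈ stdOrder a b q := by
    intro q
    set y := ((x q : (Quat a b ℚ_[q])ˣ) : Quat a b ℚ_[q])
    have hq1 : (1 : ℝ) < ((q : ℕ) : ℝ) := by exact_mod_cast q.2.one_lt
    obtain ⟨k, hk⟩ := pow_unbounded_of_one_lt (max (max ‖y.re‖ ‖y.imI‖) (max ‖y.imJ‖ ‖y.imK‖)) hq1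
    simp only [max_lt_iff] at hk
    refine ⟨k, (smul_mem_stdOrder_iff (pow_ne_zero _ (prime_ne_zero q)) _).2 ?_⟩
    rw [norm_pow, Padic.norm_p, inv_pow, inv_inv]
    exact ⟨hk.1.1.le, hk.1.2.le, hk.2.1.le, hk.2.2.le⟩
  choose k hk using hloc
  refine ⟨∏ q ∈ hfin.toFinset, (q : ℕ) ^ k q,
    Finset.prod_ne_zero_iff.2 fun q _ => pow_ne_zero _ q.2.ne_zero, fun q => ?_⟩
  by_cases hq : x q ∈ ordUnits a b q
  · refine smul_mem_stdOrder ?_ ((Submonoid.mem_units_iff _ _).1 hq).1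
    exact_mod_cast Padic.norm_int_le_one (p := (q : ℕ)) _
  · rw [← Finset.mul_prod_erase _ _ (hfin.mem_toFinset.2 hq), mul_comm, Nat.cast_mul, mul_smul]
    refine smul_mem_stdOrder ?_ ?_
    · exact_mod_cast Padic.norm_int_le_one (p := (q : ℕ)) _
    · rw [Nat.cast_pow]
      exact hk q

end Quaternions

/-! ### Simultaneous approximation -/

/-- Dirichlet's pigeonhole: among L⁴ + 1 multiples of u, two have fractional parts in the same of
the L⁴ subcubes of side 1/L. -/
theorem exists_simultaneous_approx {L : ℕ} (hL : 0 < L) (u : Fin 4 → ℚ) :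
    ∃ t : ℕ, 1 ≤ t ∧ t ≤ L ^ 4 ∧ ∃ d : Fin 4 → ℤ, ∀ i, |t * u i - d i| < 1 / L := by
  have hL' : (0 : ℚ) < L := by exact_mod_cast hL
  let f : Fin (L ^ 4 + 1) → Fin 4 → Fin L := fun t i =>
    ⟨⌊(L : ℚ) * Int.fract ((t : ℕ) * u i)⌋₊, by
      rw [Nat.floor_lt (mul_nonneg hL'.le (Int.fract_nonneg _))]
      exact mul_lt_of_lt_one_right hL' (Int.fract_lt_one _)⟩
  obtain ⟨s, t, hst, hf⟩ := Fintype.exists_ne_map_eq_of_card_lt f (by simp)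
  wlog h : s < t generalizing s t
  · exact this t s hst.symm hf.symm (lt_of_le_of_ne (not_lt.1 h) hst.symm)
  have h' : (s : ℕ) < (t : ℕ) := h
  refine ⟨t - s, by omega, by omega, fun i => ⌊((t : ℕ) : ℚ) * u i⌋ - ⌊((s : ℕ) : ℚ) * u i⌋,
    fun i => ?_⟩
  have h1 : ⌊(L : ℚ) * Int.fract (((s : ℕ) : ℚ) * u i)⌋₊ =
      ⌊(L : ℚ) * Int.fract (((t : ℕ) : ℚ) * u i)⌋₊ := congrArg Fin.val (congrFun hf i)
  have hs1 := Nat.floor_le (mul_nonneg hL'.le (Int.fract_nonneg (((s : ℕ) : ℚ) * u i)))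
  have hs2 := Nat.lt_floor_add_one ((L : ℚ) * Int.fract (((s : ℕ) : ℚ) * u i))
  have ht1 := Nat.floor_le (mul_nonneg hL'.le (Int.fract_nonneg (((t : ℕ) : ℚ) * u i)))
  have ht2 := Nat.lt_floor_add_one ((L : ℚ) * Int.fract (((t : ℕ) : ℚ) * u i))
  rw [h1] at hs1 hs2
  have heq : ((t - s : ℕ) : ℚ) * u i -
      ((⌊((t : ℕ) : ℚ) * u i⌋ - ⌊((s : ℕ) : ℚ) * u i⌋ : ℤ) : ℚ) =
      Int.fract (((t : ℕ) : ℚ) * u i) - Int.fract (((s : ℕ) : ℚ) * u i) := by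
    rw [Nat.cast_sub h'.le]
    push_cast
    rw [Int.fract, Int.fract]
    ring
  rw [heq, abs_lt, lt_div_iff₀ hL', ← neg_div, div_lt_iff₀ hL']
  constructor <;> nlinarith

/-- A substitute for division with remainder: the order need not be Euclidean, but some multiple of
u by an integer bounded independently of u is close to the order. -/
theorem exists_nrd_lt_one {a b : ℤ} (ha : a < 0) (hb : b < 0) : ∃ T : ℕ, ∀ u : Quat a b ℚ,
    ∃ t : ℕ, 1 ≤ t ∧ t ≤ T ∧ ∃ d : Quat a b ℤ,
      nrd a b ℚ ((t : ℚ) • u - baseChange a b (Int.castRingHom ℚ) d) < 1 := by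
  -- L = 1 - a - b + ab is the sum of the coefficients of the norm form, so coordinate errors below
  -- 1/L give norm at most L · L⁻² = 1/L < 1.
  obtain ⟨L, hL⟩ := Int.eq_ofNat_of_zero_le (show 0 ≤ (1 - a) * (1 - b) by nlinarith)
  have hL1 : 1 < L := by zify; rw [← hL]; nlinarith
  refine ⟨L ^ 4, fun u => ?_⟩
  obtain ⟨t, h1, h2, d, hd⟩ := exists_simultaneous_approx (zero_lt_one.trans hL1)
    ![u.re, u.imI, u.imJ, u.imK]
  refine ⟨t, h1, h2, ⟨d 0, d 1, d 2, d 3⟩, ?_⟩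
  have hLQ : (1 : ℚ) < L := by exact_mod_cast hL1
  have hsq : ∀ i, (t * (![u.re, u.imI, u.imJ, u.imK] : Fin 4 → ℚ) i - d i) ^ 2 ≤ (1 / L : ℚ) ^ 2 :=
    fun i => sq_le_sq' (abs_lt.1 (hd i)).1.le (abs_lt.1 (hd i)).2.le
  have e0 : (t * u.re - d 0) ^ 2 ≤ (1 / L : ℚ) ^ 2 := hsq 0
  have e1 : (t * u.imI - d 1) ^ 2 ≤ (1 / L : ℚ) ^ 2 := hsq 1
  have e2 : (t * u.imJ - d 2) ^ 2 ≤ (1 / L : ℚ) ^ 2 := hsq 2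
  have e3 : (t * u.imK - d 3) ^ 2 ≤ (1 / L : ℚ) ^ 2 := hsq 3
  change (t * u.re - d 0) ^ 2 - a * (t * u.imI - d 1) ^ 2 - b * (t * u.imJ - d 2) ^ 2 +
    a * b * (t * u.imK - d 3) ^ 2 < 1
  have ha' : (0 : ℚ) < -a := by exact_mod_cast Int.neg_pos_of_neg ha
  have hb' : (0 : ℚ) < -b := by exact_mod_cast Int.neg_pos_of_neg hb
  have hLS : (L : ℚ) = (1 - a) * (1 - b) := by exact_mod_cast hL.symm
  have f1 := mul_le_mul_of_nonneg_left e1 ha'.le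
  have f2 := mul_le_mul_of_nonneg_left e2 hb'.le
  have f3 := mul_le_mul_of_nonneg_left e3 (mul_pos ha' hb').le
  have hfin : (1 - a) * (1 - b) * (1 / L : ℚ) ^ 2 < 1 := by
    rw [← hLS]
    have : (L : ℚ) * (1 / L) ^ 2 = 1 / L := by field_simp
    rw [this, div_lt_one (by linarith)]
    exact hLQ
  nlinarith

/-! ### Finiteness of class numbers -/

section ClassNumber

variable {a b : ℤ}

/-- The lattice of rational quaternions that `x` multiplies into the standard order at all
primes. -/
def latticeOf (x : Bf a b) : Set (Quat a b ℚ) :=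
  {c | ∀ q, ((x q : (Quat a b ℚ_[q])ˣ) : Quat a b ℚ_[q]) *
    baseChange a b (Rat.castHom ℚ_[q]) c ∈ stdOrder a b q}

/-- At each prime the product has the norm of nrd(x_q c), which is integral, and definiteness makes
it nonnegative. Well-ordering then applies to norms on the lattice. -/
theorem exists_natCast_eq_of_mem_latticeOf (ha : a < 0) (hb : b < 0) {x : Bf a b} {c : Quat a b ℚ}
    (hc : c ∈ latticeOf x) : ∃ n : ℕ, (n : ℚ) = ideleNorm (nrdIdele x) * nrd a b ℚ c := by
  have hint : ∃ n : ℤ, (n : ℚ) = ideleNorm (nrdIdele x) * nrd a b ℚ c := by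
    refine exists_int_of_norm_le_one fun q => ?_
    have h1 : ‖nrd a b ℚ_[q] (((x q : (Quat a b ℚ_[q])ˣ) : Quat a b ℚ_[q]) *
        baseChange a b (Rat.castHom ℚ_[q]) c)‖ ≤ 1 := nrd_mem a b q (hc q)
    rw [map_mul, nrd_baseChange, norm_mul] at h1
    rw [Rat.cast_mul, norm_mul, norm_ideleNorm]
    exact h1
  obtain ⟨n, hn⟩ := hint
  have h0 : (0 : ℚ) ≤ n := by
    rw [hn]
    refine mul_nonneg (finprod_nonneg fun q => by positivity) ?_
    rcases eq_or_ne c 0 with rfl | hc0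
    · simp [nrd]
    · exact (nrd_pos ha hb hc0).le
  lift n to ℕ using by exact_mod_cast h0
  exact ⟨n, by exact_mod_cast hn⟩

theorem ideleNorm_pos (z : Ideles) : 0 < ideleNorm z :=
  finprod_induction (0 < ·) one_pos (fun _ _ => mul_pos) fun q =>
    zpow_pos (by exact_mod_cast q.2.pos) _

theorem baseChange_intCast_mem (d : Quat a b ℤ) (q : Nat.Primes) :
    baseChange a b (Rat.castHom ℚ_[q]) (baseChange a b (Int.castRingHom ℚ) d) ∈ stdOrder a b q := by
  have h : ∀ m : ℤ, ((m : ℚ) : ℚ_[q]) ∈ PadicInt.subring q := fun m => by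
    rw [Rat.cast_intCast]
    exact intCast_mem _ m
  exact ⟨h _, h _, h _, h _⟩

/-- Approximate principality of the lattices `latticeOf x`. -/
theorem exists_dvd_of_mem_latticeOf (ha : a < 0) (hb : b < 0) : ∃ M : ℤ, M ≠ 0 ∧ ∀ x : Bf a b,
    ∃ γ : (Quat a b ℚ)ˣ, (γ : Quat a b ℚ) ∈ latticeOf x ∧ ∀ c ∈ latticeOf x, ∃ d : Quat a b ℤ,
      (M : ℚ) • c = γ * baseChange a b (Int.castRingHom ℚ) d := by
  classical
  obtain ⟨T, hT⟩ := exists_nrd_lt_one ha hb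
  -- T! is divisible by every multiplier t ≤ T produced by the approximation.
  refine ⟨T.factorial, by exact_mod_cast T.factorial_ne_zero, fun x => ?_⟩
  obtain ⟨N, hN, hNx⟩ := exists_common_denominator x
  set P : ℕ → Prop := fun n => ∃ c ∈ latticeOf x, c ≠ 0 ∧
    (n : ℚ) = ideleNorm (nrdIdele x) * nrd a b ℚ c with hP
  have hex : ∃ n, P n := by
    have hmem : ((N : ℚ) • 1 : Quat a b ℚ) ∈ latticeOf x := fun q => by
      rw [baseChange_smul, map_one, mul_smul_comm, mul_one, eq_ratCast, Rat.cast_natCast]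
      exact hNx q
    obtain ⟨n, hn⟩ := exists_natCast_eq_of_mem_latticeOf ha hb hmem
    exact ⟨n, _, hmem, smul_ne_zero (Nat.cast_ne_zero.2 hN) one_ne_zero, hn⟩
  obtain ⟨g, hg, hg0, hgn⟩ := Nat.find_spec hex
  obtain ⟨γ, hγ, -⟩ := exists_unit_of_nrd_ne_zero (nrd_pos ha hb hg0).ne'
  subst hγ
  refine ⟨γ, hg, fun c hc => ?_⟩
  obtain ⟨t, ht1, htT, d, hd⟩ := hT (((γ⁻¹ : (Quat a b ℚ)ˣ) : Quat a b ℚ) * c)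
  -- γ has minimal norm among nonzero lattice elements. The remainder lies in the lattice and has
  -- strictly smaller norm, so it is zero.
  have hker : (t : ℚ) • c - γ * baseChange a b (Int.castRingHom ℚ) d = 0 := by
    by_contra hne
    have hmem : (t : ℚ) • c - γ * baseChange a b (Int.castRingHom ℚ) d ∈ latticeOf x := by
      intro q
      rw [baseChange_sub, baseChange_smul, map_mul, mul_sub, mul_smul_comm, ← mul_assoc]
      refine sub_mem_stdOrder (smul_mem_stdOrder ?_ (hc q))
        (mul_mem (hg q) (baseChange_intCast_mem d q))
      rw [eq_ratCast, Rat.cast_natCast]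
      exact_mod_cast Padic.norm_int_le_one (p := (q : ℕ)) t
    obtain ⟨n, hn⟩ := exists_natCast_eq_of_mem_latticeOf ha hb hmem
    refine Nat.find_min hex (m := n) ?_ ⟨_, hmem, hne, hn⟩
    have h1 : (t : ℚ) • c - γ * baseChange a b (Int.castRingHom ℚ) d =
        γ * ((t : ℚ) • (((γ⁻¹ : (Quat a b ℚ)ˣ) : Quat a b ℚ) * c) -
          baseChange a b (Int.castRingHom ℚ) d) := by
      rw [mul_sub, mul_smul_comm, Units.mul_inv_cancel_left]
    have h2 : (n : ℚ) < (Nat.find hex : ℕ) := by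
      rw [hn, hgn, h1, map_mul]
      have := mul_pos (ideleNorm_pos (nrdIdele x)) (nrd_pos ha hb hg0)
      nlinarith
    exact_mod_cast h2
  obtain ⟨s, hs⟩ := Nat.dvd_factorial ht1 htT
  refine ⟨(s : ℤ) • d, ?_⟩
  rw [baseChange_smul, mul_smul_comm, ← sub_eq_zero.1 hker, smul_smul, hs]
  push_cast
  rw [mul_comm]
  rfl

/-- Take γ almost generating the lattice of x, so that xγ is integral. At a given q choose c
rational with N x_q c = u a unit of the order and Nc in the lattice; then M N c = γd with d
integral. Hence (xγ)_q d u⁻¹ = M, and M (xγ)_q⁻¹ = d u⁻¹ is integral. -/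
theorem exists_mul_diag_mem_boundedInverse (ha : a < 0) (hb : b < 0) : ∃ M : ℤ, M ≠ 0 ∧
    ∀ x : Bf a b, ∃ γ : (Quat a b ℚ)ˣ, x * diag a b γ ∈ boundedInverse a b M := by
  obtain ⟨M, hM, h⟩ := exists_dvd_of_mem_latticeOf ha hb
  refine ⟨M, hM, fun x => ?_⟩
  obtain ⟨γ, hγ, hdvd⟩ := h x
  refine ⟨γ, fun q => ⟨hγ q, ?_⟩⟩
  obtain ⟨N, hN, hNx⟩ := exists_common_denominator x
  have hN0 : (N : ℚ_[q]) ≠ 0 := Nat.cast_ne_zero.2 hN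
  obtain ⟨c, hc, u, hu, huc⟩ := exists_rational_approx (Units.mk0 (N : ℚ_[q]) hN0 • x q)
  rw [Units.val_smul, Units.smul_def, Units.val_mk0] at huc
  have hmem : (N : ℚ) • c ∈ latticeOf x := by
    intro l
    rw [baseChange_smul, mul_smul_comm, ← smul_mul_assoc, eq_ratCast, Rat.cast_natCast]
    rcases eq_or_ne l q with rfl | hl
    · rw [← huc]
      exact ((Submonoid.mem_units_iff _ _).1 hu).1
    · exact mul_mem (hNx l) (hc l hl)
  obtain ⟨d, hd⟩ := hdvd _ hmem
  have hy : (((x * diag a b γ) q : (Quat a b ℚ_[q])ˣ) : Quat a b ℚ_[q]) =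
    (x q : (Quat a b ℚ_[q])ˣ) * baseChange a b (Rat.castHom ℚ_[q]) γ := rfl
  have hkey : (((x * diag a b γ) q : (Quat a b ℚ_[q])ˣ) : Quat a b ℚ_[q]) *
      (baseChange a b (Rat.castHom ℚ_[q]) (baseChange a b (Int.castRingHom ℚ) d) *
        ((u⁻¹ : (Quat a b ℚ_[q])ˣ) : Quat a b ℚ_[q])) = (M : ℚ_[q]) • 1 := by
    rw [hy, mul_assoc, ← mul_assoc (baseChange a b (Rat.castHom ℚ_[q]) γ), ← map_mul, ← hd,
      baseChange_smul, baseChange_smul, ← mul_assoc, mul_smul_comm, mul_smul_comm, ← smul_mul_assoc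
      (Rat.castHom ℚ_[q] N), eq_ratCast, eq_ratCast, Rat.cast_natCast, Rat.cast_intCast, ← huc,
      smul_mul_assoc, Units.mul_inv]
  have hfin : (M : ℚ_[q]) • ((((x * diag a b γ) q)⁻¹ : (Quat a b ℚ_[q])ˣ) : Quat a b ℚ_[q]) =
      baseChange a b (Rat.castHom ℚ_[q]) (baseChange a b (Int.castRingHom ℚ) d) *
        ((u⁻¹ : (Quat a b ℚ_[q])ˣ) : Quat a b ℚ_[q]) := by
    rw [← Units.inv_mul_cancel_left ((x * diag a b γ) q) (baseChange a b (Rat.castHom ℚ_[q])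
      (baseChange a b (Int.castRingHom ℚ) d) * ((u⁻¹ : (Quat a b ℚ_[q])ˣ) : Quat a b ℚ_[q])), hkey,
      mul_smul_comm, mul_one]
  rw [hfin]
  exact mul_mem (baseChange_intCast_mem d q) ((Submonoid.mem_units_iff _ _).1 hu).2

/-- Every B^×-orbit meets one fixed compact set, which finitely many cosets of the open subgroup K
cover. -/
theorem finite_doubleCoset_quotient (ha : a < 0) (hb : b < 0) {K : Subgroup (Bf a b)}
    (hK : IsOpen (K : Set (Bf a b))) :
    Finite (DoubleCoset.Quotient (K : Set (Bf a b)) ((diag a b).range : Set (Bf a b))) := by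
  obtain ⟨M, hM, h⟩ := exists_mul_diag_mem_boundedInverse ha hb
  obtain ⟨t, ht⟩ := exists_finite_cover hK (isCompact_boundedInverse (a := a) (b := b) hM)
  refine Finite.of_surjective (fun g : t => DoubleCoset.mk K (diag a b).range (g : Bf a b))
    fun c => ?_
  induction c using Quotient.inductionOn with | h x => ?_
  obtain ⟨γ, hγ⟩ := h x
  obtain ⟨g, hg, hxg⟩ := ht _ hγ
  refine ⟨⟨g, hg⟩, (DoubleCoset.eq _ _ _ _).2 ⟨_, hxg, diag a b γ⁻¹, ⟨_, rfl⟩, ?_⟩⟩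
  rw [map_inv]
  group

/-- Such γ and γ⁻¹ have integer coordinates, so their reduced norms are positive integers with
product 1. The norm form is diagonal with coefficients at least 1, which bounds each coordinate by 1
in absolute value. -/
theorem finite_diag_mem_ordLevel (ha : a < 0) (hb : b < 0) :
    {γ : (Quat a b ℚ)ˣ | diag a b γ ∈ ordLevel a b}.Finite := by
  set f : ℤ × ℤ × ℤ × ℤ → Quat a b ℚ := fun m => ⟨m.1, m.2.1, m.2.2.1, m.2.2.2⟩
  have hfin : (f '' (Set.Icc (-1) 1 ×ˢ Set.Icc (-1) 1 ×ˢ Set.Icc (-1) 1 ×ˢ Set.Icc (-1) 1)).Finite :=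
    ((Set.finite_Icc _ _).prod ((Set.finite_Icc _ _).prod
      ((Set.finite_Icc _ _).prod (Set.finite_Icc _ _)))).image f
  refine (hfin.preimage Units.val_injective.injOn).subset fun γ hγ => ?_
  have hint : ∀ δ : (Quat a b ℚ)ˣ, diag a b δ ∈ ordLevel a b →
      ∃ m : ℤ × ℤ × ℤ × ℤ, f m = δ := fun δ hδ => by
    have h := fun q => ((Submonoid.mem_units_iff _ _).1 (hδ q)).1
    obtain ⟨m₁, h₁⟩ := exists_int_of_norm_le_one (r := (δ : Quat a b ℚ).re) fun q => (h q).1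
    obtain ⟨m₂, h₂⟩ := exists_int_of_norm_le_one (r := (δ : Quat a b ℚ).imI) fun q => (h q).2.1
    obtain ⟨m₃, h₃⟩ := exists_int_of_norm_le_one (r := (δ : Quat a b ℚ).imJ) fun q => (h q).2.2.1
    obtain ⟨m₄, h₄⟩ := exists_int_of_norm_le_one (r := (δ : Quat a b ℚ).imK) fun q => (h q).2.2.2
    exact ⟨(m₁, m₂, m₃, m₄), QuaternionAlgebra.ext h₁ h₂ h₃ h₄⟩
  have hnrd : ∀ m, nrd a b ℚ (f m) = ((m.1 ^ 2 - a * m.2.1 ^ 2 - b * m.2.2.1 ^ 2 +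
      a * b * m.2.2.2 ^ 2 : ℤ) : ℚ) := fun m => by
    change (m.1 : ℚ) ^ 2 - a * (m.2.1 : ℚ) ^ 2 - b * (m.2.2.1 : ℚ) ^ 2 +
      a * b * (m.2.2.2 : ℚ) ^ 2 = _
    push_cast
    ring
  obtain ⟨m, hm⟩ := hint γ hγ
  obtain ⟨m', hm'⟩ := hint γ⁻¹ (by rw [map_inv]; exact inv_mem hγ)
  have h1 : nrd a b ℚ (f m) * nrd a b ℚ (f m') = 1 := by
    rw [← map_mul, hm, hm', Units.mul_inv, map_one]
  have hpos : 0 < nrd a b ℚ (f m) := nrd_pos ha hb (by rw [hm]; exact γ.ne_zero)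
  rw [hnrd] at hpos
  rw [hnrd, hnrd] at h1
  have h2 : m.1 ^ 2 - a * m.2.1 ^ 2 - b * m.2.2.1 ^ 2 + a * b * m.2.2.2 ^ 2 = 1 :=
    Int.eq_one_of_mul_eq_one_right (by exact_mod_cast hpos.le) (by exact_mod_cast h1)
  have hab : 1 ≤ a * b := Int.add_one_le_of_lt (mul_pos_of_neg_of_neg ha hb)
  have e1 := sq_nonneg m.1
  have e2 := sq_nonneg m.2.1
  have e3 := sq_nonneg m.2.2.1
  have e4 := sq_nonneg m.2.2.2
  have hbox : ∀ k : ℤ, k ^ 2 ≤ 1 → k ∈ Set.Icc (-1 : ℤ) 1 := fun k hk =>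
    Set.mem_Icc.2 (abs_le.1 ((sq_le_one_iff_abs_le_one k).1 hk))
  have g2 : 1 * m.2.1 ^ 2 ≤ -a * m.2.1 ^ 2 := mul_le_mul_of_nonneg_right (by lia) e2
  have g3 : 1 * m.2.2.1 ^ 2 ≤ -b * m.2.2.1 ^ 2 := mul_le_mul_of_nonneg_right (by lia) e3
  have g4 : 1 * m.2.2.2 ^ 2 ≤ a * b * m.2.2.2 ^ 2 := mul_le_mul_of_nonneg_right hab e4
  exact ⟨m, ⟨hbox _ (by linarith), hbox _ (by linarith), hbox _ (by linarith),
    hbox _ (by linarith)⟩, hm⟩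

/-- Finitely many cosets of the open subgroup `ordLevel` cover C, and the rational points of each
coset are a translate of a subset of those of the subgroup. -/
theorem finite_diag_mem (ha : a < 0) (hb : b < 0) {C : Set (Bf a b)} (hC : IsCompact C) :
    {γ : (Quat a b ℚ)ˣ | diag a b γ ∈ C}.Finite := by
  obtain ⟨t, ht⟩ := exists_finite_cover (isOpen_ordLevel (a := a) (b := b)) hC
  have hfin := finite_diag_mem_ordLevel ha hb
  have hcov : {γ : (Quat a b ℚ)ˣ | diag a b γ ∈ C} ⊆
      ⋃ g ∈ t, {γ : (Quat a b ℚ)ˣ | diag a b γ * g⁻¹ ∈ ordLevel a b} := fun γ hγ => by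
    obtain ⟨g, hg, h⟩ := ht _ hγ
    exact Set.mem_biUnion hg h
  refine (t.finite_toSet.biUnion fun g _ => ?_).subset hcov
  rcases Set.eq_empty_or_nonempty {γ : (Quat a b ℚ)ˣ | diag a b γ * g⁻¹ ∈ ordLevel a b} with h | ⟨γ₀, h₀⟩
  · rw [h]
    exact Set.finite_empty
  · refine (hfin.image (· * γ₀)).subset fun γ hγ => ⟨γ * γ₀⁻¹, ?_, inv_mul_cancel_right _ _⟩
    have := (ordLevel a b).mul_mem hγ ((ordLevel a b).inv_mem h₀)
    rw [Set.mem_ofPred_eq, map_mul, map_inv]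
    convert this using 1
    group

theorem finite_arithGroup (ha : a < 0) (hb : b < 0) {K : Subgroup (Bf a b)}
    (hK : IsCompact (K : Set (Bf a b))) (x : Bf a b) :
    {γ : (Quat a b ℚ)ˣ | x * diag a b γ * x⁻¹ ∈ K}.Finite := by
  refine (finite_diag_mem ha hb (hK.image (f := fun y => x⁻¹ * y * x) (by fun_prop))).subset
    fun γ hγ => ⟨_, hγ, ?_⟩
  group

end ClassNumber

/-! ### Norms of ideles -/

section Norms

theorem eq_of_norm_eq {r s : ℚ} (hr : 0 < r) (hs : 0 < s)
    (h : ∀ q : Nat.Primes, ‖(r : ℚ_[q])‖ = ‖(s : ℚ_[q])‖) : r = s := by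
  have key : ∀ {r s : ℚ}, 0 < r → 0 < s → (∀ q : Nat.Primes, ‖(r : ℚ_[q])‖ = ‖(s : ℚ_[q])‖) →
      s ≤ r := fun {r s} hr hs h => by
    obtain ⟨n, hn⟩ := exists_int_of_norm_le_one (r := r / s) fun q => by
      rw [Rat.cast_div, norm_div, h q, div_self (norm_ne_zero_iff.2 (Rat.cast_ne_zero.2 hs.ne'))]
    have hpos : (0 : ℚ) < n := by rw [hn]; exact div_pos hr hs
    have h1 : (1 : ℚ) ≤ n := by exact_mod_cast Int.add_one_le_of_lt (Int.cast_pos.1 hpos)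
    rwa [hn, one_le_div hs] at h1
  exact le_antisymm (key hs hr fun q => (h q).symm) (key hr hs h)

theorem ideleNorm_eq {z : Ideles} {r : ℚ} (hr : 0 < r)
    (h : ∀ q : Nat.Primes, ‖(z q : ℚ_[q])‖ = ‖(r : ℚ_[q])‖) : ideleNorm z = r :=
  eq_of_norm_eq (ideleNorm_pos z) hr fun q => by rw [norm_ideleNorm, h]

theorem coe_unitPart (z : Ideles) (q : Nat.Primes) :
    (((unitPart z q : ℤ_[q]ˣ) : ℤ_[q]) : ℚ_[q]) = (z q : ℚ_[q]) / ((ideleNorm z : ℚ) : ℚ_[q]) := rfl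

theorem ideleNorm_mul (z w : Ideles) : ideleNorm (z * w) = ideleNorm z * ideleNorm w := by
  refine ideleNorm_eq (mul_pos (ideleNorm_pos z) (ideleNorm_pos w)) fun q => ?_
  rw [Rat.cast_mul, norm_mul, norm_ideleNorm, norm_ideleNorm, ← norm_mul]
  rfl

theorem unit_ext {p : Nat.Primes} {t u : ℤ_[p]ˣ} (h : ((t : ℤ_[p]) : ℚ_[p]) = ((u : ℤ_[p]) : ℚ_[p])) :
    t = u := Units.ext (Subtype.ext h)

theorem coe_unit_mul {p : Nat.Primes} (t u : ℤ_[p]ˣ) : (((t * u : ℤ_[p]ˣ) : ℤ_[p]) : ℚ_[p]) =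
    ((t : ℤ_[p]) : ℚ_[p]) * ((u : ℤ_[p]) : ℚ_[p]) := rfl

theorem unitPart_mul (z w : Ideles) (q : Nat.Primes) :
    unitPart (z * w) q = unitPart z q * unitPart w q := by
  refine unit_ext ?_
  rw [coe_unit_mul, coe_unitPart, coe_unitPart, coe_unitPart, ideleNorm_mul, Rat.cast_mul]
  exact mul_div_mul_comm _ _ _ _

variable {a b : ℤ} {p : Nat.Primes}

theorem nrdIdele_mul (x y : Bf a b) : nrdIdele (x * y) = nrdIdele x * nrdIdele y :=
  RestrictedProduct.ext _ _ fun q => map_mul (Units.map (nrd a b ℚ_[q])) (x q) (y q)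

theorem nrdP_mul (x y : Bf a b) : nrdP p (x * y) = nrdP p x * nrdP p y := by
  have h : unitPart (nrdIdele (x * y)) p =
    unitPart (nrdIdele x) p * unitPart (nrdIdele y) p := by rw [nrdIdele_mul, unitPart_mul]
  change (unitPart (nrdIdele (x * y)) p)⁻¹ =
    (unitPart (nrdIdele x) p)⁻¹ * (unitPart (nrdIdele y) p)⁻¹
  rw [h]
  exact mul_inv _ _

/-- The product formula: by definiteness nrd γ is a positive rational, so it equals its own N_f,
with no sign left over. -/
theorem nrdP_diag (ha : a < 0) (hb : b < 0) (γ : (Quat a b ℚ)ˣ) : nrdP p (diag a b γ) = 1 := by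
  have hpos := nrd_pos ha hb γ.ne_zero
  have hq : ∀ q : Nat.Primes, ((nrdIdele (diag a b γ) q : ℚ_[q]ˣ) : ℚ_[q]) =
      ((nrd a b ℚ γ : ℚ) : ℚ_[q]) := fun q =>
    nrd_baseChange (Rat.castHom ℚ_[q]) (γ : Quat a b ℚ)
  have hN : ideleNorm (nrdIdele (diag a b γ)) = nrd a b ℚ γ :=
    ideleNorm_eq hpos fun q => by rw [hq]
  refine inv_eq_one.2 (unit_ext ?_)
  rw [coe_unitPart, hN, hq]
  exact div_self (Rat.cast_ne_zero.2 hpos.ne')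

end Norms

/-! ### Matrices of `p`-components -/

section Matrices

variable {a b : ℤ} {p : Nat.Primes}
  (θ : Quat a b ℚ_[p] ≃ₐ[ℚ_[p]] Matrix (Fin 2) (Fin 2) ℚ_[p])

/-- θ x satisfies both its characteristic polynomial and X² - 2 re(x) X + nrd(x). Their difference
is linear in X: either the traces agree, and then so do the constant terms, or θ x is a scalar, for
which both sides are its square. -/
theorem det_eq_nrd (x : Quat a b ℚ_[p]) : (θ x).det = nrd a b ℚ_[p] x := by
  have hn : nrd a b ℚ_[p] x = x.re ^ 2 - a * x.imI ^ 2 - b * x.imJ ^ 2 + a * b * x.imK ^ 2 := rfl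
  have hquad : x * x = (2 * x.re) • x - nrd a b ℚ_[p] x • (1 : Quat a b ℚ_[p]) := by
    rw [hn]
    ext <;> simp <;> ring
  have hθ : θ x * θ x = (2 * x.re) • θ x - nrd a b ℚ_[p] x • (1 : Matrix (Fin 2) (Fin 2) ℚ_[p]) := by
    rw [← map_mul, hquad, map_sub, map_smul, map_smul, map_one]
  have hch : θ x * θ x = (θ x).trace • θ x - (θ x).det • (1 : Matrix (Fin 2) (Fin 2) ℚ_[p]) := by
    ext i j
    fin_cases i <;> fin_cases j <;>
      simp [Matrix.mul_apply, Matrix.trace_fin_two, Matrix.det_fin_two, Fin.sum_univ_two] <;> ring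
  have hsub : (2 * x.re - (θ x).trace) • θ x =
      (nrd a b ℚ_[p] x - (θ x).det) • (1 : Matrix (Fin 2) (Fin 2) ℚ_[p]) := by
    rw [sub_smul, sub_smul]
    exact sub_eq_sub_iff_sub_eq_sub.1 (hθ.symm.trans hch)
  by_cases h0 : 2 * x.re - (θ x).trace = 0
  · rw [h0, zero_smul] at hsub
    have h1 := congrFun (congrFun hsub 0) 0
    simp only [Matrix.zero_apply, Matrix.smul_apply, Matrix.one_apply_eq, smul_eq_mul, mul_one] at h1
    exact (sub_eq_zero.1 h1.symm).symm
  · set c := (2 * x.re - (θ x).trace)⁻¹ * (nrd a b ℚ_[p] x - (θ x).det) with hc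
    have h1 : θ x = c • (1 : Matrix (Fin 2) (Fin 2) ℚ_[p]) := by
      rw [hc, mul_smul, ← hsub, smul_smul, inv_mul_cancel₀ h0, one_smul]
    have h2 : x = c • (1 : Quat a b ℚ_[p]) := θ.injective (by rw [h1, map_smul, map_one])
    rw [h1, h2]
    simp [nrd]

theorem matP_mul (x y : Bf a b) : matP θ (x * y) = matP θ x * matP θ y :=
  map_mul θ ((x p : (Quat a b ℚ_[p])ˣ) : Quat a b ℚ_[p]) ((y p : (Quat a b ℚ_[p])ˣ) : Quat a b ℚ_[p])

theorem matP_one : matP θ (1 : Bf a b) = 1 := map_one θ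

theorem matP_inv_mul (x : Bf a b) : matP θ x⁻¹ * matP θ x = 1 := by
  rw [← matP_mul, inv_mul_cancel, matP_one]

theorem det_matP (x : Bf a b) : (matP θ x).det =
    ((ideleNorm (nrdIdele x) : ℚ) : ℚ_[p]) * ((((nrdP p x)⁻¹ : ℤ_[p]ˣ) : ℤ_[p]) : ℚ_[p]) := by
  have h1 : (nrdP p x)⁻¹ = unitPart (nrdIdele x) p := inv_inv (unitPart (nrdIdele x) p)
  have h0 : ((ideleNorm (nrdIdele x) : ℚ) : ℚ_[p]) ≠ 0 :=
    Rat.cast_ne_zero.2 (ideleNorm_pos _).ne'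
  rw [h1, coe_unitPart]
  exact (det_eq_nrd θ _).trans (mul_div_cancel₀ _ h0).symm

theorem matP_central (z : Ideles) :
    matP θ (central a b z) = (z p : ℚ_[p]) • (1 : Matrix (Fin 2) (Fin 2) ℚ_[p]) :=
  (AlgEquiv.commutes θ (z p : ℚ_[p])).trans (Algebra.algebraMap_eq_smul_one _)

theorem matP_atP (g : GL (Fin 2) ℚ_[p]) :
    matP θ (atP θ g) = (g : Matrix (Fin 2) (Fin 2) ℚ_[p]) := by
  have h : (atP θ g) p = Units.map (θ.symm : Matrix (Fin 2) (Fin 2) ℚ_[p] →* Quat a b ℚ_[p]) g :=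
    RestrictedProduct.mulSingle_eq_same _ _ _
  rw [matP, h]
  exact θ.apply_symm_apply _

theorem atP_apply_of_ne (g : GL (Fin 2) ℚ_[p]) {q : Nat.Primes} (h : q ≠ p) : (atP θ g) q = 1 :=
  RestrictedProduct.mulSingle_eq_of_ne _ _ h

theorem atP_mul (g h : GL (Fin 2) ℚ_[p]) : atP θ (g * h) = atP θ g * atP θ h := by
  rw [atP, map_mul, RestrictedProduct.mulSingle_mul]
  rfl

theorem atP_inv (g : GL (Fin 2) ℚ_[p]) : atP θ g⁻¹ = (atP θ g)⁻¹ := by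
  rw [atP, map_inv, RestrictedProduct.mulSingle_inv]
  rfl

variable {θ} in
theorem ext_of_matP {x y : Bf a b} (h : matP θ x = matP θ y) (h' : ∀ q, q ≠ p → x q = y q) :
    x = y := by
  refine RestrictedProduct.ext _ _ fun q => ?_
  by_cases hq : q = p
  · subst hq
    exact Units.ext (θ.injective h)
  · exact h' q hq

theorem commute_atP {x : Bf a b} (hx : matP θ x = 1) (g : GL (Fin 2) ℚ_[p]) :
    atP θ g * x = x * atP θ g := by
  refine ext_of_matP (θ := θ) (by rw [matP_mul, matP_mul, hx, mul_one, one_mul]) fun q hq => ?_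
  change (atP θ g) q * x q = x q * (atP θ g) q
  rw [atP_apply_of_ne θ g hq, one_mul, mul_one]

theorem ideleNorm_atP (g : GL (Fin 2) ℚ_[p]) {r : ℚ} (hr : 0 < r)
    (hg : (g : Matrix (Fin 2) (Fin 2) ℚ_[p]).det = r)
    (h : ∀ q : Nat.Primes, q ≠ p → ‖(r : ℚ_[q])‖ = 1) :
    ideleNorm (nrdIdele (atP θ g)) = r := by
  refine ideleNorm_eq hr fun q => ?_
  by_cases hq : q = p
  · subst hq
    rw [← hg, ← matP_atP θ g]
    exact congrArg _ (det_eq_nrd θ _).symm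
  · have h1 : (nrdIdele (atP θ g)) q = 1 := by
      change Units.map (nrd a b ℚ_[q]) ((atP θ g) q) = 1
      rw [atP_apply_of_ne θ g hq, map_one]
    rw [h1, h q hq, Units.val_one, norm_one]

theorem det_piP : (piP p : Matrix (Fin 2) (Fin 2) ℚ_[p]).det = (((p : ℕ) : ℚ) : ℚ_[p]) := by
  change (!![1, 0; 0, ((p : ℕ) : ℚ_[p])] : Matrix (Fin 2) (Fin 2) ℚ_[p]).det = _
  rw [Matrix.det_fin_two_of, Rat.cast_natCast]
  ring

theorem coe_piP : (piP p : Matrix (Fin 2) (Fin 2) ℚ_[p]) = !![1, 0; 0, ((p : ℕ) : ℚ_[p])] := rfl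

theorem coe_piPiota :
    (piPiota p : Matrix (Fin 2) (Fin 2) ℚ_[p]) = !![((p : ℕ) : ℚ_[p]), 0; 0, 1] := rfl

theorem ideleNorm_atP_piP : ideleNorm (nrdIdele (atP θ (piP p))) = ((p : ℕ) : ℚ) := by
  refine ideleNorm_atP θ _ (by exact_mod_cast p.2.pos) det_piP fun q hq => ?_
  have h : ‖((p : ℕ) : ℚ_[q])‖ = 1 := norm_prime_ne hq
  rw [Rat.cast_natCast]
  exact h

theorem ideleNorm_level {K : Subgroup (Bf a b)} (hK : IsCompact (K : Set (Bf a b))) {u : Bf a b}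
    (hu : u ∈ K) : ideleNorm (nrdIdele u) = 1 := by
  refine ideleNorm_eq one_pos fun q => ?_
  rw [Rat.cast_one, norm_one]
  exact norm_nrd_eq_one hK hu q

theorem det_matP_level {K : Subgroup (Bf a b)} (hK : IsCompact (K : Set (Bf a b))) {u : Bf a b}
    (hu : u ∈ K) : (matP θ u).det = ((((nrdP p u)⁻¹ : ℤ_[p]ˣ) : ℤ_[p]) : ℚ_[p]) := by
  rw [det_matP, ideleNorm_level hK hu, Rat.cast_one, one_mul]

/-- The double coset of `diag(1, p)` at `p`. -/
abbrev heckeSet (K : Subgroup (Bf a b)) : Set (Bf a b) :=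
  DoubleCoset.doubleCoset (atP θ (piP p)) (K : Set (Bf a b)) (K : Set (Bf a b))

/-- The double coset of `diag(p, 1)` at `p`. -/
abbrev heckeSetIota (K : Subgroup (Bf a b)) : Set (Bf a b) :=
  DoubleCoset.doubleCoset (atP θ (piPiota p)) (K : Set (Bf a b)) (K : Set (Bf a b))

theorem det_matP_heckeSet {K : Subgroup (Bf a b)} (hK : IsCompact (K : Set (Bf a b))) {c : Bf a b}
    (hc : c ∈ heckeSet θ K) : (matP θ c).det =
      ((p : ℕ) : ℚ_[p]) * ((((nrdP p c)⁻¹ : ℤ_[p]ˣ) : ℤ_[p]) : ℚ_[p]) := by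
  obtain ⟨u, hu, v, hv, rfl⟩ := DoubleCoset.mem_doubleCoset.1 hc
  rw [det_matP, nrdIdele_mul, nrdIdele_mul, ideleNorm_mul, ideleNorm_mul, ideleNorm_level hK hu,
    ideleNorm_level hK hv, ideleNorm_atP_piP, one_mul, mul_one, Rat.cast_natCast]

/-- The idele equal to `p` at `p` and to `1` elsewhere. -/
def zP (p : Nat.Primes) : Ideles :=
  RestrictedProduct.mulSingle (fun q => intUnits q) p (Units.mk0 ((p : ℕ) : ℚ_[p]) (prime_ne_zero p))

theorem zP_self (p : Nat.Primes) : ((zP p p : ℚ_[p]ˣ) : ℚ_[p]) = ((p : ℕ) : ℚ_[p]) := by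
  have h : zP p p = Units.mk0 ((p : ℕ) : ℚ_[p]) (prime_ne_zero p) :=
    RestrictedProduct.mulSingle_eq_same _ _ _
  rw [h, Units.val_mk0]

theorem zP_of_ne {p q : Nat.Primes} (h : q ≠ p) : zP p q = 1 :=
  RestrictedProduct.mulSingle_eq_of_ne _ _ h

/-- The idele has N_f = p, and dividing by p leaves 1 at p and p⁻¹ at every other prime. This is the
source of the factor ω₃(p'). -/
theorem unitPart_zP (p : Nat.Primes) : unitPart (zP p) = (pPrime p)⁻¹ := by
  have hN : ideleNorm (zP p) = ((p : ℕ) : ℚ) := by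
    refine ideleNorm_eq (by exact_mod_cast p.2.pos) fun q => ?_
    rw [Rat.cast_natCast]
    by_cases hq : q = p
    · subst hq
      rw [zP_self]
    · have h : ‖((p : ℕ) : ℚ_[q])‖ = 1 := norm_prime_ne hq
      rw [zP_of_ne hq, Units.val_one, norm_one]
      exact h.symm
  funext q
  refine eq_inv_of_mul_eq_one_left (unit_ext ?_)
  rw [coe_unit_mul, coe_unitPart, hN, Rat.cast_natCast]
  by_cases hq : q = p
  · subst hq
    rw [zP_self, div_self (prime_ne_zero q), one_mul, pPrime, dif_pos rfl]
  · have h0 : ((p : ℕ) : ℚ_[q]) ≠ 0 := Nat.cast_ne_zero.2 p.2.ne_zero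
    rw [zP_of_ne hq, pPrime, dif_neg hq]
    exact one_div_mul_cancel h0

/-- The identity p · diag(1,p)⁻¹ = diag(p,1): up to the central idele, inverting the double coset of
U_p gives that of U_p^ι. -/
theorem central_zP_mul_atP_inv :
    central a b (zP p) * (atP θ (piP p))⁻¹ = atP θ (piPiota p) := by
  rw [mul_inv_eq_iff_eq_mul]
  refine ext_of_matP (θ := θ) ?_ fun q hq => ?_
  · rw [matP_mul, matP_central, matP_atP, matP_atP, zP_self, coe_piP, coe_piPiota]
    ext i j
    fin_cases i <;> fin_cases j <;> simp
  · change Units.map _ (zP p q) = (atP θ (piPiota p)) q * (atP θ (piP p)) q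
    rw [zP_of_ne hq, map_one, atP_apply_of_ne θ _ hq, atP_apply_of_ne θ _ hq, one_mul]

theorem central_mul_comm (z : Ideles) (x : Bf a b) : central a b z * x = x * central a b z :=
  RestrictedProduct.ext _ _ fun _ => Units.ext (Algebra.commutes _ _)

theorem inv_mem_heckeSet_iff {K : Subgroup (Bf a b)} (x : Bf a b) :
    x⁻¹ ∈ heckeSet θ K ↔ central a b (zP p) * x ∈ heckeSetIota θ K := by
  have h := central_zP_mul_atP_inv (a := a) (b := b) θ
  constructor
  · intro hx
    obtain ⟨u, hu, v, hv, hx⟩ := DoubleCoset.mem_doubleCoset.1 hx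
    refine DoubleCoset.mem_doubleCoset.2 ⟨v⁻¹, inv_mem hv, u⁻¹, inv_mem hu, ?_⟩
    rw [← h, ← inv_inv x, hx, mul_inv_rev, mul_inv_rev]
    simp only [mul_assoc]
    rw [← mul_assoc, central_mul_comm, mul_assoc]
  · intro hx
    obtain ⟨u, hu, v, hv, hx⟩ := DoubleCoset.mem_doubleCoset.1 hx
    refine DoubleCoset.mem_doubleCoset.2 ⟨v⁻¹, inv_mem hv, u⁻¹, inv_mem hu, ?_⟩
    have h1 : x = u * (atP θ (piP p))⁻¹ * v := by
      refine mul_left_cancel (a := central a b (zP p)) ?_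
      rw [hx, ← h]
      simp only [mul_assoc]
      rw [← mul_assoc, ← central_mul_comm, mul_assoc]
    rw [h1]
    group

end Matrices

/-! ### Matrices acting on the two regions -/

section Stability

variable {p : Nat.Primes} {m n : Matrix (Fin 2) (Fin 2) ℚ_[p]}

theorem IsGamma0.norm_diag (hm : IsGamma0 m) : ‖m 0 0‖ = 1 ∧ ‖m 1 1‖ = 1 := by
  have h1 : ‖m 0 1 * m 1 0‖ < 1 := by
    rw [norm_mul]
    exact mul_lt_one_of_nonneg_of_lt_one_right (hm.1 0 1) (norm_nonneg _) hm.2.2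
  have h2 := norm_add_eq_one hm.2.1 h1
  rw [Matrix.det_fin_two, sub_add_cancel, norm_mul] at h2
  have h3 := hm.1 0 0
  have h4 := hm.1 1 1
  constructor <;> nlinarith [norm_nonneg (m 0 0), norm_nonneg (m 1 1)]

theorem vecMul_two (w : Fin 2 → ℚ_[p]) (m : Matrix (Fin 2) (Fin 2) ℚ_[p]) (j : Fin 2) :
    Matrix.vecMul w m j = w 0 * m 0 j + w 1 * m 1 j := by
  simp [Matrix.vecMul, dotProduct, Fin.sum_univ_two]

theorem Region.StableUnder.mul {X : Region p} (hm : X.StableUnder m) (hn : X.StableUnder n) :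
    X.StableUnder (m * n) := fun w hw => by
  rw [← Matrix.vecMul_vecMul]
  exact hn _ (hm w hw)

theorem Region.StableUnder.unit_smul {X : Region p} (hm : X.StableUnder m) (t : ℤ_[p]ˣ) :
    X.StableUnder (((t : ℤ_[p]) : ℚ_[p]) • m) := fun w hw => by
  rw [Matrix.vecMul_smul]
  exact X.smul_mem t _ (hm w hw)

theorem norm_prime_lt_one (p : Nat.Primes) : ‖((p : ℕ) : ℚ_[p])‖ < 1 := Padic.norm_p_lt_one

theorem IsGamma0.regionWhat_stable (hm : IsGamma0 m) : (regionWhat p).StableUnder m := by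
  rintro w ⟨h0, h1⟩
  constructor
  · rw [vecMul_two]
    refine (Padic.nonarchimedean _ _).trans_lt (max_lt ?_ ?_) <;> rw [norm_mul]
    · exact mul_lt_one_of_nonneg_of_lt_one_left (norm_nonneg _) h0 (hm.1 0 0)
    · exact mul_lt_one_of_nonneg_of_lt_one_right h1.le (norm_nonneg _) hm.2.2
  · rw [vecMul_two, add_comm]
    refine norm_add_eq_one (by rw [norm_mul, h1, hm.norm_diag.2, one_mul]) ?_
    rw [norm_mul]
    exact mul_lt_one_of_nonneg_of_lt_one_left (norm_nonneg _) h0 (hm.1 0 1)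

theorem vecMul_piP (w : Fin 2 → ℚ_[p]) :
    Matrix.vecMul w (piP p : Matrix (Fin 2) (Fin 2) ℚ_[p]) = ![w 0, w 1 * ((p : ℕ) : ℚ_[p])] := by
  rw [coe_piP]
  ext j
  fin_cases j <;> simp [vecMul_two]

theorem regionW_stable_piP : (regionW p).StableUnder (piP p : Matrix (Fin 2) (Fin 2) ℚ_[p]) := by
  rintro w ⟨h0, h1⟩
  rw [vecMul_piP]
  refine ⟨h0, ?_⟩
  change ‖w 1 * ((p : ℕ) : ℚ_[p])‖ ≤ 1
  rw [norm_mul]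
  exact mul_le_one₀ h1 (norm_nonneg _) (norm_prime_lt_one p).le

theorem regionWhat_stable_piPiota :
    (regionWhat p).StableUnder (piPiota p : Matrix (Fin 2) (Fin 2) ℚ_[p]) := by
  rintro w ⟨h0, h1⟩
  have h : Matrix.vecMul w (piPiota p : Matrix (Fin 2) (Fin 2) ℚ_[p]) =
      ![w 0 * ((p : ℕ) : ℚ_[p]), w 1] := by
    rw [coe_piPiota]
    ext j
    fin_cases j <;> simp [vecMul_two]
  rw [h]
  refine ⟨?_, h1⟩
  change ‖w 0 * ((p : ℕ) : ℚ_[p])‖ < 1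
  rw [norm_mul]
  exact mul_lt_one_of_nonneg_of_lt_one_left (norm_nonneg _) h0 (norm_prime_lt_one p).le

theorem norm_delta_eq_of_det {v w : Fin 2 → ℚ_[p]} (hm : ‖m.det‖ = 1) :
    ‖delta (Matrix.vecMul v m) (Matrix.vecMul w m)‖ = ‖delta v w‖ := by
  rw [delta_vecMul, norm_mul, hm, one_mul]

/-- The entry `h₀₁` detects whether the pairing of `vπ` and `wπh` is a unit. -/
theorem norm_lt_one_of_delta_piP {h : Matrix (Fin 2) (Fin 2) ℚ_[p]} (hh : IsGamma0 h)
    {v w : Fin 2 → ℚ_[p]} (hv : v ∈ (regionW p).carrier) (hw : w ∈ (regionW p).carrier)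
    (hd : ‖delta (Matrix.vecMul v (piP p : Matrix (Fin 2) (Fin 2) ℚ_[p]))
      (Matrix.vecMul (Matrix.vecMul w (piP p : Matrix (Fin 2) (Fin 2) ℚ_[p])) h)‖ ≠ 1) :
    ‖h 0 1‖ < 1 := by
  refine lt_of_le_of_ne (hh.1 0 1) fun h01 => hd ?_
  have hz := (regionW p).norm_le _ (hh.regionW_stable hh.norm_diag.1 _ (regionW_stable_piP w hw))
  rw [pi_norm_le_iff_of_nonneg zero_le_one, Fin.forall_fin_two] at hz
  have hvp := vecMul_piP v
  -- Modulo p the pairing is v₀ w₀ h₀₁, where v₀ and w₀ are units.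
  have heq : delta (Matrix.vecMul v (piP p : Matrix (Fin 2) (Fin 2) ℚ_[p]))
      (Matrix.vecMul (Matrix.vecMul w (piP p : Matrix (Fin 2) (Fin 2) ℚ_[p])) h) =
      v 0 * w 0 * h 0 1 + ((p : ℕ) : ℚ_[p]) * (v 0 * (w 1 * h 1 1) - v 1 *
        (Matrix.vecMul (Matrix.vecMul w (piP p : Matrix (Fin 2) (Fin 2) ℚ_[p])) h) 0) := by
    rw [delta, hvp, vecMul_two _ h 1, vecMul_piP w]
    simp only [Matrix.cons_val_zero, Matrix.cons_val_one]
    ring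
  rw [heq]
  refine norm_add_eq_one (by rw [norm_mul, norm_mul, hv.1, hw.1, h01, one_mul, one_mul]) ?_
  rw [norm_mul]
  refine mul_lt_one_of_nonneg_of_lt_one_left (norm_nonneg _) (norm_prime_lt_one p) ?_
  rw [sub_eq_add_neg]
  refine (Padic.nonarchimedean _ _).trans (max_le ?_ ?_)
  · rw [norm_mul, norm_mul]
    exact mul_le_one₀ hv.1.le (by positivity) (mul_le_one₀ hw.2 (norm_nonneg _) (hh.1 1 1))
  · rw [norm_neg, norm_mul]
    exact mul_le_one₀ hv.2 (norm_nonneg _) hz.1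

/-- Conjugation by diag(1,p) divides the upper right entry by p and multiplies the lower left one by
p, so only integrality of h₀₁ / p is at stake. -/
theorem isGamma0_conj_piP {h : GL (Fin 2) ℚ_[p]} (hh : IsGamma0 (h : Matrix (Fin 2) (Fin 2) ℚ_[p]))
    (h01 : ‖(h : Matrix (Fin 2) (Fin 2) ℚ_[p]) 0 1‖ < 1) :
    IsGamma0 ((piP p * h * (piP p)⁻¹ : GL (Fin 2) ℚ_[p]) : Matrix (Fin 2) (Fin 2) ℚ_[p]) := by
  set A := (h : Matrix (Fin 2) (Fin 2) ℚ_[p])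
  have hp0 := prime_ne_zero p
  have hA : ((piP p * h * (piP p)⁻¹ : GL (Fin 2) ℚ_[p]) : Matrix (Fin 2) (Fin 2) ℚ_[p]) =
      !![A 0 0, A 0 1 / ((p : ℕ) : ℚ_[p]); ((p : ℕ) : ℚ_[p]) * A 1 0, A 1 1] := by
    rw [Units.val_mul, Units.mul_inv_eq_iff_eq_mul, Units.val_mul, coe_piP]
    ext i j
    fin_cases i <;> fin_cases j <;> simp [Matrix.mul_apply, Fin.sum_univ_two, A, mul_comm]
    field_simp
  have hdet : ‖((piP p * h * (piP p)⁻¹ : GL (Fin 2) ℚ_[p]) :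
      Matrix (Fin 2) (Fin 2) ℚ_[p]).det‖ = 1 := by
    rw [hA, Matrix.det_fin_two_of, ← hh.2.1, Matrix.det_fin_two]
    congr 2
    field_simp
  have h01' : ‖A 0 1 / ((p : ℕ) : ℚ_[p])‖ ≤ 1 := by
    -- The valuation is discrete: norm below 1 means norm at most 1/p.
    have h1 : ‖A 0 1‖ ≤ ((p : ℕ) : ℝ) ^ (-1 : ℤ) :=
      (Padic.norm_le_pow_iff_norm_lt_pow_add_one _ _).2 (by simpa using h01)
    have h2 : ‖((p : ℕ) : ℚ_[p])‖ = ((p : ℕ) : ℝ)⁻¹ := Padic.norm_p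
    rw [zpow_neg_one] at h1
    rw [norm_div, h2]
    exact (div_le_one (inv_pos.2 (by exact_mod_cast p.2.pos))).2 h1
  have h10 : ‖((p : ℕ) : ℚ_[p]) * A 1 0‖ < 1 := by
    rw [norm_mul]
    exact mul_lt_one_of_nonneg_of_lt_one_left (norm_nonneg _) (norm_prime_lt_one p) (hh.1 1 0)
  refine ⟨?_, hdet, by rw [hA]; exact h10⟩
  rw [hA]
  intro i j
  fin_cases i <;> fin_cases j
  exacts [hh.1 0 0, h01', h10.le, hh.1 1 1]

end Stability

/-! ### Cosets in the double coset of `diag(1, p)` -/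

section Level

variable {a b : ℤ} {p : Nat.Primes} {θ : Quat a b ℚ_[p] ≃ₐ[ℚ_[p]] Matrix (Fin 2) (Fin 2) ℚ_[p]}
  {K : Subgroup (Bf a b)} (hK : IsLevel θ K)
include hK

theorem IsLevel.regionW_stable {u : Bf a b} (hu : u ∈ K) : (regionW p).StableUnder (matP θ u) :=
  (hK.isGamma0 u hu).regionW_stable (hK.isGamma0 u hu).norm_diag.1

theorem IsLevel.regionWhat_stable {u : Bf a b} (hu : u ∈ K) :
    (regionWhat p).StableUnder (matP θ u) :=
  (hK.isGamma0 u hu).regionWhat_stable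

theorem IsLevel.regionW_stable_heckeSet {c : Bf a b} (hc : c ∈ heckeSet θ K) :
    (regionW p).StableUnder (matP θ c) := by
  obtain ⟨u, hu, v, hv, rfl⟩ := DoubleCoset.mem_doubleCoset.1 hc
  rw [matP_mul, matP_mul, matP_atP]
  exact ((hK.regionW_stable hu).mul regionW_stable_piP).mul (hK.regionW_stable hv)

theorem IsLevel.regionWhat_stable_heckeSetIota {c : Bf a b} (hc : c ∈ heckeSetIota θ K) :
    (regionWhat p).StableUnder (matP θ c) := by
  obtain ⟨u, hu, v, hv, rfl⟩ := DoubleCoset.mem_doubleCoset.1 hc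
  rw [matP_mul, matP_mul, matP_atP]
  exact ((hK.regionWhat_stable hu).mul regionWhat_stable_piPiota).mul (hK.regionWhat_stable hv)

/-- Split k into its component at p and the rest. The rest commutes with elements concentrated at p,
and the conjugate of the p-component stays in Γ₀(pℤ_p), which K contains. -/
theorem IsLevel.conj_piP_mem {k : Bf a b} (hk : k ∈ K) (h01 : ‖matP θ k 0 1‖ < 1) :
    atP θ (piP p) * k * (atP θ (piP p))⁻¹ ∈ K := by
  set h : GL (Fin 2) ℚ_[p] :=
    Units.map (θ : Quat a b ℚ_[p] →* Matrix (Fin 2) (Fin 2) ℚ_[p]) (k p) with hh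
  have hcoe : (h : Matrix (Fin 2) (Fin 2) ℚ_[p]) = matP θ k := rfl
  have hG : IsGamma0 (h : Matrix (Fin 2) (Fin 2) ℚ_[p]) := hK.isGamma0 k hk
  have hat := hK.atP_mem h hG
  have htriv : matP θ ((atP θ h)⁻¹ * k) = 1 := by
    rw [matP_mul, ← hcoe, ← matP_atP θ h, matP_inv_mul]
  have hcomm := commute_atP θ htriv (piP p)⁻¹
  have heq : atP θ (piP p) * k * (atP θ (piP p))⁻¹ =
      atP θ (piP p * h * (piP p)⁻¹) * ((atP θ h)⁻¹ * k) := by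
    rw [atP_mul, atP_mul, mul_assoc _ (atP θ (piP p)⁻¹), hcomm, atP_inv]
    group
  rw [heq]
  exact mul_mem (hK.atP_mem _ (isGamma0_conj_piP hG h01)) (mul_mem (inv_mem hat) hk)

/-- Representatives of different cosets give unit pairings. -/
theorem IsLevel.mul_inv_mem_of_norm_delta_ne_one {c c' : Bf a b} (hc : c ∈ heckeSet θ K)
    (hc' : c' ∈ heckeSet θ K) {w₁ w₂ : Fin 2 → ℚ_[p]} (h₁ : w₁ ∈ (regionW p).carrier)
    (h₂ : w₂ ∈ (regionW p).carrier)
    (hd : ‖delta (Matrix.vecMul w₁ (matP θ c)) (Matrix.vecMul w₂ (matP θ c'))‖ ≠ 1) :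
    c' * c⁻¹ ∈ K := by
  obtain ⟨l, hl, k, hk, rfl⟩ := DoubleCoset.mem_doubleCoset.1 hc
  obtain ⟨l', hl', k', hk', rfl⟩ := DoubleCoset.mem_doubleCoset.1 hc'
  have hkk : k' * k⁻¹ ∈ K := mul_mem hk' (inv_mem hk)
  -- A common right factor k has unit determinant and does not affect the norm of the pairing, so
  -- only k'k⁻¹ matters.
  have hk'eq : matP θ k' = matP θ (k' * k⁻¹) * matP θ k := by
    rw [← matP_mul, inv_mul_cancel_right]
  have g₁ : Matrix.vecMul w₁ (matP θ (l * atP θ (piP p) * k)) =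
      Matrix.vecMul (Matrix.vecMul (Matrix.vecMul w₁ (matP θ l)) (piP p).1) (matP θ k) := by
    rw [Matrix.vecMul_vecMul, Matrix.vecMul_vecMul, matP_mul, matP_mul, matP_atP, mul_assoc]
  have g₂ : Matrix.vecMul w₂ (matP θ (l' * atP θ (piP p) * k')) = Matrix.vecMul (Matrix.vecMul
      (Matrix.vecMul (Matrix.vecMul w₂ (matP θ l')) (piP p).1) (matP θ (k' * k⁻¹))) (matP θ k) := by
    rw [Matrix.vecMul_vecMul, ← hk'eq, Matrix.vecMul_vecMul, Matrix.vecMul_vecMul, matP_mul,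
      matP_mul, matP_atP, mul_assoc]
  have h01 : ‖matP θ (k' * k⁻¹) 0 1‖ < 1 := by
    refine norm_lt_one_of_delta_piP (hK.isGamma0 _ hkk) (hK.regionW_stable hl w₁ h₁)
      (hK.regionW_stable hl' w₂ h₂) ?_
    rw [← norm_delta_eq_of_det (hK.isGamma0 k hk).2.1]
    rwa [g₁, g₂] at hd
  have heq : l' * atP θ (piP p) * k' * (l * atP θ (piP p) * k)⁻¹ =
      l' * (atP θ (piP p) * (k' * k⁻¹) * (atP θ (piP p))⁻¹) * l⁻¹ := by group
  rw [heq]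
  exact mul_mem (mul_mem hl' (hK.conj_piP_mem hkk h01)) (inv_mem hl)

/-- The adjugate is det(c) c⁻¹, the determinant is p times a unit, and p c⁻¹ is the matrix of the
product of c⁻¹ with the central idele. -/
theorem IsLevel.adjugate_matP {c : Bf a b} (hc : c ∈ heckeSet θ K) :
    (matP θ c).adjugate = ((((nrdP p c)⁻¹ : ℤ_[p]ˣ) : ℤ_[p]) : ℚ_[p]) •
      matP θ (central a b (zP p) * c⁻¹) := by
  have h1 : matP θ c * matP θ c⁻¹ = 1 := by rw [← matP_mul, mul_inv_cancel, matP_one]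
  calc (matP θ c).adjugate = (matP θ c).adjugate * (matP θ c * matP θ c⁻¹) := by rw [h1, mul_one]
    _ = (matP θ c).det • matP θ c⁻¹ := by
      rw [← mul_assoc, Matrix.adjugate_mul, smul_mul_assoc, one_mul]
    _ = _ := by
      rw [det_matP_heckeSet θ hK.isCompact hc, matP_mul, matP_central, zP_self, smul_mul_assoc,
        one_mul, smul_smul, mul_comm]

end Level

/-! ### The part of the pairing supported on non-units -/

/-- Weights are multiplicative here, so `ks / kᵢ` stands for k* - kᵢ. The first three identities
give the homogeneity of Δ in each variable, the last its behaviour under simultaneous scaling of the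
pairings. -/
theorem div_mul_div_eq_of_sq_eq {G : Type*} [CommGroup G] {k₁ k₂ k₃ ks : G}
    (h : ks ^ 2 = k₁ * k₂ * k₃) : ks / k₂ * (ks / k₃) = k₁ ∧ ks / k₁ * (ks / k₃) = k₂ ∧
      ks / k₁ * (ks / k₂) = k₃ ∧ ks / k₁ * (ks / k₂) * (ks / k₃) = ks := by
  have h1 : ks / k₁ * (ks / k₂) = k₃ := by
    rw [div_mul_div_comm, ← sq, h, mul_div_cancel_left]
  refine ⟨?_, ?_, h1, ?_⟩
  · rw [div_mul_div_comm, ← sq, h, mul_assoc, mul_div_cancel_right]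
  · rw [div_mul_div_comm, ← sq, h, mul_comm k₁ k₂, mul_assoc, mul_div_cancel_right]
  · rw [h1, mul_div_cancel]

section Rest

variable {p : Nat.Primes} {O : Type*} [NormedCommRing O] [NormedAlgebra ℚ_[p] O]

/-- The difference of `DeltaFull` and `DeltaCirc`. -/
def DeltaRest (k₁s k₂s k₃s : ℤ_[p]ˣ →* Oˣ) (κ : ℤ_[p] →* O) :
    (Fin 2 → ℚ_[p]) → (Fin 2 → ℚ_[p]) → (Fin 2 → ℚ_[p]) → O :=
  triDelta (unitExt k₁s) (unitExt k₂s) fun x => intExt κ x - unitExt k₃s x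

variable {k₁ k₂ k₃ ks : ℤ_[p]ˣ →* Oˣ} {κ : ℤ_[p] →* O}

omit [NormedAlgebra ℚ_[p] O] in
theorem deltaFull_eq (k₁s k₂s k₃s : ℤ_[p]ˣ →* Oˣ) (κ : ℤ_[p] →* O) (w₁ w₂ w₃ : Fin 2 → ℚ_[p]) :
    DeltaFull k₁s k₂s κ w₁ w₂ w₃ =
      DeltaCirc k₁s k₂s k₃s w₁ w₂ w₃ + DeltaRest k₁s k₂s k₃s κ w₁ w₂ w₃ := by
  rw [DeltaFull, DeltaCirc, DeltaRest, triDelta]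
  ring

theorem norm_delta_le_one {v w : Fin 2 → ℚ_[p]} (hv : v ∈ (regionW p).carrier)
    (hw : w ∈ (regionW p).carrier) : ‖delta v w‖ ≤ 1 := by
  rw [delta, sub_eq_add_neg]
  refine (Padic.nonarchimedean _ _).trans (max_le ?_ ?_)
  · rw [norm_mul]
    exact mul_le_one₀ hv.1.le (norm_nonneg _) hw.2
  · rw [norm_neg, norm_mul]
    exact mul_le_one₀ hv.2 (norm_nonneg _) hw.1.le

omit [NormedAlgebra ℚ_[p] O] in
theorem intExt_natCast (κ : ℤ_[p] →* O) (n : ℕ) : intExt κ (n : ℚ_[p]) = κ (n : ℤ_[p]) := by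
  have h : ‖((n : ℤ_[p]) : ℚ_[p])‖ ≤ 1 := (n : ℤ_[p]).2
  rw [PadicInt.coe_natCast] at h
  rw [intExt, dif_pos h]
  exact congrArg κ (Subtype.ext (PadicInt.coe_natCast n).symm)

/-- All three pairings scale by det(m), with exponents adding up to k*. This is what the normalizing
factor Nrd_p(x)^{k*} compensates. -/
theorem deltaFull_vecMul (hκ : IsAnalyticExtension (ks / k₃) κ) (hks2 : ks ^ 2 = k₁ * k₂ * k₃)
    {m : Matrix (Fin 2) (Fin 2) ℚ_[p]} {t : ℤ_[p]ˣ} (hm : m.det = ((t : ℤ_[p]) : ℚ_[p]))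
    (w₁ w₂ w₃ : Fin 2 → ℚ_[p]) :
    DeltaFull (ks / k₁) (ks / k₂) κ (Matrix.vecMul w₁ m) (Matrix.vecMul w₂ m)
      (Matrix.vecMul w₃ m) = (ks t : O) * DeltaFull (ks / k₁) (ks / k₂) κ w₁ w₂ w₃ := by
  have ht := norm_unit_coe t
  have h : (ks / k₁) t * (ks / k₂) t * (ks / k₃) t = ks t :=
    DFunLike.congr_fun (div_mul_div_eq_of_sq_eq hks2).2.2.2 t
  rw [DeltaFull, DeltaFull, delta_vecMul, delta_vecMul, delta_vecMul, hm, unitExt_mul _ _ _ ht,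
    unitExt_mul _ _ _ ht, intExt_mul _ _ _ ht, unitExt_unit, unitExt_unit, hκ.intExt_eq ht,
    unitExt_unit, ← h, Units.val_mul, Units.val_mul]
  ring

variable [IsUltrametricDist O] [CompleteSpace O]

theorem tripleIntegrable_deltaFull (hk₁ : IsWeight k₁) (hk₂ : IsWeight k₂) (hks : IsWeight ks)
    (hks2 : ks ^ 2 = k₁ * k₂ * k₃) (hκ : IsAnalyticExtension (ks / k₃) κ) (X₁ X₂ X₃ : Region p) :
    TripleIntegrable k₁ k₂ k₃ X₁ X₂ X₃ (DeltaFull (ks / k₁) (ks / k₂) κ) :=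
  have h := div_mul_div_eq_of_sq_eq hks2
  tripleIntegrable_triDelta h.1 h.2.1 h.2.2.1 (hks.div hk₁).isHomAnalytic
    (hks.div hk₂).isHomAnalytic hκ.isHomAnalytic X₁ X₂ X₃

theorem tripleIntegrable_deltaCirc (hk₁ : IsWeight k₁) (hk₂ : IsWeight k₂) (hk₃ : IsWeight k₃)
    (hks : IsWeight ks) (hks2 : ks ^ 2 = k₁ * k₂ * k₃) (X₁ X₂ X₃ : Region p) :
    TripleIntegrable k₁ k₂ k₃ X₁ X₂ X₃ (DeltaCirc (ks / k₁) (ks / k₂) (ks / k₃)) :=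
  have h := div_mul_div_eq_of_sq_eq hks2
  tripleIntegrable_triDelta h.1 h.2.1 h.2.2.1 (hks.div hk₁).isHomAnalytic
    (hks.div hk₂).isHomAnalytic (hks.div hk₃).isHomAnalytic X₁ X₂ X₃

theorem tripleIntegrable_deltaRest (hk₁ : IsWeight k₁) (hk₂ : IsWeight k₂) (hk₃ : IsWeight k₃)
    (hks : IsWeight ks) (hks2 : ks ^ 2 = k₁ * k₂ * k₃) (hκ : IsAnalyticExtension (ks / k₃) κ)
    (X₁ X₂ X₃ : Region p) :
    TripleIntegrable k₁ k₂ k₃ X₁ X₂ X₃ (DeltaRest (ks / k₁) (ks / k₂) (ks / k₃) κ) :=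
  have h := div_mul_div_eq_of_sq_eq hks2
  tripleIntegrable_triDelta h.1 h.2.1 h.2.2.1 (hks.div hk₁).isHomAnalytic
    (hks.div hk₂).isHomAnalytic (hκ.isHomAnalytic.sub (hks.div hk₃).isHomAnalytic) X₁ X₂ X₃

end Rest

/-! ### Hecke translates of the pairing -/

section Translates

variable {p : Nat.Primes} {O : Type*} [NormedCommRing O] [NormedAlgebra ℚ_[p] O]
  {a b : ℤ} {θ : Quat a b ℚ_[p] ≃ₐ[ℚ_[p]] Matrix (Fin 2) (Fin 2) ℚ_[p]}
  {K : Subgroup (Bf a b)} {k₁ k₂ k₃ ks : ℤ_[p]ˣ →* Oˣ} {κ : ℤ_[p] →* O}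

theorem indicator_const_mul_mem {k : ℤ_[p]ˣ →* Oˣ} {X : Region p} {f : (Fin 2 → ℚ_[p]) → O} (c : O)
    (hf : X.carrier.indicator f ∈ homogFun k X) :
    (X.carrier.indicator fun w => c * f w) ∈ homogFun k X := by
  have h : (X.carrier.indicator fun w => c * f w) = c • X.carrier.indicator f := by
    funext w
    by_cases hw : w ∈ X.carrier <;> simp [hw]
  rw [h]
  exact Submodule.smul_mem _ _ hf

theorem deltaRest_eq_zero (hκ : IsAnalyticExtension (ks / k₃) κ) {w₁ w₂ : Fin 2 → ℚ_[p]}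
    (h : ‖delta w₁ w₂‖ = 1) (w₃ : Fin 2 → ℚ_[p]) :
    DeltaRest (ks / k₁) (ks / k₂) (ks / k₃) κ w₁ w₂ w₃ = 0 := by
  rw [DeltaRest, triDelta, hκ.intExt_eq h, sub_self, mul_zero]

/-- With the same c on both vectors, δ(w₁c, w₂c) = p·u·δ(w₁,w₂) is never a unit, so the Δ° part
disappears and κ factors over p, u and δ(w₁,w₂). In the other two pairings c moves to w₃ as its
adjugate. -/
theorem deltaRest_vecMul (hK : IsLevel θ K) (hκ : IsAnalyticExtension (ks / k₃) κ) {c : Bf a b}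
    (hc : c ∈ heckeSet θ K) {w₁ w₂ : Fin 2 → ℚ_[p]} (h₁ : w₁ ∈ (regionW p).carrier)
    (h₂ : w₂ ∈ (regionW p).carrier) (w₃ : Fin 2 → ℚ_[p]) :
    DeltaRest (ks / k₁) (ks / k₂) (ks / k₃) κ (Matrix.vecMul w₁ (matP θ c))
        (Matrix.vecMul w₂ (matP θ c)) w₃ =
      κ ((p : ℕ) : ℤ_[p]) * ((ks / k₃) (nrdP p c)⁻¹ : Oˣ) *
        DeltaFull (ks / k₁) (ks / k₂) κ w₁ w₂ (Matrix.vecMul w₃ (matP θ c).adjugate) := by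
  have hδ := norm_delta_le_one h₁ h₂
  have hu := norm_unit_coe (nrdP p c)⁻¹
  have hp := norm_prime_lt_one p
  have huδ : ‖((((nrdP p c)⁻¹ : ℤ_[p]ˣ) : ℤ_[p]) : ℚ_[p]) * delta w₁ w₂‖ ≤ 1 := by
    rw [norm_mul, hu, one_mul]
    exact hδ
  have hlt : ‖((p : ℕ) : ℚ_[p]) *
      (((((nrdP p c)⁻¹ : ℤ_[p]ˣ) : ℤ_[p]) : ℚ_[p]) * delta w₁ w₂)‖ ≠ 1 := by
    rw [norm_mul]
    exact (mul_lt_one_of_nonneg_of_lt_one_left (norm_nonneg _) hp huδ).ne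
  rw [DeltaRest, triDelta, DeltaFull, delta_vecMul_adjugate, delta_vecMul_adjugate, delta_vecMul,
    det_matP_heckeSet θ hK.isCompact hc, mul_assoc ((p : ℕ) : ℚ_[p]),
    unitExt_of_norm_ne_one _ hlt, sub_zero, intExt_mul_of_norm_le κ hp.le huδ, intExt_natCast,
    intExt_mul κ _ _ hu, hκ.intExt_eq hu, unitExt_unit]
  ring

/-- Distinct cosets make the first pairing a unit everywhere on W × W, where κ and the character k₃*
agree. -/
theorem tripleIntegral_rest_eq_zero (hK : IsLevel θ K) (hκ : IsAnalyticExtension (ks / k₃) κ)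
    (hT : TripleIntegrable k₁ k₂ k₃ (regionW p) (regionW p) (regionWhat p)
      (DeltaRest (ks / k₁) (ks / k₂) (ks / k₃) κ)) {c c' : Bf a b} (hc : c ∈ heckeSet θ K)
    (hc' : c' ∈ heckeSet θ K) (hcc : c' * c⁻¹ ∉ K) (μ₁ : HomDist k₁ (regionW p))
    (μ₂ : HomDist k₂ (regionW p)) (μ₃ : HomDist k₃ (regionWhat p)) :
    tripleIntegral (DeltaRest (ks / k₁) (ks / k₂) (ks / k₃) κ) (distAct (matP θ c) μ₁)
      (distAct (matP θ c') μ₂) μ₃ = 0 := by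
  rw [hT.distAct₁₂ (hK.regionW_stable_heckeSet hc) (hK.regionW_stable_heckeSet hc'),
    ← tripleIntegral_zero μ₁ μ₂ μ₃]
  refine tripleIntegral_congr (fun w₁ h₁ w₂ h₂ w₃ _ => deltaRest_eq_zero hκ ?_ w₃) _ _ _
  by_contra hne
  exact hcc (hK.mul_inv_mem_of_norm_delta_ne_one hc hc' h₁ h₂ hne)

theorem inv_heckeSet_iota {c : Bf a b} (hc : c ∈ heckeSet θ K) :
    central a b (zP p) * c⁻¹ ∈ heckeSetIota θ K :=
  (inv_mem_heckeSet_iff θ _).1 (by rwa [inv_inv])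

/-- With u = Nrd_p(c)⁻¹, the scalar u in the adjugate contributes k₃(u), and κ contributes (k* -
k₃)(u). Together they give k*(u), which turns Nrd_p(x)^{-k*} into Nrd_p(cx)^{-k*}. -/
theorem tripleIntegral_rest_diag (hK : IsLevel θ K) (hκ : IsAnalyticExtension (ks / k₃) κ)
    (hT : TripleIntegrable k₁ k₂ k₃ (regionW p) (regionW p) (regionWhat p)
      (DeltaRest (ks / k₁) (ks / k₂) (ks / k₃) κ))
    (hT' : TripleIntegrable k₁ k₂ k₃ (regionW p) (regionW p) (regionWhat p)
      (DeltaFull (ks / k₁) (ks / k₂) κ)) {c : Bf a b} (hc : c ∈ heckeSet θ K)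
    (μ₁ : HomDist k₁ (regionW p)) (μ₂ : HomDist k₂ (regionW p)) (μ₃ : HomDist k₃ (regionWhat p)) :
    tripleIntegral (DeltaRest (ks / k₁) (ks / k₂) (ks / k₃) κ) (distAct (matP θ c) μ₁)
        (distAct (matP θ c) μ₂) μ₃ =
      κ ((p : ℕ) : ℤ_[p]) * (ks (nrdP p c)⁻¹ : Oˣ) *
        tripleIntegral (DeltaFull (ks / k₁) (ks / k₂) κ) μ₁ μ₂
          (distAct (matP θ (central a b (zP p) * c⁻¹)) μ₃) := by
  have hst := hK.regionWhat_stable_heckeSetIota (inv_heckeSet_iota hc)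
  have hadj := hK.adjugate_matP hc
  have hst' : (regionWhat p).StableUnder (matP θ c).adjugate := by
    rw [hadj]
    exact hst.unit_smul _
  have hk : (ks / k₃) (nrdP p c)⁻¹ * k₃ (nrdP p c)⁻¹ = ks (nrdP p c)⁻¹ :=
    div_mul_cancel (ks (nrdP p c)⁻¹) (k₃ (nrdP p c)⁻¹)
  have hinv : tripleIntegral (DeltaFull (ks / k₁) (ks / k₂) κ) μ₁ μ₂
      (distAct (matP θ c).adjugate μ₃) = (k₃ (nrdP p c)⁻¹ : Oˣ) *
        tripleIntegral (DeltaFull (ks / k₁) (ks / k₂) κ) μ₁ μ₂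
          (distAct (matP θ (central a b (zP p) * c⁻¹)) μ₃) := by
    rw [hadj, distAct_unit_smul, hT'.smul_right]
  have hmul : ∀ w₁ ∈ (regionW p).carrier, ∀ w₂ ∈ (regionW p).carrier,
      distIntegral μ₃ (fun w₃ => κ ((p : ℕ) : ℤ_[p]) * ((ks / k₃) (nrdP p c)⁻¹ : Oˣ) *
        DeltaFull (ks / k₁) (ks / k₂) κ w₁ w₂ (Matrix.vecMul w₃ (matP θ c).adjugate)) =
      distIntegral ((κ ((p : ℕ) : ℤ_[p]) * ((ks / k₃) (nrdP p c)⁻¹ : Oˣ)) •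
        distAct (matP θ c).adjugate μ₃) (DeltaFull (ks / k₁) (ks / k₂) κ w₁ w₂) :=
    fun w₁ h₁ w₂ h₂ => by
      have h := hT'.inner w₁ h₁ w₂ h₂
      have h' := indicator_const_mul_mem (κ ((p : ℕ) : ℤ_[p]) * ((ks / k₃) (nrdP p c)⁻¹ : Oˣ)) h
      rw [smul_distIntegral, ← distIntegral_const_mul _ h]
      exact (distIntegral_distAct (f := fun w => κ ((p : ℕ) : ℤ_[p]) *
        ((ks / k₃) (nrdP p c)⁻¹ : Oˣ) * DeltaFull (ks / k₁) (ks / k₂) κ w₁ w₂ w) hst' μ₃ h').symm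
  calc _ = tripleIntegral (DeltaFull (ks / k₁) (ks / k₂) κ) μ₁ μ₂
        ((κ ((p : ℕ) : ℤ_[p]) * ((ks / k₃) (nrdP p c)⁻¹ : Oˣ)) •
          distAct (matP θ c).adjugate μ₃) := by
        rw [hT.distAct₁₂ (hK.regionW_stable_heckeSet hc) (hK.regionW_stable_heckeSet hc)]
        refine distIntegral_congr μ₁ fun w₁ h₁ => distIntegral_congr μ₂ fun w₂ h₂ => ?_
        rw [← hmul w₁ h₁ w₂ h₂]
        exact distIntegral_congr μ₃ fun w₃ _ => deltaRest_vecMul hK hκ hc h₁ h₂ w₃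
    _ = _ := by
        rw [hT'.smul_right, hinv, ← hk, Units.val_mul]
        ring

end Translates

/-! ### The Hecke correspondence on triples of forms -/

section Kernel

variable {p : Nat.Primes} {O : Type*} [NormedCommRing O] [NormedAlgebra ℚ_[p] O]
  {a b : ℤ} {θ : Quat a b ℚ_[p] ≃ₐ[ℚ_[p]] Matrix (Fin 2) (Fin 2) ℚ_[p]}
  {K : Subgroup (Bf a b)} {k₁ k₂ k₃ ks : ℤ_[p]ˣ →* Oˣ} {κ : ℤ_[p] →* O}
  {ω₁ ω₂ ω₃ : (∀ q : Nat.Primes, ℤ_[q]ˣ) →* Oˣ}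

omit [NormedAlgebra ℚ_[p] O] in
theorem centralChar_zP (ω : (∀ q : Nat.Primes, ℤ_[q]ˣ) →* Oˣ) (k : ℤ_[p]ˣ →* Oˣ) :
    centralChar ω k (zP p) = (ω (pPrime p))⁻¹ := by
  have h1 : unitPart (zP p) p = 1 := by
    rw [unitPart_zP, Pi.inv_apply, pPrime, dif_pos rfl]
    exact inv_one
  rw [centralChar, h1, unitPart_zP, map_inv, map_one k]
  exact (congrArg _ inv_one).trans (mul_one _)

theorem IsPadicForm.apply_level_mul {k : ℤ_[p]ˣ →* Oˣ} {X : Region p}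
    {ω : (∀ q : Nat.Primes, ℤ_[q]ˣ) →* Oˣ} {φ : Bf a b → HomDist k X} (hφ : IsPadicForm θ K ω φ)
    {u : Bf a b} (hu : u ∈ K) (x : Bf a b) : φ (u * x) = distAct (matP θ u⁻¹) (φ x) := by
  rw [← hφ.level u⁻¹ (inv_mem hu) (u * x), inv_mul_cancel_left]

/-- Thus a summand of a Hecke operator depends only on the coset of its representative. -/
theorem IsPadicForm.distAct_level_mul (hK : IsLevel θ K) {k : ℤ_[p]ˣ →* Oˣ}
    {ω : (∀ q : Nat.Primes, ℤ_[q]ˣ) →* Oˣ} {φ : Bf a b → HomDist k (regionWhat p)}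
    (hφ : IsPadicForm θ K ω φ) {u : Bf a b} (hu : u ∈ K) (τ x : Bf a b) :
    distAct (matP θ (u * τ)) (φ (u * x)) = distAct (matP θ τ) (φ x) := by
  rw [matP_mul, ← distAct_mul (hK.regionWhat_stable hu), hφ.level u hu]

variable (θ ks κ) in
/-- The kernel of the Hecke correspondence acting on the pairing of three forms. -/
def heckeKernel (φ₁ : Bf a b → HomDist k₁ (regionW p)) (φ₂ : Bf a b → HomDist k₂ (regionW p))
    (φ₃ : Bf a b → HomDist k₃ (regionWhat p)) (y x : Bf a b) : O :=
  tripleIntegral (DeltaFull (ks / k₁) (ks / k₂) κ) (φ₁ y) (φ₂ y)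
    (distAct (matP θ (central a b (zP p) * x * y⁻¹)) (φ₃ (central a b (zP p) * x))) *
      (((ks (nrdP p y))⁻¹ : Oˣ) : O)

variable {φ₁ : Bf a b → HomDist k₁ (regionW p)} {φ₂ : Bf a b → HomDist k₂ (regionW p)}
  {φ₃ : Bf a b → HomDist k₃ (regionWhat p)}

theorem heckeKernel_mul_diag (ha : a < 0) (hb : b < 0) (hφ₁ : IsPadicForm θ K ω₁ φ₁)
    (hφ₂ : IsPadicForm θ K ω₂ φ₂) (hφ₃ : IsPadicForm θ K ω₃ φ₃) (γ : (Quat a b ℚ)ˣ)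
    (x y : Bf a b) : heckeKernel θ ks κ φ₁ φ₂ φ₃ (y * diag a b γ) (x * diag a b γ) =
      heckeKernel θ ks κ φ₁ φ₂ φ₃ y x := by
  have h1 : central a b (zP p) * (x * diag a b γ) * (y * diag a b γ)⁻¹ =
      central a b (zP p) * x * y⁻¹ := by group
  have h2 : nrdP p (y * diag a b γ) = nrdP p y := by
    rw [nrdP_mul, nrdP_diag ha hb]
    exact mul_one _
  rw [heckeKernel, h1, h2, hφ₁.right_invariant, hφ₂.right_invariant, ← mul_assoc,
    hφ₃.right_invariant]
  rfl

/-- The factor v is absorbed by the level condition on φ₃. The factor u makes u⁻¹ act on all three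
distributions at once; its determinant at p is Nrd_p(u), and the resulting k*-power cancels the
change in Nrd_p(y)^{-k*}. -/
theorem heckeKernel_level_mul (hK : IsLevel θ K) (hκ : IsAnalyticExtension (ks / k₃) κ)
    (hks2 : ks ^ 2 = k₁ * k₂ * k₃)
    (hT : TripleIntegrable k₁ k₂ k₃ (regionW p) (regionW p) (regionWhat p)
      (DeltaFull (ks / k₁) (ks / k₂) κ)) (hφ₁ : IsPadicForm θ K ω₁ φ₁)
    (hφ₂ : IsPadicForm θ K ω₂ φ₂) (hφ₃ : IsPadicForm θ K ω₃ φ₃) {u v : Bf a b} (hu : u ∈ K)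
    (hv : v ∈ K) {x y : Bf a b} (hyx : y * x⁻¹ ∈ heckeSet θ K) :
    heckeKernel θ ks κ φ₁ φ₂ φ₃ (u * y) (v * x) = heckeKernel θ ks κ φ₁ φ₂ φ₃ y x := by
  have hu' := inv_mem hu
  have hτ : (regionWhat p).StableUnder (matP θ (central a b (zP p) * x * y⁻¹)) := by
    have := hK.regionWhat_stable_heckeSetIota (inv_heckeSet_iota hyx)
    rwa [mul_inv_rev, inv_inv, ← mul_assoc] at this
  have h1 : central a b (zP p) * (v * x) * (u * y)⁻¹ =
      v * ((central a b (zP p) * x * y⁻¹) * u⁻¹) := by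
    rw [← mul_assoc, central_mul_comm _ v]
    group
  have h2 : central a b (zP p) * (v * x) = v * (central a b (zP p) * x) := by
    rw [← mul_assoc, central_mul_comm _ v, mul_assoc]
  have hμ₃ : distAct (matP θ (central a b (zP p) * (v * x) * (u * y)⁻¹))
      (φ₃ (central a b (zP p) * (v * x))) = distAct (matP θ u⁻¹)
        (distAct (matP θ (central a b (zP p) * x * y⁻¹)) (φ₃ (central a b (zP p) * x))) := by
    rw [h1, h2, hφ₃.distAct_level_mul hK hv, matP_mul, distAct_mul hτ]
  have hdet : (matP θ u⁻¹).det = (((nrdP p u : ℤ_[p]ˣ) : ℤ_[p]) : ℚ_[p]) := by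
    have h : (nrdP p u⁻¹)⁻¹ = nrdP p u := by
      refine inv_eq_of_mul_eq_one_left ?_
      rw [← nrdP_mul, mul_inv_cancel]
      have h3 : nrdP p (1 : Bf a b) * nrdP p (1 : Bf a b) = nrdP p (1 : Bf a b) := by
        rw [← nrdP_mul, mul_one]
      exact mul_eq_left.1 h3
    rw [det_matP_level θ hK.isCompact hu', h]
  have hks : (ks (nrdP p u) : O) * (((ks (nrdP p (u * y)))⁻¹ : Oˣ) : O) =
      (((ks (nrdP p y))⁻¹ : Oˣ) : O) := by
    rw [nrdP_mul, map_mul, ← Units.val_mul, mul_inv, mul_inv_cancel_left]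
  have hpair : tripleIntegral (DeltaFull (ks / k₁) (ks / k₂) κ) (φ₁ (u * y)) (φ₂ (u * y))
      (distAct (matP θ (central a b (zP p) * (v * x) * (u * y)⁻¹))
        (φ₃ (central a b (zP p) * (v * x)))) = (ks (nrdP p u) : O) *
      tripleIntegral (DeltaFull (ks / k₁) (ks / k₂) κ) (φ₁ y) (φ₂ y)
        (distAct (matP θ (central a b (zP p) * x * y⁻¹)) (φ₃ (central a b (zP p) * x))) := by
    rw [hμ₃, hφ₁.apply_level_mul hu, hφ₂.apply_level_mul hu,
      hT.distAct₁₂₃ (hK.regionW_stable hu') (hK.regionW_stable hu') (hK.regionWhat_stable hu'),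
      ← hT.tripleIntegral_const_mul]
    exact tripleIntegral_congr (fun w₁ _ w₂ _ w₃ _ => deltaFull_vecMul hκ hks2 hdet w₁ w₂ w₃) _ _ _
  rw [heckeKernel, hpair, heckeKernel, ← hks]
  ring

/-- Expansion of the pairing supported on non-units through the eigenvalues of `U_p`. -/
theorem mul_rest_eq_finsum (hK : IsLevel θ K) (hκ : IsAnalyticExtension (ks / k₃) κ)
    (hT : TripleIntegrable k₁ k₂ k₃ (regionW p) (regionW p) (regionWhat p)
      (DeltaRest (ks / k₁) (ks / k₂) (ks / k₃) κ))
    (hT' : TripleIntegrable k₁ k₂ k₃ (regionW p) (regionW p) (regionWhat p)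
      (DeltaFull (ks / k₁) (ks / k₂) κ)) (hφ₃ : IsPadicForm θ K ω₃ φ₃) {α₁ α₂ : O}
    (h₁ : Up θ K φ₁ = α₁ • φ₁) (h₂ : Up θ K φ₂ = α₂ • φ₂) (x : Bf a b) :
    α₁ * α₂ * (tripleIntegral (DeltaRest (ks / k₁) (ks / k₂) (ks / k₃) κ) (φ₁ x) (φ₂ x) (φ₃ x) *
        (((ks (nrdP p x))⁻¹ : Oˣ) : O)) =
      κ ((p : ℕ) : ℤ_[p]) * (ω₃ (pPrime p) : O) *
        ∑ᶠ (q : RightCosets K) (_ : q.out ∈ heckeSet θ K),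
          heckeKernel θ ks κ φ₁ φ₂ φ₃ (q.out * x) x := by
  classical
  have hfin : {q : RightCosets K | q.out ∈ heckeSet θ K}.Finite :=
    finite_out_mem hK.isOpen (isCompact_doubleCoset hK.isCompact _)
  have hU : ∀ {k : ℤ_[p]ˣ →* Oˣ} (φ : Bf a b → HomDist k (regionW p)), Up θ K φ x =
      ∑ q ∈ hfin.toFinset, distAct (matP θ q.out) (φ (q.out * x)) := fun φ =>
    finsum_mem_eq_finite_toFinset_sum _ hfin
  have e₁ : α₁ • φ₁ x = ∑ q ∈ hfin.toFinset, distAct (matP θ q.out) (φ₁ (q.out * x)) := by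
    rw [← hU, h₁, Pi.smul_apply]
  have e₂ : α₂ • φ₂ x = ∑ q ∈ hfin.toFinset, distAct (matP θ q.out) (φ₂ (q.out * x)) := by
    rw [← hU, h₂, Pi.smul_apply]
  -- The central idele needed to form a representative of U_p^ι is inserted at the cost of ω₃(p').
  have hφ₃z : φ₃ x = (ω₃ (pPrime p) : O) • φ₃ (central a b (zP p) * x) := by
    rw [hφ₃.central_char, centralChar_zP, smul_smul, Units.mul_inv, one_smul]
  have hsum : (∑ᶠ (q : RightCosets K) (_ : q.out ∈ heckeSet θ K),
      heckeKernel θ ks κ φ₁ φ₂ φ₃ (q.out * x) x) = ∑ q ∈ hfin.toFinset,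
        heckeKernel θ ks κ φ₁ φ₂ φ₃ (q.out * x) x := finsum_mem_eq_finite_toFinset_sum _ hfin
  have hpair : α₁ * α₂ * tripleIntegral (DeltaRest (ks / k₁) (ks / k₂) (ks / k₃) κ)
      (φ₁ x) (φ₂ x) (φ₃ x) = hT.linear (α₁ • φ₁ x) (α₂ • φ₂ x) (φ₃ x) := by
    rw [map_smul, LinearMap.smul_apply, map_smul, LinearMap.smul_apply, LinearMap.smul_apply,
      hT.linear_apply, smul_eq_mul, smul_eq_mul, mul_comm α₁, mul_assoc]
  rw [← mul_assoc, hpair, e₁, e₂, map_sum, LinearMap.sum_apply, hsum, Finset.mul_sum, Finset.sum_mul]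
  refine Finset.sum_congr rfl fun q hq => ?_
  have hq' : q.out ∈ heckeSet θ K := hfin.mem_toFinset.1 hq
  -- Of the double sum over pairs of cosets only the diagonal survives.
  rw [map_sum, LinearMap.sum_apply, LinearMap.sum_apply, Finset.sum_eq_single q]
  · rw [hT.linear_apply, tripleIntegral_rest_diag hK hκ hT hT' hq', hφ₃z]
    have hdist : ∀ (σ : Matrix (Fin 2) (Fin 2) ℚ_[p]) (c : O) (ν : HomDist k₃ (regionWhat p)),
      distAct σ (c • ν) = c • distAct σ ν := fun _ _ _ => rfl
    have hτ : central a b (zP p) * x * (q.out * x)⁻¹ = central a b (zP p) * q.out⁻¹ := by group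
    have hks : (ks (nrdP p q.out)⁻¹ : O) * (((ks (nrdP p x))⁻¹ : Oˣ) : O) =
        (((ks (nrdP p (q.out * x)))⁻¹ : Oˣ) : O) := by
      rw [nrdP_mul, map_mul, map_inv, ← Units.val_mul, mul_inv]
    rw [hdist, hT'.smul_right, heckeKernel, hτ, ← hks]
    ring
  · intro q' hq₂ hne
    rw [hT.linear_apply]
    refine tripleIntegral_rest_eq_zero hK hκ hT (hfin.mem_toFinset.1 hq₂) hq' (fun h => hne ?_) _ _ _
    rw [← Quotient.out_eq q, ← Quotient.out_eq q']
    exact (rightCosets_mk_eq_iff K).2 h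
  · exact fun h => absurd hq h

/-- Contraction of the kernel through the eigenvalue of `U_p^ι`. -/
theorem finsum_heckeKernel_eq (hK : IsLevel θ K)
    (hT : TripleIntegrable k₁ k₂ k₃ (regionW p) (regionW p) (regionWhat p)
      (DeltaFull (ks / k₁) (ks / k₂) κ)) (hφ₃ : IsPadicForm θ K ω₃ φ₃) {α₃ : O}
    (h₃ : UpIota θ K φ₃ = α₃ • φ₃) (x : Bf a b) :
    ∑ᶠ (q : RightCosets K) (_ : q.out⁻¹ ∈ heckeSet θ K),
        heckeKernel θ ks κ φ₁ φ₂ φ₃ x (q.out * x) =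
      α₃ * (tripleIntegral (DeltaFull (ks / k₁) (ks / k₂) κ) (φ₁ x) (φ₂ x) (φ₃ x) *
        (((ks (nrdP p x))⁻¹ : Oˣ) : O)) := by
  classical
  have hfin : {q : RightCosets K | q.out ∈ heckeSetIota θ K}.Finite :=
    finite_out_mem hK.isOpen (isCompact_doubleCoset hK.isCompact _)
  set z := central a b (zP p)
  set f : RightCosets K → O := fun q => tripleIntegral (DeltaFull (ks / k₁) (ks / k₂) κ)
    (φ₁ x) (φ₂ x) (distAct (matP θ q.out) (φ₃ (q.out * x))) * (((ks (nrdP p x))⁻¹ : Oˣ) : O)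
  have hreindex : ∑ᶠ (q : RightCosets K) (_ : q.out⁻¹ ∈ heckeSet θ K),
      heckeKernel θ ks κ φ₁ φ₂ φ₃ x (q.out * x) =
        ∑ᶠ (q : RightCosets K) (_ : q.out ∈ heckeSetIota θ K), f q := by
    -- Translation by the central idele matches cosets whose inverses lie in the U_p double coset
    -- with cosets in that of U_p^ι. The chosen representatives differ by an element of `K`, which
    -- changes neither the membership condition nor the summand.
    refine finsum_eq_of_bijective (rightTranslate K z) (rightTranslate_bijective K z) fun q => ?_
    set r := rightTranslate K z q
    obtain ⟨g, hr, hrq⟩ : ∃ g ∈ K, r.out = g * (z * q.out) := by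
      refine ⟨r.out * (z * q.out)⁻¹, (rightCosets_mk_eq_iff K).1 ?_, by group⟩
      rw [Quotient.out_eq, central_mul_comm, ← rightTranslate_mk, Quotient.out_eq]
    have hmem : q.out⁻¹ ∈ heckeSet θ K ↔ r.out ∈ heckeSetIota θ K := by
      rw [inv_mem_heckeSet_iff, hrq]
      refine ⟨fun h => ?_, fun h => ?_⟩
      · obtain ⟨u, hu, v, hv, h⟩ := DoubleCoset.mem_doubleCoset.1 h
        refine DoubleCoset.mem_doubleCoset.2 ⟨_, mul_mem hr hu, v, hv, ?_⟩
        rw [h]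
        simp only [mul_assoc]
      · obtain ⟨u, hu, v, hv, h⟩ := DoubleCoset.mem_doubleCoset.1 h
        refine DoubleCoset.mem_doubleCoset.2 ⟨_, mul_mem (inv_mem hr) hu, v, hv, ?_⟩
        rw [eq_inv_mul_of_mul_eq h]
        simp only [mul_assoc]
    have hval : heckeKernel θ ks κ φ₁ φ₂ φ₃ x (q.out * x) = f r := by
      have hτ : z * (q.out * x) * x⁻¹ = z * q.out := by group
      have h1 : distAct (matP θ r.out) (φ₃ (r.out * x)) =
          distAct (matP θ (z * q.out)) (φ₃ (z * (q.out * x))) := by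
        rw [hrq, mul_assoc _ _ x, hφ₃.distAct_level_mul hK hr, mul_assoc]
      simp only [f]
      rw [h1, heckeKernel, hτ]
    rw [hval]
    exact finsum_congr_Prop (propext hmem) fun _ => rfl
  have e₃ : α₃ • φ₃ x = ∑ q ∈ hfin.toFinset, distAct (matP θ q.out) (φ₃ (q.out * x)) := by
    have h := congrFun h₃ x
    rw [Pi.smul_apply] at h
    exact h.symm.trans (finsum_mem_eq_finite_toFinset_sum _ hfin)
  have hsum : ∑ᶠ (q : RightCosets K) (_ : q.out ∈ heckeSetIota θ K), f q =
    ∑ q ∈ hfin.toFinset, f q := finsum_mem_eq_finite_toFinset_sum _ hfin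
  have hlin : hT.linear (φ₁ x) (φ₂ x) (α₃ • φ₃ x) = α₃ *
      tripleIntegral (DeltaFull (ks / k₁) (ks / k₂) κ) (φ₁ x) (φ₂ x) (φ₃ x) := by
    rw [map_smul, hT.linear_apply, smul_eq_mul]
  rw [hreindex, hsum, ← mul_assoc, ← hlin, e₃, map_sum, Finset.sum_mul]
  rfl

end Kernel

/-! ### Traces over the class set and conclusion -/

theorem trace_eq_smul {a b : ℤ} (p : Nat.Primes) {O : Type*} [NormedCommRing O]
    [NormedAlgebra ℚ_[p] O] (μ : MeasureTheory.Measure (Bf a b)) (K : Subgroup (Bf a b))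
    (f : Bf a b → O) : trace p μ K f = (ratVol μ K : ℚ_[p]) •
      ∑ᶠ c : DoubleCoset.Quotient (K : Set (Bf a b)) ((diag a b).range : Set (Bf a b)),
        (Nat.card {γ : (Quat a b ℚ)ˣ | Quotient.out c * diag a b γ * (Quotient.out c)⁻¹ ∈ K} :
          ℚ_[p])⁻¹ • f (Quotient.out c) := by
  rw [smul_finsum]
  refine finsum_congr fun c => ?_
  rw [smul_smul, Rat.cast_div, Rat.cast_natCast, div_eq_mul_inv]
  rfl

theorem trace_const_mul {a b : ℤ} (p : Nat.Primes) {O : Type*} [NormedCommRing O]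
    [NormedAlgebra ℚ_[p] O] (μ : MeasureTheory.Measure (Bf a b)) (K : Subgroup (Bf a b))
    [Finite (DoubleCoset.Quotient (K : Set (Bf a b)) ((diag a b).range : Set (Bf a b)))] (c : O)
    (f : Bf a b → O) : trace p μ K (fun x => c * f x) = c * trace p μ K f := by
  rw [trace, trace, mul_finsum' _ _ (Set.toFinite _)]
  exact finsum_congr fun d => (mul_smul_comm _ _ _).symm

theorem trace_add {a b : ℤ} (p : Nat.Primes) {O : Type*} [NormedCommRing O]
    [NormedAlgebra ℚ_[p] O] (μ : MeasureTheory.Measure (Bf a b)) (K : Subgroup (Bf a b))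
    [Finite (DoubleCoset.Quotient (K : Set (Bf a b)) ((diag a b).range : Set (Bf a b)))]
    (f g : Bf a b → O) : trace p μ K (fun x => f x + g x) = trace p μ K f + trace p μ K g := by
  rw [trace, trace, trace, ← finsum_add_distrib (Set.toFinite _) (Set.toFinite _)]
  exact finsum_congr fun d => smul_add _ _ _

end TripleProduct

end

theorem corollaryC (p : Nat.Primes) {O : Type*} [NormedCommRing O] [NormedAlgebra ℚ_[p] O]
    [CompleteSpace O] [IsUltrametricDist O]
    -- the definite quaternion algebra `B = (a, b)` over `ℚ`, split at `p`
    (a b : ℤ) (ha : a < 0) (hb : b < 0)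
    (θ : Quat a b ℚ_[p] ≃ₐ[ℚ_[p]] Matrix (Fin 2) (Fin 2) ℚ_[p])
    -- a Haar measure on `B_f^×` with rational values on open compact subgroups
    (μ : MeasureTheory.Measure (Bf a b)) [μ.IsHaarMeasure]
    (hμ : ∃ (U : Subgroup (Bf a b)) (c : ℚ), IsOpen (U : Set (Bf a b)) ∧
      IsCompact (U : Set (Bf a b)) ∧ 0 ≤ c ∧ μ (U : Set (Bf a b)) = ENNReal.ofReal (c : ℝ))
    -- weights, `2 k* = k₁ + k₂ + k₃`, and the extension of `k₃* = k* - k₃` to `ℤ_p`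
    (k₁ k₂ k₃ ks : ℤ_[p]ˣ →* Oˣ) (hk₁ : IsWeight k₁) (hk₂ : IsWeight k₂) (hk₃ : IsWeight k₃)
    (hks : IsWeight ks) (hks2 : ks ^ 2 = k₁ * k₂ * k₃)
    (κ : ℤ_[p] →* O) (hκ : IsAnalyticExtension (ks / k₃) κ)
    -- the tame central characters
    (ω₁ ω₂ ω₃ : (∀ q : Nat.Primes, ℤ_[q]ˣ) →* Oˣ) (hω : ω₁ * ω₂ * ω₃ = 1)
    -- a level `K = K^p × Γ₀(pℤ_p)` and forms of that level
    (K : Subgroup (Bf a b)) (hK : IsLevel θ K)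
    (φ₁ : Bf a b → HomDist k₁ (regionW p)) (hφ₁ : IsPadicForm θ K ω₁ φ₁)
    (φ₂ : Bf a b → HomDist k₂ (regionW p)) (hφ₂ : IsPadicForm θ K ω₂ φ₂)
    (φ₃ : Bf a b → HomDist k₃ (regionWhat p)) (hφ₃ : IsPadicForm θ K ω₃ φ₃)
    -- eigenvalues
    (α₁ α₂ : Oˣ) (α₃ : O)
    (h₁ : Up θ K φ₁ = (α₁ : O) • φ₁) (h₂ : Up θ K φ₂ = (α₂ : O) • φ₂)
    (h₃ : UpIota θ K φ₃ = α₃ • φ₃) :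
    trilinear μ K ks (DeltaCirc (ks / k₁) (ks / k₂) (ks / k₃)) φ₁ φ₂ φ₃ =
      (1 - (ω₃ (pPrime p) : O) * (α₃ * (((α₁ * α₂)⁻¹ : Oˣ) : O)) * κ (p : ℕ)) *
        trilinear μ K ks (DeltaFull (ks / k₁) (ks / k₂) κ) φ₁ φ₂ φ₃ := by
  have := finite_doubleCoset_quotient ha hb hK.isOpen
  have hF := tripleIntegrable_deltaFull hk₁ hk₂ hks hks2 hκ (regionW p) (regionW p) (regionWhat p)
  have hC := tripleIntegrable_deltaCirc hk₁ hk₂ hk₃ hks hks2 (regionW p) (regionW p) (regionWhat p)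
  have hR := tripleIntegrable_deltaRest hk₁ hk₂ hk₃ hks hks2 hκ (regionW p) (regionW p)
    (regionWhat p)
  set F : Bf a b → O := fun x => tripleIntegral (DeltaFull (ks / k₁) (ks / k₂) κ) (φ₁ x) (φ₂ x)
    (φ₃ x) * (((ks (nrdP p x))⁻¹ : Oˣ) : O) with hFdef
  set C : Bf a b → O := fun x => tripleIntegral (DeltaCirc (ks / k₁) (ks / k₂) (ks / k₃)) (φ₁ x)
    (φ₂ x) (φ₃ x) * (((ks (nrdP p x))⁻¹ : Oˣ) : O) with hCdef
  set R : Bf a b → O := fun x => tripleIntegral (DeltaRest (ks / k₁) (ks / k₂) (ks / k₃) κ) (φ₁ x)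
    (φ₂ x) (φ₃ x) * (((ks (nrdP p x))⁻¹ : Oˣ) : O) with hRdef
  -- By additivity it remains to evaluate the trace `R` of the part supported on non-units.
  have hsplit : trace p μ K F = trace p μ K C + trace p μ K R := by
    rw [← trace_add]
    refine congrArg (trace p μ K) (funext fun x => ?_)
    simp only [hFdef, hCdef, hRdef]
    rw [← add_mul, ← hC.tripleIntegral_add hR]
    exact congrArg (· * _) (tripleIntegral_congr
      (fun w₁ _ w₂ _ w₃ _ => deltaFull_eq (ks / k₁) (ks / k₂) (ks / k₃) κ w₁ w₂ w₃) _ _ _)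
  -- The open side goal is the bi-`K`-invariance of the double coset.
  have hadj := hecke_adjoint (R := ℚ_[p]) K (diag a b) (finite_arithGroup ha hb hK.isCompact)
    (heckeSet θ K) ?_ (finite_out_mem hK.isOpen (isCompact_doubleCoset hK.isCompact _))
    (heckeKernel θ ks κ φ₁ φ₂ φ₃)
    (fun u hu v hv x y h => heckeKernel_level_mul hK hκ hks2 hF hφ₁ hφ₂ hφ₃ hu hv h)
    (fun γ x y _ => heckeKernel_mul_diag ha hb hφ₁ hφ₂ hφ₃ γ x y)
  · have hleft : ((α₁ * α₂ : Oˣ) : O) * trace p μ K R =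
        κ ((p : ℕ) : ℤ_[p]) * (ω₃ (pPrime p) : O) * (α₃ * trace p μ K F) := by
      -- The correspondence is summed along its other projection, where the inner sum is U_p^ι
      -- applied to φ₃.
      have h : trace p μ K (fun x => ∑ᶠ (q : RightCosets K) (_ : q.out ∈ heckeSet θ K),
          heckeKernel θ ks κ φ₁ φ₂ φ₃ (q.out * x) x) = trace p μ K fun x => α₃ * F x := by
        rw [trace_eq_smul, trace_eq_smul, hadj]
        simp only [finsum_heckeKernel_eq hK hF hφ₃ h₃]
        rfl
      rw [← trace_const_mul, ← trace_const_mul, ← h, ← trace_const_mul]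
      refine congrArg (trace p μ K) (funext fun x => ?_)
      rw [Units.val_mul]
      exact mul_rest_eq_finsum hK hκ hR hF hφ₃ h₁ h₂ x
    have hrest : trace p μ K R = (ω₃ (pPrime p) : O) * (α₃ * (((α₁ * α₂)⁻¹ : Oˣ) : O)) *
        κ ((p : ℕ) : ℤ_[p]) * trace p μ K F := by
      rw [← Units.inv_mul_cancel_left (α₁ * α₂) (trace p μ K R), hleft]
      ring
    change trace p μ K C = _ * trace p μ K F
    rw [sub_mul, one_mul, ← hrest, hsplit, add_sub_cancel_right]
  · intro u hu v hv x
    constructor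
    · intro h
      obtain ⟨u', hu', v', hv', h⟩ := DoubleCoset.mem_doubleCoset.1 h
      refine DoubleCoset.mem_doubleCoset.2
        ⟨_, mul_mem (inv_mem hu) hu', _, mul_mem hv' (inv_mem hv), ?_⟩
      have hx : x = u⁻¹ * (u * x * v) * v⁻¹ := by group
      rw [hx, h]
      group
    · intro h
      obtain ⟨u', hu', v', hv', h⟩ := DoubleCoset.mem_doubleCoset.1 h
      refine DoubleCoset.mem_doubleCoset.2 ⟨_, mul_mem hu hu', _, mul_mem hv' hv, ?_⟩
      rw [h]
      group
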